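/- Let $(r,\sigma)$ be a pair with either $\sigma=-1$, $r\ge 1$, or $\sigma=+1$, $r\ge 3$ ($r$ an integer), and let $\lambda=\frac{r+\sqrt{r^2-4\sigma}}2>1$. Let $\mathbb T^2=\mathbb R^2/\mathbb Z^2$. **Compacta.** For $\sigma=-1$ let $C=\mathfrak X_r$ be the set of sequences $(\varepsilon_n)_{n\in\mathbb Z}$ with $0\le\varepsilon_n\le r$ such that $\varepsilon_n=r$ implies $\varepsilon_{n+1}=0$. For $\sigma=+1$ let $C=\mathfrak Y_r$ be the set of sequences with $0\le\varepsilon_n\le r-1$ which contain no block $(r-1)(r-2)^{j}(r-1)$, $j\ge 0$. Both carry the product topology. **Identifications.** Let $\mathfrak R_1$ (on $\mathfrak X_r$), resp. $\mathfrak R_2$ (on $\mathfrak Y_r$), be the smallest closed equivalence relation that identifies the following pairs of sequences of $C$, where $*$ is one and the same arbitrary tail and corresponding digits stand at the same place: * $\mathfrak R_1$: $(*\,k,r,0,r,0,\dots)\sim(*\,k+1,0,0,0,\dots)$ and $(\dots,0,r,0,r,0,k\,*)\sim(\dots,r,0,r,0,r-1,k+1\,*)$, for $0\le k\le r-1$;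 * $\mathfrak R_2$: $(*\,k,r-1,r-2,r-2,\dots)\sim(*\,k+1,0,0,\dots)$ and $(\dots,r-2,r-2,r-1,k\,*)\sim(\dots,0,0,0,k+1\,*)$, for $0\le k\le r-2$. Let $C'$ be the factor space ($\mathfrak X_r'=\mathfrak X_r/\mathfrak R_1$, resp. $\mathfrak Y_r'=\mathfrak Y_r/\mathfrak R_2$) with the quotient topology, and $[\varepsilon]\in C'$ the class of $\varepsilon\in C$. Say that $z\in C$ is a *two-sided normalization* of a sequence $x\in\mathbb Z_{\ge0}^{\mathbb Z}$ if $\mathbb Z$ can be cut into finite intervals $I_j$, $j\in\mathbb Z$ (in increasing order), such that $\sum_{n\in I_j}x_n\lambda^{-n}=\sum_{n\in I_j}z_n\lambda^{-n}$ for every $j$. **Coding maps.** Let $\widetilde{\mathfrak X}$ be the semigroup of sequences $\varepsilon\in\mathbb Z_{\ge 0}^{\mathbb Z}$ for which $\sum_{n\ge1}\varepsilon_n\lambda^{-n}$ and $\sum_{n\ge1}\varepsilon_{-n}\lambda^{-n}$ converge, with coordinatewise addition, and $(\tau\varepsilon)_n=\varepsilon_{n+1}$ the shift. Let $T$ be an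 automorphism of $\mathbb T^2$ given by an integer $2\times2$ matrix $M$ with trace $r$ and determinant $\sigma$. A *coding map* for $T$ is a map $\varphi:\widetilde{\mathfrak X}\to\mathbb T^2$ with $\varphi(\varepsilon+\varepsilon')=\varphi(\varepsilon)+\varphi(\varepsilon')$ and $\varphi\tau=T\varphi$, whose restriction to each set $\{\varepsilon: \varepsilon_n\le B \text{ for all } n\}$, $B\in\mathbb N$, is continuous in the product topology. An *arithmetic coding* is a coding map that maps $C$ onto $\mathbb T^2$. **Claim.** 1. $C'$ is a compact Hausdorff space, and there is exactly one structure of abelian topological group on $C'$ such that, for all $\varepsilon,\varepsilon',z\in C$: $[\varepsilon]+[\varepsilon']=[z]$ whenever $z$ is a two-sided normalization of $(\varepsilon_n+\varepsilon'_n)_n$; and $-[\varepsilon]=[z]$ whenever $z$ is a two-sided normalization of $(r-\varepsilon_n)_n$ if $\sigma=-1$, resp. of $(2(r-2)-\varepsilon_n)_n$ if $\sigma=+1$. 2. For every $T$ as above and every coding map $\varphi$ for $T$, there is a continuous group homomorphism $\varphi':C'\to\mathbb T^2$ with $\varphi'([\varepsilon])=\varphi(\varepsilon)$ for all $\varepsilon\in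 C$. 3. If moreover $\varphi$ is not identically $\mathbf 0$ on $C$ (in particular, if $\varphi$ is an arithmetic coding), then $\varphi'$ is onto, and there is an integer $K\ge1$ such that every fibre of $\varphi'$ has exactly $K$ elements, and such that $\varphi|_C$ is $K$-to-$1$ almost everywhere: $\#\{\varepsilon\in C:\varphi(\varepsilon)=\varphi'(p)\}=K$ for almost every $p\in C'$ with respect to Haar measure $\mu$ on $C'$, and $\#\{\varepsilon\in C:\varphi(\varepsilon)=x\}=K$ for Lebesgue almost every $x\in\mathbb T^2$. -/

import Mathlib

noncomputable section

namespace ArithCoding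

/-- The two-dimensional torus `ℝ² / ℤ²`, with Lebesgue (= Haar probability) measure `volume`. -/
abbrev Torus : Type := Fin 2 → UnitAddCircle

/-- The endomorphism of the torus given by an integer matrix. -/
def toralMap (M : Matrix (Fin 2) (Fin 2) ℤ) (x : Torus) : Torus :=
  fun i => ∑ j, M i j • x j

/-- The larger eigenvalue `(r + √(r² - 4σ)) / 2` of a matrix of trace `r` and determinant `σ`. -/
def dominantRoot (r : ℕ) (σ : ℤ) : ℝ :=
  ((r : ℝ) + Real.sqrt ((r : ℝ) ^ 2 - 4 * (σ : ℝ))) / 2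

/-- Two-sided sequences of nonnegative integers such that `∑_{n ≥ 1} ε_n lam⁻ⁿ` and
`∑_{n ≥ 1} ε_{-n} lam⁻ⁿ` converge. -/
def primarySpace (lam : ℝ) : Set (ℤ → ℕ) :=
  {ε | Summable (fun n : ℕ => (ε ((n : ℤ) + 1) : ℝ) / lam ^ (n + 1)) ∧
       Summable (fun n : ℕ => (ε (-((n : ℤ) + 1)) : ℝ) / lam ^ (n + 1))}

/-- The two-sided shift, `(τ ε)_n = ε_{n+1}`. -/
def shift (ε : ℤ → ℕ) : ℤ → ℕ := fun n => ε (n + 1)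

/-- `φ`, defined on `primarySpace lam` (its values elsewhere play no role), is a homomorphism of
semigroups into the torus which turns the shift into the toral automorphism of `M`, and is
continuous for coordinatewise convergence along sequences with uniformly bounded digits. -/
structure IsCodingMap (M : Matrix (Fin 2) (Fin 2) ℤ) (lam : ℝ) (φ : (ℤ → ℕ) → Torus) : Prop where
  map_add : ∀ a ∈ primarySpace lam, ∀ b ∈ primarySpace lam, φ (a + b) = φ a + φ b
  map_shift : ∀ a ∈ primarySpace lam, φ (shift a) = toralMap M (φ a)
  continuousOn : ∀ B : ℕ, ContinuousOn φ {ε | ∀ n, ε n ≤ B}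

/-- The Markov compactum: digits `0, …, r`, each digit `r` being followed by `0`. -/
def markovCompactum (r : ℕ) : Set (ℤ → ℕ) :=
  {ε | ∀ n, ε n ≤ r ∧ (ε n = r → ε (n + 1) = 0)}

/-- The sofic compactum (used for `3 ≤ r`): digits `0, …, r - 1`, and no block
`(r-1)(r-2)^j(r-1)` with `j ≥ 0`. -/
def soficCompactum (r : ℕ) : Set (ℤ → ℕ) :=
  {ε | (∀ n, ε n ≤ r - 1) ∧
    ∀ (n : ℤ) (j : ℕ), ¬ (ε n = r - 1 ∧ (∀ i : ℕ, i < j → ε (n + 1 + i) = r - 2) ∧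
      ε (n + 1 + j) = r - 1)}

/-- `(* k, r, 0, r, 0, …) ∼ (* k+1, 0, 0, 0, …)` with `k ≤ r - 1` at place `N`. -/
def MarkovGlueRight (r : ℕ) (a b : ℤ → ℕ) : Prop :=
  ∃ (N : ℤ) (k : ℕ), k < r ∧ (∀ n < N, a n = b n) ∧ a N = k ∧ b N = k + 1 ∧
    (∀ i : ℕ, a (N + 1 + 2 * i) = r ∧ a (N + 2 + 2 * i) = 0) ∧ ∀ n > N, b n = 0

/-- `(… 0, r, 0, r, 0, k *) ∼ (… r, 0, r, 0, r-1, k+1 *)` with `k ≤ r - 1` at place `N`. -/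
def MarkovGlueLeft (r : ℕ) (a b : ℤ → ℕ) : Prop :=
  ∃ (N : ℤ) (k : ℕ), k < r ∧ (∀ n > N, a n = b n) ∧ a N = k ∧ b N = k + 1 ∧
    (∀ i : ℕ, a (N - 1 - 2 * i) = 0 ∧ a (N - 2 - 2 * i) = r) ∧
    b (N - 1) = r - 1 ∧ ∀ i : ℕ, b (N - 2 - 2 * i) = 0 ∧ b (N - 3 - 2 * i) = r

/-- `(* k, r-1, r-2, r-2, …) ∼ (* k+1, 0, 0, 0, …)` with `k ≤ r - 2` at place `N`. -/
def SoficGlueRight (r : ℕ) (a b : ℤ → ℕ) : Prop :=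
  ∃ (N : ℤ) (k : ℕ), k + 2 ≤ r ∧ (∀ n < N, a n = b n) ∧ a N = k ∧ b N = k + 1 ∧
    a (N + 1) = r - 1 ∧ (∀ i : ℕ, a (N + 2 + i) = r - 2) ∧ ∀ n > N, b n = 0

/-- `(… r-2, r-2, r-1, k *) ∼ (… 0, 0, 0, k+1 *)` with `k ≤ r - 2` at place `N`. -/
def SoficGlueLeft (r : ℕ) (a b : ℤ → ℕ) : Prop :=
  ∃ (N : ℤ) (k : ℕ), k + 2 ≤ r ∧ (∀ n > N, a n = b n) ∧ a N = k ∧ b N = k + 1 ∧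
    a (N - 1) = r - 1 ∧ (∀ i : ℕ, a (N - 2 - i) = r - 2) ∧ ∀ n < N, b n = 0

/-- The symbolic compactum attached to trace `r` and determinant `σ`: the Markov compactum for
`σ = -1`, the sofic one for `σ = 1`. -/
def compactum (r : ℕ) (σ : ℤ) : Set (ℤ → ℕ) :=
  if σ = -1 then markovCompactum r else soficCompactum r

/-- The pairs of sequences to be glued. -/
def Glue (r : ℕ) (σ : ℤ) (a b : ℤ → ℕ) : Prop :=
  if σ = -1 then MarkovGlueRight r a b ∨ MarkovGlueLeft r a b
  else SoficGlueRight r a b ∨ SoficGlueLeft r a b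

/-- The smallest closed equivalence relation containing a relation on a topological space. -/
def closedEquivalence {X : Type*} [TopologicalSpace X] (R : X → X → Prop) : Setoid X :=
  sInf {s : Setoid X | (∀ a b, R a b → s a b) ∧ IsClosed {p : X × X | s p.1 p.2}}

/-- The identifications, as an equivalence relation on the compactum: limits of glued sequences
are glued too. -/
def gluing (r : ℕ) (σ : ℤ) : Setoid (compactum r σ) :=
  closedEquivalence fun a b => Glue r σ a b

/-- The factor space of the compactum. -/
def GluedSpace (r : ℕ) (σ : ℤ) : Type := Quotient (gluing r σ)

instance (r : ℕ) (σ : ℤ) : TopologicalSpace (GluedSpace r σ) :=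
  inferInstanceAs (TopologicalSpace (Quotient (gluing r σ)))

instance (r : ℕ) (σ : ℤ) : MeasurableSpace (GluedSpace r σ) := borel _

instance (r : ℕ) (σ : ℤ) : BorelSpace (GluedSpace r σ) := ⟨rfl⟩

/-- The natural projection of the compactum onto its factor space. -/
def proj (r : ℕ) (σ : ℤ) (a : compactum r σ) : GluedSpace r σ := Quotient.mk (gluing r σ) a

/-- `z` is a two-sided (blockwise) normalization of the sequence `x` of nonnegative integers:
`z` lies in the compactum, and `ℤ` can be cut into finite blocks (indexed by `ℤ`) such that on
each block `x` and `z` represent the same number in base `lam = dominantRoot r σ`. -/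
def IsNormalization (r : ℕ) (σ : ℤ) (x z : ℤ → ℕ) : Prop :=
  z ∈ compactum r σ ∧ ∃ c : ℤ → ℤ, StrictMono c ∧ ∀ j : ℤ,
    ∑ n ∈ Finset.Ioc (c j) (c (j + 1)), (x n : ℝ) * dominantRoot r σ ^ (-n) =
    ∑ n ∈ Finset.Ioc (c j) (c (j + 1)), (z n : ℝ) * dominantRoot r σ ^ (-n)

/-- The sequence `r - ε_n` in the Markov case, `2(r-2) - ε_n` in the sofic case; the normalization
of this sequence is to represent `-ε`. (No truncation occurs on the compactum when `3 ≤ r` in the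
sofic case.) -/
def reflect (r : ℕ) (σ : ℤ) (ε : ℤ → ℕ) : ℤ → ℕ :=
  fun n => (if σ = -1 then r else 2 * (r - 2)) - ε n

/-- An abelian group structure on the factor space which is compatible with the topology, and in
which sums and inverses are given by two-sided normalization of the coordinatewise sum and of the
reflected sequence, whenever such a normalization exists. -/
structure IsNormalizationGroup (r : ℕ) (σ : ℤ) (G : AddCommGroup (GluedSpace r σ)) : Prop where
  isTopologicalAddGroup : IsTopologicalAddGroup (GluedSpace r σ)
  proj_add : ∀ a b z : compactum r σ,
    IsNormalization r σ ((a : ℤ → ℕ) + (b : ℤ → ℕ)) z → proj r σ a + proj r σ b = proj r σ z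
  proj_neg : ∀ a z : compactum r σ,
    IsNormalization r σ (reflect r σ a) z → - proj r σ a = proj r σ z

end ArithCoding

end

/-!
For a bounded integer sequence `d` the recursion `r p_N - p_{N+1} - σ p_{N-1} = d_N` has exactly one
bounded real solution `p`, the convolution of `d` with a Green function built from `λ` and its
conjugate. Reducing `(p_0, p_1)` modulo one codes bounded sequences by points of the torus, and two
sequences have the same code exactly when their difference is the image, under the difference
operator, of a bounded *integer* sequence, the carry. On the compactum the carries take only the
values `-1, 0, 1`, and following them digit by digit shows that two codes coincide exactly when the
closed gluing relation identifies the sequences. So the factor space is homeomorphic to the torus,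
and normalization, which changes a sequence by a bounded carry, is the group law of the torus.

A coding map satisfies the same recursion on the shifts of the unit digit and vanishes at infinity
there, so it is an integer matrix `A` applied to the universal code. As `A` intertwines two
matrices with the same irreducible characteristic polynomial, `A ≠ 0` forces `det A ≠ 0`, and
`K = #ker A`. Finally, the code is injective away from sequences with an eventually `0` or
eventually alternating tail; the codes of these are null, because some power of the measure
preserving toral automorphism pushes them into arbitrarily small neighbourhoods of `0`.
-/

namespace ArithCoding

open Filter Topology MeasureTheory

/-- The admissible pairs of trace and determinant. -/
def Admissible (r : ℕ) (σ : ℤ) : Prop := (σ = -1 ∧ 1 ≤ r) ∨ (σ = 1 ∧ 3 ≤ r)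

/-- The root of `x² - r x + σ` conjugate to `dominantRoot r σ`. -/
noncomputable def conjRoot (r : ℕ) (σ : ℤ) : ℝ := (r : ℝ) - dominantRoot r σ

/-! ### The characteristic recursion and its bounded solutions -/

section Recursion

variable {r : ℕ} {σ : ℤ}

lemma Admissible.eq_neg_one_or_one (h : Admissible r σ) : σ = -1 ∨ σ = 1 :=
  h.imp And.left And.left

lemma Admissible.mul_self (h : Admissible r σ) : σ * σ = 1 := by
  obtain rfl | rfl := h.eq_neg_one_or_one <;> rfl

lemma Admissible.one_le (h : Admissible r (-1)) : 1 ≤ r :=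
  h.elim And.right fun h => absurd h.1 (by lia)

lemma Admissible.three_le (h : Admissible r 1) : 3 ≤ r :=
  h.elim (fun h => absurd h.1 (by lia)) And.right

lemma dominantRoot_add_conjRoot : dominantRoot r σ + conjRoot r σ = r := by
  simp [conjRoot]

lemma Admissible.discr_pos (h : Admissible r σ) : 0 < (r : ℝ) ^ 2 - 4 * (σ : ℝ) := by
  rcases h with ⟨rfl, _⟩ | ⟨rfl, hr⟩
  · push_cast; nlinarith [sq_nonneg (r : ℝ)]
  · have : (3 : ℝ) ≤ r := by exact_mod_cast hr
    push_cast; nlinarith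

lemma Admissible.dominantRoot_sq (h : Admissible r σ) :
    dominantRoot r σ ^ 2 = r * dominantRoot r σ - σ := by
  have := Real.sq_sqrt h.discr_pos.le
  unfold dominantRoot
  nlinarith

lemma Admissible.one_lt_dominantRoot (h : Admissible r σ) : 1 < dominantRoot r σ := by
  have hs := Real.sq_sqrt h.discr_pos.le
  have hs0 := Real.sqrt_nonneg ((r : ℝ) ^ 2 - 4 * (σ : ℝ))
  unfold dominantRoot
  generalize √((r : ℝ) ^ 2 - 4 * (σ : ℝ)) = s at hs hs0 ⊢
  rcases h with ⟨rfl, hr⟩ | ⟨rfl, hr⟩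
  · have h1 : (1 : ℝ) ≤ r := by exact_mod_cast hr
    push_cast at hs
    have : 1 < s := by nlinarith
    linarith
  · have h1 : (3 : ℝ) ≤ r := by exact_mod_cast hr
    linarith

lemma Admissible.dominantRoot_pos (h : Admissible r σ) : 0 < dominantRoot r σ :=
  one_pos.trans h.one_lt_dominantRoot

lemma Admissible.dominantRoot_mul_conjRoot (h : Admissible r σ) :
    dominantRoot r σ * conjRoot r σ = σ := by
  have := h.dominantRoot_sq
  unfold conjRoot
  linarith

lemma Admissible.conjRoot_sq (h : Admissible r σ) :
    conjRoot r σ ^ 2 = r * conjRoot r σ - σ := by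
  have := h.dominantRoot_sq
  unfold conjRoot
  linarith

lemma Admissible.abs_conjRoot (h : Admissible r σ) : |conjRoot r σ| = (dominantRoot r σ)⁻¹ := by
  have hσ : |(σ : ℝ)| = 1 := by rcases h with ⟨rfl, _⟩ | ⟨rfl, _⟩ <;> norm_num
  have hmul : dominantRoot r σ * |conjRoot r σ| = 1 := by
    rw [← hσ, ← h.dominantRoot_mul_conjRoot, abs_mul, abs_of_pos h.dominantRoot_pos]
  exact eq_inv_of_mul_eq_one_right hmul

lemma Admissible.conjRoot_ne_zero (h : Admissible r σ) : conjRoot r σ ≠ 0 := by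
  rw [← abs_pos, h.abs_conjRoot]
  exact inv_pos.2 h.dominantRoot_pos

lemma Admissible.conjRoot_lt_one (h : Admissible r σ) : conjRoot r σ < 1 :=
  (le_abs_self _).trans_lt (h.abs_conjRoot ▸ inv_lt_one_of_one_lt₀ h.one_lt_dominantRoot)

lemma Admissible.sub_conjRoot_pos (h : Admissible r σ) : 0 < dominantRoot r σ - conjRoot r σ := by
  linarith [h.conjRoot_lt_one, h.one_lt_dominantRoot]

lemma zpow_neg_recursion {x : ℝ} (hx : x ≠ 0) (h : x ^ 2 = r * x - σ) (n : ℤ) :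
    (r : ℝ) * x ^ (-n) - x ^ (-(n - 1)) - σ * x ^ (-(n + 1)) = 0 := by
  have h1 : x ^ (-n) = x ^ (-(n + 1)) * x := by
    rw [← zpow_add_one₀ hx]; congr 1; lia
  have h2 : x ^ (-(n - 1)) = x ^ (-(n + 1)) * x ^ 2 := by
    rw [← zpow_natCast x 2, ← zpow_add₀ hx]; congr 1; lia
  rw [h1, h2, h]; ring

/-- The operator `q ↦ r q_N - q_{N+1} - σ q_{N-1}` on two-sided sequences. -/
def charOp {R : Type*} [CommRing R] (r : ℕ) (σ : ℤ) (q : ℤ → R) (N : ℤ) : R :=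
  r * q N - q (N + 1) - σ * q (N - 1)

variable (r σ) in
/-- The bounded sequence whose reflection `n ↦ green r σ (-n)` is mapped by `charOp r σ` to the
indicator of `0`. -/
noncomputable def green (n : ℤ) : ℝ :=
  (if 0 ≤ n then dominantRoot r σ ^ (-n) else conjRoot r σ ^ (-n)) /
    (dominantRoot r σ - conjRoot r σ)

lemma green_of_nonneg {n : ℤ} (hn : 0 ≤ n) :
    green r σ n = dominantRoot r σ ^ (-n) / (dominantRoot r σ - conjRoot r σ) := by
  simp [green, hn]

lemma green_of_nonpos {n : ℤ} (hn : n ≤ 0) :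
    green r σ n = conjRoot r σ ^ (-n) / (dominantRoot r σ - conjRoot r σ) := by
  rcases hn.lt_or_eq with hn | rfl
  · simp [green, not_le.2 hn]
  · simp [green]

lemma Admissible.abs_green (h : Admissible r σ) (n : ℤ) :
    |green r σ n| = dominantRoot r σ ^ (-|n|) / (dominantRoot r σ - conjRoot r σ) := by
  have hs := h.sub_conjRoot_pos
  rcases le_total 0 n with hn | hn
  · rw [green_of_nonneg hn, abs_div, abs_of_pos hs, abs_of_nonneg hn,
      abs_of_pos (zpow_pos h.dominantRoot_pos _)]
  · rw [green_of_nonpos hn, abs_div, abs_of_pos hs, abs_of_nonpos hn, abs_zpow, h.abs_conjRoot,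
      inv_zpow', neg_neg]

lemma Admissible.green_recursion (h : Admissible r σ) (n : ℤ) :
    (r : ℝ) * green r σ n - green r σ (n - 1) - σ * green r σ (n + 1) =
      if n = 0 then 1 else 0 := by
  have hs := h.sub_conjRoot_pos.ne'
  rcases lt_trichotomy n 0 with hn | rfl | hn
  · rw [green_of_nonpos hn.le, green_of_nonpos (by lia), green_of_nonpos (by lia), if_neg hn.ne]
    have := zpow_neg_recursion h.conjRoot_ne_zero h.conjRoot_sq n
    field_simp
    linarith
  · rw [green_of_nonneg le_rfl, green_of_nonpos (by lia), green_of_nonneg (by lia), if_pos rfl,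
      ← h.dominantRoot_mul_conjRoot, ← dominantRoot_add_conjRoot (σ := σ)]
    have := h.dominantRoot_pos.ne'
    simp only [neg_zero, zpow_zero, zero_sub, neg_neg, zpow_one, zero_add, zpow_neg]
    field_simp
    ring
  · rw [green_of_nonneg hn.le, green_of_nonneg (by lia), green_of_nonneg (by lia), if_neg hn.ne']
    have := zpow_neg_recursion h.dominantRoot_pos.ne' h.dominantRoot_sq n
    field_simp
    linarith

lemma hasSum_zpow_neg_abs {x : ℝ} (hx : 1 < x) :
    HasSum (fun n : ℤ => x ^ (-|n|)) ((x + 1) / (x - 1)) := by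
  have hx0 : 0 < x := one_pos.trans hx
  have hx1 : x - 1 ≠ 0 := (sub_pos.2 hx).ne'
  have hgeom := hasSum_geometric_of_lt_one (inv_nonneg.2 hx0.le) (inv_lt_one_of_one_lt₀ hx)
  convert HasSum.of_nat_of_neg_add_one (f := fun n : ℤ => x ^ (-|n|)) (m := (1 - x⁻¹)⁻¹)
    (m' := x⁻¹ * (1 - x⁻¹)⁻¹) (by simpa using hgeom) ?_ using 1
  · field_simp
  · refine (hgeom.mul_left x⁻¹).congr_fun fun n => ?_
    have : |(-((n : ℤ) + 1))| = n + 1 := by rw [abs_neg, abs_of_nonneg (by positivity)]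
    rw [this, neg_add, zpow_add₀ hx0.ne', zpow_neg, zpow_neg_one, zpow_natCast, inv_pow]
    ring

lemma Admissible.hasSum_abs_green (h : Admissible r σ) :
    HasSum (fun n : ℤ => |green r σ n|) ((dominantRoot r σ + 1) / (dominantRoot r σ - 1) /
      (dominantRoot r σ - conjRoot r σ)) := by
  simp_rw [h.abs_green]
  exact (hasSum_zpow_neg_abs h.one_lt_dominantRoot).div_const _

variable (r σ) in
/-- The bounded solution `p` of `r p_N - p_{N+1} - σ p_{N-1} = d_N`, for bounded `d`. -/
noncomputable def potential (d : ℤ → ℝ) (N : ℤ) : ℝ := ∑' n, green r σ (n - N) * d n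

lemma Admissible.hasSum_potential (h : Admissible r σ) {d : ℤ → ℝ} {B : ℝ}
    (hd : ∀ n, |d n| ≤ B) (N : ℤ) :
    HasSum (fun n => green r σ (n - N) * d n) (potential r σ d N) := by
  have hbound : Summable (fun n : ℤ => |green r σ (n - N)| * B) :=
    ((Equiv.subRight N).summable_iff.2 h.hasSum_abs_green.summable).mul_right B
  refine (Summable.of_norm_bounded hbound fun n => ?_).hasSum
  rw [Real.norm_eq_abs, abs_mul]
  exact mul_le_mul_of_nonneg_left (hd n) (abs_nonneg _)

lemma Admissible.potential_add (h : Admissible r σ) {d e : ℤ → ℝ} {B C : ℝ}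
    (hd : ∀ n, |d n| ≤ B) (he : ∀ n, |e n| ≤ C) (N : ℤ) :
    potential r σ (fun n => d n + e n) N = potential r σ d N + potential r σ e N := by
  refine HasSum.tsum_eq ?_
  simpa only [mul_add] using (h.hasSum_potential hd N).add (h.hasSum_potential he N)

lemma potential_neg (d : ℤ → ℝ) (N : ℤ) :
    potential r σ (fun n => -d n) N = -potential r σ d N := by
  simp only [potential, mul_neg, tsum_neg]

lemma potential_shift (d : ℤ → ℝ) (k N : ℤ) :
    potential r σ (fun n => d (n + k)) N = potential r σ d (N + k) := by
  unfold potential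
  rw [← (Equiv.addRight k).tsum_eq (fun n => green r σ (n - (N + k)) * d n)]
  simp

lemma Admissible.abs_potential_le (h : Admissible r σ) {d : ℤ → ℝ} {B : ℝ}
    (hd : ∀ n, |d n| ≤ B) (N : ℤ) :
    |potential r σ d N| ≤ (dominantRoot r σ + 1) / (dominantRoot r σ - 1) /
      (dominantRoot r σ - conjRoot r σ) * B := by
  have hs : HasSum (fun n : ℤ => |green r σ (n - N)| * B) _ :=
    ((Equiv.subRight N).hasSum_iff.2 h.hasSum_abs_green).mul_right B
  refine tsum_of_norm_bounded (f := fun n => green r σ (n - N) * d n) hs fun n => ?_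
  rw [Real.norm_eq_abs, abs_mul]
  exact mul_le_mul_of_nonneg_left (hd n) (abs_nonneg _)

lemma Admissible.charOp_potential (h : Admissible r σ) {d : ℤ → ℝ} {B : ℝ}
    (hd : ∀ n, |d n| ≤ B) (N : ℤ) : charOp r σ (potential r σ d) N = d N := by
  have hS := h.hasSum_potential hd
  have hsum := (((hS N).mul_left (r : ℝ)).sub (hS (N + 1))).sub ((hS (N - 1)).mul_left (σ : ℝ))
  refine hsum.unique ((hasSum_ite_eq N (d N)).congr_fun fun n => ?_)
  have hrec := congrArg (· * d n) (h.green_recursion (n - N))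
  simp only [sub_eq_zero, ite_mul, one_mul, zero_mul] at hrec
  rw [show n - (N + 1) = n - N - 1 by ring, show n - (N - 1) = n - N + 1 by ring,
    show (if n = N then d N else 0) = if n = N then d n else 0 by grind, ← hrec]
  ring

lemma Admissible.potential_charOp (h : Admissible r σ) {q : ℤ → ℝ} {B : ℝ}
    (hq : ∀ n, |q n| ≤ B) (N : ℤ) : potential r σ (charOp r σ q) N = q N := by
  have hnext := h.hasSum_potential (fun n => hq (n + 1)) N
  have hprev := h.hasSum_potential (fun n => hq (n + -1)) N
  rw [potential_shift] at hnext hprev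
  rw [← h.charOp_potential hq N]
  have hsum := (((h.hasSum_potential hq N).mul_left (r : ℝ)).sub hnext).sub
    (hprev.mul_left (σ : ℝ))
  refine (hsum.congr_fun fun n => ?_).tsum_eq
  simp only [charOp, sub_eq_add_neg]
  ring

/-- The two branches of `green` agree modulo `1`: `(λᵐ - μᵐ) / (λ - μ)` is an integer for conjugate
`λ` and `μ`. -/
lemma Admissible.exists_green_eq_add_intCast (h : Admissible r σ) (n : ℤ) :
    ∃ k : ℤ, green r σ n = dominantRoot r σ ^ (-n) / (dominantRoot r σ - conjRoot r σ) + k := by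
  rcases le_total 0 n with hn | hn
  · exact ⟨0, by simp [green_of_nonneg hn]⟩
  obtain ⟨m, rfl⟩ : ∃ m : ℕ, n = -(m : ℤ) := ⟨n.natAbs, by lia⟩
  have hs := h.sub_conjRoot_pos.ne'
  suffices H : ∃ k : ℤ, conjRoot r σ ^ m - dominantRoot r σ ^ m =
      k * (dominantRoot r σ - conjRoot r σ) by
    obtain ⟨k, hk⟩ := H
    refine ⟨k, ?_⟩
    rw [green_of_nonpos hn]
    simp only [neg_neg, zpow_natCast]
    field_simp
    linarith
  induction m using Nat.twoStepInduction with
  | zero => exact ⟨0, by simp⟩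
  | one => exact ⟨-1, by push_cast; ring⟩
  | more m ih₀ ih₁ =>
    obtain ⟨k, hk⟩ := ih₀ (by lia)
    obtain ⟨l, hl⟩ := ih₁ (by lia)
    refine ⟨r * l - σ * k, ?_⟩
    rw [pow_add, pow_add, h.conjRoot_sq, h.dominantRoot_sq]
    push_cast
    rw [sub_mul, mul_assoc, ← hl, mul_assoc, ← hk]
    ring

end Recursion

/-! ### Finite normalization -/

section FiniteNormalization

variable {r : ℕ} {σ : ℤ}

lemma compactum_neg_one : compactum r (-1) = markovCompactum r := if_pos rfl

lemma compactum_one : compactum r 1 = soficCompactum r := if_neg (by lia)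

variable (r σ) in
/-- The number represented by a finitely supported sequence in base `dominantRoot r σ`. -/
noncomputable def value : (ℤ →₀ ℕ) →+ ℝ :=
  Finsupp.liftAddHom fun n =>
    (AddMonoidHom.mulRight (dominantRoot r σ ^ (-n))).comp (Nat.castAddMonoidHom ℝ)

lemma value_single (n : ℤ) (k : ℕ) :
    value r σ (Finsupp.single n k) = k * dominantRoot r σ ^ (-n) := by
  simp [value]

lemma value_eq_sum (a : ℤ →₀ ℕ) {s : Finset ℤ} (hs : a.support ⊆ s) :
    value r σ a = ∑ n ∈ s, (a n : ℝ) * dominantRoot r σ ^ (-n) := by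
  simp only [value, Finsupp.liftAddHom_apply]
  rw [Finsupp.sum_of_support_subset _ hs _ (by simp)]
  simp

lemma exists_eq_add_single {a : ℤ →₀ ℕ} {n : ℤ} {k : ℕ} (h : k ≤ a n) :
    ∃ b : ℤ →₀ ℕ, a = b + Finsupp.single n k :=
  ⟨a - Finsupp.single n k, (tsub_add_cancel_of_le (Finsupp.single_le_iff.2 h)).symm⟩

lemma Admissible.value_nonneg (h : Admissible r σ) (a : ℤ →₀ ℕ) : 0 ≤ value r σ a := by
  rw [value_eq_sum a subset_rfl]
  exact Finset.sum_nonneg fun n _ =>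
    mul_nonneg (Nat.cast_nonneg _) (zpow_pos h.dominantRoot_pos _).le

lemma Admissible.zpow_neg_le_value (h : Admissible r σ) {a : ℤ →₀ ℕ} {n : ℤ} (hn : a n ≠ 0) :
    dominantRoot r σ ^ (-n) ≤ value r σ a := by
  obtain ⟨b, hb⟩ := exists_eq_add_single (Nat.one_le_iff_ne_zero.2 hn)
  rw [hb, map_add, value_single, Nat.cast_one, one_mul]
  linarith [h.value_nonneg b]

lemma Admissible.mul_zpow_neg (h : Admissible r σ) (n : ℤ) :
    (r : ℝ) * dominantRoot r σ ^ (-n) =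
      dominantRoot r σ ^ (-(n - 1)) + σ * dominantRoot r σ ^ (-(n + 1)) := by
  linarith [zpow_neg_recursion h.dominantRoot_pos.ne' h.dominantRoot_sq n]

lemma Admissible.exists_eq_add_soficBlock (h : Admissible r 1) (a : ℤ →₀ ℕ) (n : ℤ)
    (hn : r - 1 ≤ a n) (j : ℕ) (hj : ∀ i < j, r - 2 ≤ a (n + 1 + i)) :
    ∃ b u : ℤ →₀ ℕ, a = b + u ∧ value r 1 u = dominantRoot r 1 ^ (-(n - 1)) +
      dominantRoot r 1 ^ (-(n + j + 1)) - dominantRoot r 1 ^ (-(n + j)) ∧ r - 1 ≤ u.degree ∧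
      ∀ m > n + j, b m = a m := by
  have hr := h.three_le
  induction j with
  | zero =>
    obtain ⟨b, hb⟩ := exists_eq_add_single hn
    refine ⟨b, _, hb, ?_, (Finsupp.degree_single _ _).ge, fun m hm => ?_⟩
    · have hcarry := h.mul_zpow_neg n
      rw [value_single]
      push_cast [Nat.cast_sub (show 1 ≤ r by lia)] at hcarry ⊢
      rw [add_zero]
      linarith
    · have : m ≠ n := by simp only [Nat.cast_zero, add_zero] at hm; lia
      simp [hb, this]
  | succ j ih =>
    obtain ⟨b, u, rfl, hv, hd, hm⟩ := ih fun i hi => hj i (by lia)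
    obtain ⟨c, rfl⟩ := exists_eq_add_single ((hj j (by lia)).trans_eq (hm _ (by lia)).symm)
    refine ⟨c, Finsupp.single (n + 1 + j) (r - 2) + u, by abel, ?_, ?_, fun m hm' => ?_⟩
    · have hcarry := h.mul_zpow_neg (n + 1 + j)
      rw [map_add, hv, value_single]
      push_cast [Nat.cast_sub (show 2 ≤ r by lia)] at hcarry ⊢
      rw [show n + (j + 1) + 1 = n + 1 + j + 1 by ring, show n + (j + 1) = n + 1 + j by ring,
        show n + j + 1 = n + 1 + (j : ℤ) by ring]
      rw [show n + 1 + (j : ℤ) - 1 = n + j by ring] at hcarry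
      linarith
    · rw [map_add]; lia
    · push_cast at hm'
      have : m ≠ n + 1 + j := by lia
      rw [← hm m (by lia)]
      simp [this]

lemma Admissible.exists_degree_lt_of_digit (h : Admissible r 1) {a : ℤ →₀ ℕ} {n : ℤ}
    (hn : r ≤ a n) : ∃ b : ℤ →₀ ℕ, value r 1 b = value r 1 a ∧ b.degree < a.degree := by
  have hr := h.three_le
  obtain ⟨b, rfl⟩ := exists_eq_add_single hn
  refine ⟨b + Finsupp.single (n - 1) 1 + Finsupp.single (n + 1) 1, ?_, ?_⟩
  · have hcarry := h.mul_zpow_neg n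
    simp only [map_add, value_single]
    push_cast at hcarry ⊢
    linarith
  · simp only [map_add, Finsupp.degree_single]
    lia

lemma Admissible.exists_degree_lt_of_block (h : Admissible r 1) {a : ℤ →₀ ℕ} {n : ℤ} {j : ℕ}
    (hfirst : a n = r - 1) (hmid : ∀ i < j, a (n + 1 + i) = r - 2) (hlast : a (n + 1 + j) = r - 1) :
    ∃ b : ℤ →₀ ℕ, value r 1 b = value r 1 a ∧ b.degree < a.degree := by
  have hr := h.three_le
  obtain ⟨b, u, hbu, hv, hu, hm⟩ :=
    h.exists_eq_add_soficBlock a n hfirst.ge j fun i hi => (hmid i hi).ge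
  obtain ⟨c, rfl⟩ := exists_eq_add_single (hlast.symm.trans (hm _ (by lia)).symm).le
  refine ⟨c + Finsupp.single (n - 1) 1 + Finsupp.single (n + 1 + j + 1) 1, ?_, ?_⟩
  · have hcarry := h.mul_zpow_neg (n + 1 + j)
    simp only [hbu, map_add, value_single, hv]
    push_cast [Nat.cast_sub (show 1 ≤ r by lia)] at hcarry ⊢
    rw [show n + j + 1 = n + 1 + (j : ℤ) by ring]
    rw [show n + 1 + (j : ℤ) - 1 = n + j by ring] at hcarry
    linarith
  · rw [hbu]
    simp only [map_add, Finsupp.degree_single]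
    lia

lemma Admissible.exists_mem_soficCompactum (h : Admissible r 1) (a : ℤ →₀ ℕ) :
    ∃ z : ℤ →₀ ℕ, ⇑z ∈ soficCompactum r ∧ value r 1 z = value r 1 a := by
  induction hS : a.degree using Nat.strong_induction_on generalizing a with
  | _ S ih =>
    by_cases ha : ⇑a ∈ soficCompactum r
    · exact ⟨a, ha, rfl⟩
    obtain ⟨b, hb, hd⟩ : ∃ b : ℤ →₀ ℕ, value r 1 b = value r 1 a ∧ b.degree < a.degree := by
      by_cases hdigit : ∃ n, r ≤ a n
      · exact h.exists_degree_lt_of_digit hdigit.choose_spec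
      · push Not at hdigit
        by_contra hcon
        exact ha ⟨fun n => Nat.le_sub_one_of_lt (hdigit n), fun n j ⟨hfirst, hmid, hlast⟩ =>
          hcon (h.exists_degree_lt_of_block hfirst hmid hlast)⟩
    obtain ⟨z, hz, hv⟩ := ih _ (hS ▸ hd) b rfl
    exact ⟨z, hz, hv.trans hb⟩

/-- The extremal representations of a number, whose leading digit can be split off as in a greedy
expansion: `b` has the least digit sum, among these its first nonzero digit stands at the leftmost
possible place `n`, and among these that digit is as large as possible. -/
structure IsExtremal (r : ℕ) (σ : ℤ) (b : ℤ →₀ ℕ) (n : ℤ) : Prop where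
  ne_zero : b n ≠ 0
  degree_le : ∀ c, value r σ c = value r σ b → b.degree ≤ c.degree
  eq_zero : ∀ c, value r σ c = value r σ b → c.degree = b.degree → ∀ k < n, c k = 0
  apply_le : ∀ c, value r σ c = value r σ b → c.degree = b.degree → c n ≤ b n

lemma Admissible.bddBelow_ne_zero (h : Admissible r σ) (V : ℝ) :
    ∃ k : ℤ, ∀ n, (∃ b : ℤ →₀ ℕ, value r σ b = V ∧ b n ≠ 0) → k ≤ n := by
  obtain ⟨k, hk⟩ := pow_unbounded_of_one_lt V h.one_lt_dominantRoot
  refine ⟨-k, fun n ⟨b, hb, hn⟩ => ?_⟩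
  by_contra! hlt
  have hpow : dominantRoot r σ ^ (k : ℤ) ≤ dominantRoot r σ ^ (-n) :=
    zpow_le_zpow_right₀ h.one_lt_dominantRoot.le (by lia)
  rw [zpow_natCast] at hpow
  linarith [h.zpow_neg_le_value hn]

lemma Admissible.exists_isExtremal (h : Admissible r σ) {a : ℤ →₀ ℕ} (ha : value r σ a ≠ 0) :
    ∃ (b : ℤ →₀ ℕ) (n : ℤ), value r σ b = value r σ a ∧ b.degree ≤ a.degree ∧
      IsExtremal r σ b n := by
  obtain ⟨d, hd, hmin⟩ := exists_minimalFor_of_wellFoundedLT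
    (fun c => value r σ c = value r σ a) Finsupp.degree ⟨a, rfl⟩
  let P (c : ℤ →₀ ℕ) : Prop := value r σ c = value r σ a ∧ c.degree = d.degree
  have hd0 : ∃ n, d n ≠ 0 := by
    by_contra! hcon
    exact ha (by rw [← hd, (Finsupp.ext hcon : d = 0), map_zero])
  obtain ⟨k, hk⟩ := h.bddBelow_ne_zero (value r σ a)
  obtain ⟨n, ⟨c, hc, hcn⟩, hleast⟩ := Int.exists_least_of_bdd (P := fun n => ∃ c, P c ∧ c n ≠ 0)
    ⟨k, fun n ⟨c, hc, hn⟩ => hk n ⟨c, hc.1, hn⟩⟩ (hd0.imp fun n hn => ⟨d, ⟨hd, rfl⟩, hn⟩)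
  have hbdd : BddAbove {m | ∃ c, P c ∧ c n = m} := by
    refine ⟨d.degree, ?_⟩
    rintro m ⟨c, hc, rfl⟩
    exact hc.2 ▸ Finsupp.le_degree n c
  obtain ⟨b, hb, hbn⟩ := Nat.sSup_mem (s := {m | ∃ c, P c ∧ c n = m}) ⟨c n, c, hc, rfl⟩ hbdd
  have hgreatest : ∀ c, P c → c n ≤ b n := fun c hc => hbn ▸ le_csSup hbdd ⟨c, hc, rfl⟩
  have hP : ∀ e, value r σ e = value r σ b → e.degree = b.degree → P e := fun e he hed =>
    ⟨he.trans hb.1, hed.trans hb.2⟩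
  refine ⟨b, n, hb.1, hb.2.trans_le ?_, ?_, fun e he => ?_, fun e he hed k hkn => ?_,
    fun e he hed => hgreatest e (hP e he hed)⟩
  · exact (le_total d.degree a.degree).elim id (hmin rfl)
  · exact fun h0 => hcn (Nat.le_zero.1 (h0 ▸ hgreatest c hc))
  · exact hb.2.trans_le ((le_total d.degree e.degree).elim id (hmin (he.trans hb.1)))
  · by_contra hne
    exact hkn.not_ge (hleast k ⟨e, hP e he hed, hne⟩)

lemma IsExtremal.congr {b c : ℤ →₀ ℕ} {n : ℤ} (hb : IsExtremal r σ b n)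
    (hv : value r σ c = value r σ b) (hd : c.degree = b.degree) (hn : c n = b n) :
    IsExtremal r σ c n where
  ne_zero := hn ▸ hb.ne_zero
  degree_le e he := hd ▸ hb.degree_le e (he.trans hv)
  eq_zero e he hed := hb.eq_zero e (he.trans hv) (hed.trans hd)
  apply_le e he hed := hn ▸ hb.apply_le e (he.trans hv) (hed.trans hd)

lemma IsExtremal.apply_le_of_neg_one {b : ℤ →₀ ℕ} {n : ℤ} (hb : IsExtremal r (-1) b n)
    (h : Admissible r (-1)) : b n ≤ r := by
  by_contra! hlt
  have hr := h.one_le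
  obtain ⟨c, hc⟩ := exists_eq_add_single (a := b) (n := n) (k := r + 1) hlt
  have hzero := hb.eq_zero (c + Finsupp.single (n - 1) 1 + Finsupp.single (n + 1) (r - 1) +
    Finsupp.single (n + 1 + 1) 1) ?_ ?_ (n - 1) (by lia)
  · simp at hzero
  · have hcarry := h.mul_zpow_neg n
    have hcarry' := h.mul_zpow_neg (n + 1)
    simp only [hc, map_add, value_single]
    push_cast [Nat.cast_sub hr] at hcarry hcarry' ⊢
    rw [add_sub_cancel_right] at hcarry'
    linarith
  · simp only [hc, map_add, Finsupp.degree_single]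
    lia

lemma IsExtremal.succ_eq_zero {b : ℤ →₀ ℕ} {n : ℤ} (hb : IsExtremal r (-1) b n)
    (h : Admissible r (-1)) (hn : b n = r) : b (n + 1) = 0 := by
  by_contra hne
  have hr := h.one_le
  obtain ⟨c, hc⟩ := exists_eq_add_single hn.ge
  obtain ⟨d, rfl⟩ := exists_eq_add_single (a := c) (n := n + 1) (k := 1) (by simp [hc] at hne; lia)
  have hdeg := hb.degree_le (d + Finsupp.single (n - 1) 1) ?_
  · simp only [hc, map_add, Finsupp.degree_single] at hdeg
    lia
  · have hcarry := h.mul_zpow_neg n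
    simp only [hc, map_add, value_single]
    push_cast at hcarry ⊢
    linarith

lemma IsExtremal.mem_markovCompactum {b : ℤ →₀ ℕ} {n : ℤ} (hb : IsExtremal r (-1) b n)
    (h : Admissible r (-1)) (htail : ∀ k > n, b k ≤ r ∧ (b k = r → b (k + 1) = 0)) :
    ⇑b ∈ markovCompactum r := fun k => by
  have hr := h.one_le
  rcases lt_trichotomy k n with hk | rfl | hk
  · have := hb.eq_zero b rfl rfl k hk
    exact ⟨by lia, fun _ => by lia⟩
  · exact ⟨hb.apply_le_of_neg_one h, hb.succ_eq_zero h⟩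
  · exact htail k hk

lemma Admissible.exists_mem_markovCompactum (h : Admissible r (-1)) (a : ℤ →₀ ℕ) :
    ∃ z : ℤ →₀ ℕ, ⇑z ∈ markovCompactum r ∧ value r (-1) z = value r (-1) a ∧
      z.degree ≤ a.degree := by
  induction hS : a.degree using Nat.strong_induction_on generalizing a with
  | _ S ih =>
    by_cases ha : value r (-1) a = 0
    · exact ⟨0, fun n => by simp, by rw [ha, map_zero], by simp⟩
    obtain ⟨b, n, hv, hd, hb⟩ := h.exists_isExtremal ha
    have hbn := hb.ne_zero
    obtain ⟨c, hc⟩ := exists_eq_add_single (le_refl (b n))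
    have hbd : b.degree = c.degree + b n := by
      conv_lhs => rw [hc]
      rw [map_add, Finsupp.degree_single]
    obtain ⟨z, hz, hvz, hdz⟩ := ih c.degree (by lia) c rfl
    set y := z + Finsupp.single n (b n) with hy
    have hvy : value r (-1) y = value r (-1) b := by
      rw [hy, map_add, hvz, ← map_add, ← hc]
    have hdy : y.degree = b.degree := by
      refine le_antisymm ?_ (hb.degree_le y hvy)
      rw [hy, map_add, Finsupp.degree_single]
      lia
    have hyn : y n = b n := le_antisymm (hb.apply_le y hvy hdy) (by simp [hy])
    refine ⟨y, (hb.congr hvy hdy hyn).mem_markovCompactum h fun k hk => ?_, hvy.trans hv, by lia⟩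
    have hyz : ∀ k > n, y k = z k := fun k hk => by simp [hy, Finsupp.single_eq_of_ne hk.ne']
    rw [hyz k hk, hyz (k + 1) (by lia)]
    exact hz k

theorem Admissible.exists_finite_normalization (h : Admissible r σ) (a : ℤ →₀ ℕ) :
    ∃ z : ℤ →₀ ℕ, ⇑z ∈ compactum r σ ∧ value r σ z = value r σ a := by
  obtain rfl | rfl := h.eq_neg_one_or_one
  · obtain ⟨z, hz, hv, -⟩ := h.exists_mem_markovCompactum a
    exact ⟨z, compactum_neg_one ▸ hz, hv⟩
  · rw [compactum_one]
    exact h.exists_mem_soficCompactum a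

end FiniteNormalization

/-! ### The universal coding into the torus -/

section ToralMaps

lemma coe_intCast_eq_zero (k : ℤ) : ((k : ℝ) : UnitAddCircle) = 0 :=
  (AddCircle.coe_eq_zero_iff (1 : ℝ)).2 ⟨k, by simp⟩

lemma coe_intCast_mul (k : ℤ) (x : ℝ) :
    ((k * x : ℝ) : UnitAddCircle) = k • (x : UnitAddCircle) := by
  rw [← AddCircle.coe_zsmul, zsmul_eq_mul]

lemma coe_eq_zero_iff_exists_intCast (x : ℝ) :
    (x : UnitAddCircle) = 0 ↔ ∃ k : ℤ, (k : ℝ) = x := by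
  rw [AddCircle.coe_eq_zero_iff]
  simp

lemma continuous_toralMap (M : Matrix (Fin 2) (Fin 2) ℤ) : Continuous (toralMap M) := by
  unfold toralMap
  fun_prop

lemma toralMap_apply (M : Matrix (Fin 2) (Fin 2) ℤ) (x : Torus) (i : Fin 2) :
    toralMap M x i = M i 0 • x 0 + M i 1 • x 1 := by
  simp [toralMap, Fin.sum_univ_two]

lemma toralMap_add (M : Matrix (Fin 2) (Fin 2) ℤ) (x y : Torus) :
    toralMap M (x + y) = toralMap M x + toralMap M y := by
  ext i
  simp only [toralMap_apply, Pi.add_apply, smul_add]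
  abel

/-- The toral endomorphism of an integer matrix, as a group homomorphism. -/
def toralHom (M : Matrix (Fin 2) (Fin 2) ℤ) : Torus →+ Torus :=
  AddMonoidHom.mk' (toralMap M) (toralMap_add M)

lemma toralMap_mul (M N : Matrix (Fin 2) (Fin 2) ℤ) (x : Torus) :
    toralMap (M * N) x = toralMap M (toralMap N x) := by
  ext i
  simp only [toralMap_apply, Matrix.mul_apply, Fin.sum_univ_two, smul_add, smul_smul, add_smul]
  abel

end ToralMaps

section TorusCode

variable {r : ℕ} {σ : ℤ}

/-- The two-sided integer sequences with terms of absolute value at most `B`. -/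
def boundedSeq (B : ℕ) : Set (ℤ → ℤ) := {d | ∀ n, |d n| ≤ B}

lemma abs_intCast_le {B : ℕ} {d : ℤ → ℤ} (hd : d ∈ boundedSeq B) (n : ℤ) : |(d n : ℝ)| ≤ B := by
  exact_mod_cast hd n

lemma neg_mem_boundedSeq {B : ℕ} {d : ℤ → ℤ} (hd : d ∈ boundedSeq B) : -d ∈ boundedSeq B :=
  fun n => by simpa using hd n

variable (r σ) in
/-- The universal coding of a bounded integer sequence: its potential at `0` and `1`, modulo `1`. -/
noncomputable def torusCode (d : ℤ → ℤ) : Torus :=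
  ![((potential r σ (fun n => d n) 0 : ℝ) : UnitAddCircle),
    ((potential r σ (fun n => d n) 1 : ℝ) : UnitAddCircle)]

lemma Admissible.torusCode_add (h : Admissible r σ) {B C : ℕ} {d e : ℤ → ℤ}
    (hd : d ∈ boundedSeq B) (he : e ∈ boundedSeq C) :
    torusCode r σ (d + e) = torusCode r σ d + torusCode r σ e := by
  have := h.potential_add (abs_intCast_le hd) (abs_intCast_le he)
  ext i
  fin_cases i <;> simp [torusCode, this]

lemma torusCode_neg (d : ℤ → ℤ) : torusCode r σ (-d) = -torusCode r σ d := by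
  ext i
  fin_cases i <;> simp [torusCode, potential_neg]

lemma Admissible.torusCode_sub (h : Admissible r σ) {B C : ℕ} {d e : ℤ → ℤ}
    (hd : d ∈ boundedSeq B) (he : e ∈ boundedSeq C) :
    torusCode r σ (d - e) = torusCode r σ d - torusCode r σ e := by
  rw [sub_eq_add_neg, h.torusCode_add hd (neg_mem_boundedSeq he), torusCode_neg, sub_eq_add_neg]

lemma Admissible.continuousOn_potential (h : Admissible r σ) (B : ℕ) (N : ℤ) :
    ContinuousOn (fun d : ℤ → ℤ => potential r σ (fun n => d n) N) (boundedSeq B) := by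
  refine continuousOn_tsum (u := fun n : ℤ => |green r σ (n - N)| * B) (fun n => ?_) ?_ ?_
  · exact (continuous_const.mul (continuous_of_discreteTopology.comp
      (continuous_apply n))).continuousOn
  · exact ((Equiv.subRight N).summable_iff.2 h.hasSum_abs_green.summable).mul_right _
  · intro n d hd
    rw [Real.norm_eq_abs, abs_mul]
    exact mul_le_mul_of_nonneg_left (abs_intCast_le hd n) (abs_nonneg _)

lemma Admissible.continuousOn_torusCode (h : Admissible r σ) (B : ℕ) :
    ContinuousOn (torusCode r σ) (boundedSeq B) := by
  refine continuousOn_pi.2 fun i => ?_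
  have hc : Continuous (fun x : ℝ => (x : UnitAddCircle)) := AddCircle.continuous_mk' 1
  fin_cases i
  · exact hc.comp_continuousOn (h.continuousOn_potential B 0)
  · exact hc.comp_continuousOn (h.continuousOn_potential B 1)

lemma Admissible.tendsto_torusCode (h : Admissible r σ) {B : ℕ} {d : ℤ → ℤ}
    {e : ℕ → ℤ → ℤ} (he : ∀ j, e j ∈ boundedSeq B) (hd : d ∈ boundedSeq B)
    (hlim : ∀ n, ∀ᶠ j in atTop, e j n = d n) :
    Tendsto (fun j => torusCode r σ (e j)) atTop (𝓝 (torusCode r σ d)) := by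
  refine Tendsto.comp (h.continuousOn_torusCode B d hd) ?_
  refine tendsto_nhdsWithin_iff.2 ⟨tendsto_pi_nhds.2 fun n => ?_, .of_forall he⟩
  exact tendsto_const_nhds.congr' ((hlim n).mono fun j hj => hj.symm)

/-- As `σ` is a unit, the recursion determines `p` from `p 0` and `p 1` in both directions. -/
lemma Admissible.mem_of_charOp_mem (h : Admissible r σ) {R : Type*} [CommRing R]
    {S : AddSubgroup R} {p : ℤ → R} (hp : ∀ N, charOp r σ p N ∈ S) (h0 : p 0 ∈ S) (h1 : p 1 ∈ S)
    (N : ℤ) : p N ∈ S := by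
  suffices H : p N ∈ S ∧ p (N + 1) ∈ S from H.1
  induction N using Int.induction_on with
  | zero => exact ⟨h0, by simpa using h1⟩
  | succ N ih =>
    refine ⟨ih.2, ?_⟩
    have hnext : p (N + 1 + 1) = r • p (N + 1) - charOp r σ p (N + 1) - σ • p N := by
      simp only [charOp, nsmul_eq_mul, zsmul_eq_mul, add_sub_cancel_right]
      ring
    rw [hnext]
    exact sub_mem (sub_mem (nsmul_mem ih.2 r) (hp _)) (zsmul_mem ih.1 σ)
  | pred N ih =>
    refine ⟨?_, by simpa using ih.1⟩
    have hprev : p (-N - 1) = σ • (r • p (-N) - p (-N + 1) - charOp r σ p (-N)) := by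
      have hσ : (σ : R) * σ = 1 := by rw [← Int.cast_mul, h.mul_self, Int.cast_one]
      simp only [charOp, nsmul_eq_mul, zsmul_eq_mul]
      linear_combination (-p (-N - 1)) * hσ
    rw [hprev]
    exact zsmul_mem (sub_mem (sub_mem (nsmul_mem ih.1 r) ih.2) (hp _)) σ

lemma Admissible.exists_potential_eq (h : Admissible r σ) {B : ℕ} {d : ℤ → ℤ}
    (hd : d ∈ boundedSeq B) (h0 : torusCode r σ d = 0) :
    ∃ q : ℤ → ℤ, (∀ N, (q N : ℝ) = potential r σ (fun n => d n) N) ∧ charOp r σ q = d := by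
  set p := potential r σ (fun n => d n)
  have hrec : ∀ N, charOp r σ p N = d N := h.charOp_potential (abs_intCast_le hd)
  have hint : ∀ N, p N ∈ (Int.castAddHom ℝ).range :=
    h.mem_of_charOp_mem (fun N => ⟨d N, (hrec N).symm⟩)
      ((coe_eq_zero_iff_exists_intCast _).1 (congrFun h0 0))
      ((coe_eq_zero_iff_exists_intCast _).1 (congrFun h0 1))
  choose q hq using hint
  simp only [Int.coe_castAddHom] at hq
  refine ⟨q, hq, funext fun N => ?_⟩
  have hN := hrec N
  unfold charOp at hN ⊢
  rw [← hq, ← hq, ← hq] at hN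
  exact_mod_cast hN

lemma Admissible.torusCode_charOp (h : Admissible r σ) {B : ℕ} {q : ℤ → ℤ}
    (hq : q ∈ boundedSeq B) : torusCode r σ (charOp r σ q) = 0 := by
  have hpot := h.potential_charOp (abs_intCast_le hq)
  have hcast : (fun n => ((charOp r σ q n : ℤ) : ℝ)) = charOp r σ (fun n => (q n : ℝ)) := by
    ext n; simp [charOp]
  ext i
  fin_cases i <;> simp [torusCode, hcast, hpot, coe_intCast_eq_zero]

lemma Admissible.exists_potential_eq_sum (h : Admissible r σ) (s : Finset ℤ) (d : ℤ → ℤ)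
    (N : ℤ) : ∃ k : ℤ, potential r σ (fun n => ((if n ∈ s then d n else 0 : ℤ) : ℝ)) N =
      dominantRoot r σ ^ N / (dominantRoot r σ - conjRoot r σ) *
        ∑ n ∈ s, (d n : ℝ) * dominantRoot r σ ^ (-n) + k := by
  choose k hk using fun n => h.exists_green_eq_add_intCast (n - N)
  refine ⟨∑ n ∈ s, d n * k n, ?_⟩
  unfold potential
  rw [tsum_eq_sum (s := s) fun n hn => by simp [hn]]
  push_cast
  rw [Finset.mul_sum, ← Finset.sum_add_distrib]
  refine Finset.sum_congr rfl fun n hn => ?_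
  rw [if_pos hn, hk, neg_sub, sub_eq_add_neg, zpow_add₀ h.dominantRoot_pos.ne']
  ring

lemma Admissible.torusCode_eq_of_sum_eq (h : Admissible r σ) (s : Finset ℤ) (d e : ℤ → ℤ)
    (hde : ∑ n ∈ s, (d n : ℝ) * dominantRoot r σ ^ (-n) =
      ∑ n ∈ s, (e n : ℝ) * dominantRoot r σ ^ (-n)) :
    torusCode r σ (fun n => if n ∈ s then d n else 0) =
      torusCode r σ (fun n => if n ∈ s then e n else 0) := by
  have key : ∀ N, ((potential r σ (fun n => ((if n ∈ s then d n else 0 : ℤ) : ℝ)) N : ℝ) :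
      UnitAddCircle) = (potential r σ (fun n => ((if n ∈ s then e n else 0 : ℤ) : ℝ)) N : ℝ) := by
    intro N
    obtain ⟨k, hk⟩ := h.exists_potential_eq_sum s d N
    obtain ⟨l, hl⟩ := h.exists_potential_eq_sum s e N
    rw [hk, hl, hde, AddCircle.coe_add, AddCircle.coe_add, coe_intCast_eq_zero,
      coe_intCast_eq_zero]
  ext i
  fin_cases i
  · exact key 0
  · exact key 1

lemma coe_intCast_combination (k l m : ℤ) (x y : ℝ) :
    ((k * x + l * y - m : ℝ) : UnitAddCircle) =
      k • (x : UnitAddCircle) + l • (y : UnitAddCircle) := by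
  rw [AddCircle.coe_sub, AddCircle.coe_add, coe_intCast_mul, coe_intCast_mul, coe_intCast_eq_zero,
    sub_zero]

lemma Admissible.torusCode_shift (h : Admissible r σ) {B : ℕ} {d : ℤ → ℤ}
    (hd : d ∈ boundedSeq B) : torusCode r σ (fun n => d (n + 1)) =
      toralMap !![0, 1; -σ, r] (torusCode r σ d) := by
  have hshift := potential_shift (r := r) (σ := σ) (fun n => (d n : ℝ)) 1
  ext i
  fin_cases i
  · simp [toralMap_apply, torusCode, hshift]
  · have hrec := h.charOp_potential (abs_intCast_le hd) 1
    simp only [charOp, sub_self, one_add_one_eq_two] at hrec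
    have htwo : potential r σ (fun n => (d n : ℝ)) 2 =
        ((-σ : ℤ) : ℝ) * potential r σ (fun n => (d n : ℝ)) 0 +
          ((r : ℤ) : ℝ) * potential r σ (fun n => (d n : ℝ)) 1 - (d 1 : ℤ) := by
      push_cast; linarith
    have hcoe := congrArg (fun x : ℝ => (x : UnitAddCircle)) htwo
    simp only [coe_intCast_combination] at hcoe
    simpa [toralMap_apply, torusCode, hshift, -neg_smul, -zsmul_eq_mul] using hcoe

lemma Admissible.torusCode_unshift (h : Admissible r σ) {B : ℕ} {d : ℤ → ℤ}
    (hd : d ∈ boundedSeq B) : torusCode r σ (fun n => d (n - 1)) =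
      toralMap !![σ * r, -σ; 1, 0] (torusCode r σ d) := by
  have hshift := potential_shift (r := r) (σ := σ) (fun n => (d n : ℝ)) (-1)
  simp only [← sub_eq_add_neg] at hshift
  ext i
  fin_cases i
  · have hrec := h.charOp_potential (abs_intCast_le hd) 0
    simp only [charOp, zero_add, zero_sub] at hrec
    have hneg : potential r σ (fun n => (d n : ℝ)) (-1) =
        ((σ * r : ℤ) : ℝ) * potential r σ (fun n => (d n : ℝ)) 0 +
          ((-σ : ℤ) : ℝ) * potential r σ (fun n => (d n : ℝ)) 1 - ((σ * d 0 : ℤ) : ℝ) := by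
      have hσ : (σ : ℝ) * σ = 1 := by exact_mod_cast h.mul_self
      push_cast
      rw [← hrec]
      linear_combination (-potential r σ (fun n => (d n : ℝ)) (-1)) * hσ
    have hcoe := congrArg (fun x : ℝ => (x : UnitAddCircle)) hneg
    simp only [coe_intCast_combination] at hcoe
    simpa [toralMap_apply, torusCode, hshift, -neg_smul, -zsmul_eq_mul] using hcoe
  · simp [toralMap_apply, torusCode, hshift]

end TorusCode

section CompactumCode

variable {r : ℕ} {σ : ℤ}

lemma Admissible.le_of_mem (h : Admissible r σ) {a : ℤ → ℕ} (ha : a ∈ compactum r σ) (n : ℤ) :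
    a n ≤ r := by
  obtain rfl | rfl := h.eq_neg_one_or_one
  · rw [compactum_neg_one] at ha
    exact (ha n).1
  · rw [compactum_one] at ha
    exact (ha.1 n).trans (by lia)

lemma isClosed_markovCompactum : IsClosed (markovCompactum r) := by
  simp only [markovCompactum, Set.ofPred_forall]
  refine isClosed_iInter fun n => ?_
  exact (isClosed_discrete {p : ℕ × ℕ | p.1 ≤ r ∧ (p.1 = r → p.2 = 0)}).preimage
    (f := fun ε : ℤ → ℕ => (ε n, ε (n + 1))) (by fun_prop)

lemma isClosed_soficCompactum : IsClosed (soficCompactum r) := by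
  have hdigit (n : ℤ) (s : Set ℕ) : IsClopen {ε : ℤ → ℕ | ε n ∈ s} :=
    (isClopen_discrete s).preimage (continuous_apply (A := fun _ : ℤ => ℕ) n)
  have hrun (n : ℤ) (j : ℕ) : IsOpen {ε : ℤ → ℕ | ∀ i : ℕ, i < j → ε (n + 1 + i) = r - 2} := by
    simp only [Set.ofPred_forall]
    exact (Set.finite_lt_nat j).isOpen_biInter fun i _ => (hdigit _ {r - 2}).2
  have hblock (n : ℤ) (j : ℕ) : IsOpen {ε : ℤ → ℕ | ε n = r - 1 ∧
      (∀ i : ℕ, i < j → ε (n + 1 + i) = r - 2) ∧ ε (n + 1 + j) = r - 1} :=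
    (hdigit n {r - 1}).2.inter ((hrun n j).inter (hdigit _ {r - 1}).2)
  simp only [soficCompactum, Set.ofPred_and, Set.ofPred_forall]
  exact (isClosed_iInter fun n => (hdigit n (Set.Iic (r - 1))).1).inter
    (isClosed_iInter fun n => isClosed_iInter fun j => (hblock n j).isClosed_compl)

lemma isClosed_compactum : IsClosed (compactum r σ) := by
  unfold compactum
  split_ifs
  exacts [isClosed_markovCompactum, isClosed_soficCompactum]

lemma isCompact_boundedDigits (B : ℕ) : IsCompact {a : ℤ → ℕ | ∀ n, a n ≤ B} := by
  have := isCompact_univ_pi (s := fun _ : ℤ => Set.Iic B) fun _ => (Set.finite_Iic B).isCompact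
  convert this using 1
  ext a
  simp [Pi.le_def]

lemma Admissible.isCompact_compactum (h : Admissible r σ) : IsCompact (compactum r σ) :=
  (isCompact_boundedDigits r).of_isClosed_subset isClosed_compactum fun _ ha => h.le_of_mem ha

variable (r σ) in
/-- The universal coding of a sequence of digits. -/
noncomputable def code (a : ℤ → ℕ) : Torus := torusCode r σ fun n => (a n : ℤ)

lemma cast_mem_boundedSeq {B : ℕ} {a : ℤ → ℕ} (ha : ∀ n, a n ≤ B) :
    (fun n => (a n : ℤ)) ∈ boundedSeq B := fun n => by
  simpa using ha n

lemma Admissible.continuousOn_code (h : Admissible r σ) (B : ℕ) :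
    ContinuousOn (code r σ) {a | ∀ n, a n ≤ B} := by
  refine (h.continuousOn_torusCode B).comp (Continuous.continuousOn ?_)
    fun a ha => cast_mem_boundedSeq ha
  exact continuous_pi fun n => continuous_of_discreteTopology.comp (continuous_apply n)

lemma Admissible.tendsto_code (h : Admissible r σ) {ι : Type*} {l : Filter ι} {B : ℕ}
    {a : ℤ → ℕ} {e : ι → ℤ → ℕ} (he : ∀ j n, e j n ≤ B) (ha : ∀ n, a n ≤ B)
    (hlim : Tendsto e l (𝓝 a)) : Tendsto (fun j => code r σ (e j)) l (𝓝 (code r σ a)) :=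
  (h.continuousOn_code B a ha).tendsto.comp (tendsto_nhdsWithin_iff.2 ⟨hlim, .of_forall he⟩)

lemma Admissible.code_add (h : Admissible r σ) {B C : ℕ} {a b : ℤ → ℕ}
    (ha : ∀ n, a n ≤ B) (hb : ∀ n, b n ≤ C) :
    code r σ (a + b) = code r σ a + code r σ b := by
  unfold code
  rw [← h.torusCode_add (cast_mem_boundedSeq ha) (cast_mem_boundedSeq hb)]
  congr 1

/-- The restriction of a sequence to a finite set of places. -/
noncomputable def restrict (s : Finset ℤ) (a : ℤ → ℕ) : ℤ →₀ ℕ := Finsupp.indicator s fun n _ => a n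

lemma restrict_apply (s : Finset ℤ) (a : ℤ → ℕ) (n : ℤ) :
    restrict s a n = if n ∈ s then a n else 0 := by
  simp [restrict, Finsupp.indicator_apply]

lemma restrict_le (s : Finset ℤ) (a : ℤ → ℕ) (n : ℤ) : restrict s a n ≤ a n := by
  rw [restrict_apply]
  split_ifs <;> simp

lemma value_restrict (s : Finset ℤ) (a : ℤ → ℕ) :
    value r σ (restrict s a) = ∑ n ∈ s, (a n : ℝ) * dominantRoot r σ ^ (-n) := by
  rw [value_eq_sum (restrict s a) (Finsupp.support_indicator_subset s _)]
  exact Finset.sum_congr rfl fun n hn => by rw [restrict_apply, if_pos hn]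

lemma tendsto_restrict (a : ℤ → ℕ) :
    Tendsto (fun s : Finset ℤ => (⇑(restrict s a) : ℤ → ℕ)) atTop (𝓝 a) := by
  refine tendsto_pi_nhds.2 fun n => tendsto_const_nhds.congr' ?_
  filter_upwards [eventually_ge_atTop {n}] with s hs
  rw [restrict_apply, if_pos (hs (Finset.mem_singleton_self n))]

lemma Admissible.restrict_mem (h : Admissible r σ) {a : ℤ → ℕ} (ha : a ∈ compactum r σ)
    (s : Finset ℤ) : ⇑(restrict s a) ∈ compactum r σ := by
  obtain rfl | rfl := h.eq_neg_one_or_one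
  · rw [compactum_neg_one] at *
    intro n
    have := h.one_le
    have := ha n
    have := restrict_le s a n
    have := restrict_le s a (n + 1)
    lia
  · rw [compactum_one] at *
    have := h.three_le
    have hdigit {m k} (hm : restrict s a m = k) (hk : 0 < k) : a m = k := by
      rw [restrict_apply] at hm
      split_ifs at hm <;> lia
    exact ⟨fun n => (restrict_le s a n).trans (ha.1 n), fun n j hj => ha.2 n j
      ⟨hdigit hj.1 (by lia), fun i hi => hdigit (hj.2.1 i hi) (by lia), hdigit hj.2.2 (by lia)⟩⟩

lemma Admissible.code_eq_of_value_eq (h : Admissible r σ) {a b : ℤ →₀ ℕ}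
    (hab : value r σ a = value r σ b) : code r σ a = code r σ b := by
  set s := a.support ∪ b.support
  have ha : a.support ⊆ s := Finset.subset_union_left
  have hb : b.support ⊆ s := Finset.subset_union_right
  have hext {c : ℤ →₀ ℕ} (hc : c.support ⊆ s) :
      (fun n => if n ∈ s then (c n : ℤ) else 0) = fun n => (c n : ℤ) := by
    ext n
    rw [ite_eq_left_iff]
    intro hn
    exact_mod_cast (Finsupp.notMem_support_iff.1 fun hcn => hn (hc hcn)).symm
  have hcode := h.torusCode_eq_of_sum_eq s (fun n => (a n : ℤ)) (fun n => (b n : ℤ))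
    (by simpa only [value_eq_sum _ ha, value_eq_sum _ hb, Int.cast_natCast] using hab)
  rwa [hext ha, hext hb] at hcode

lemma Admissible.isClosed_image_code (h : Admissible r σ) :
    IsClosed (code r σ '' compactum r σ) :=
  (h.isCompact_compactum.image_of_continuousOn
    ((h.continuousOn_code r).mono fun _ ha => h.le_of_mem ha)).isClosed

lemma Admissible.code_mem_image (h : Admissible r σ) {B : ℕ} {x : ℤ → ℕ} (hx : ∀ n, x n ≤ B) :
    code r σ x ∈ code r σ '' compactum r σ := by
  refine h.isClosed_image_code.mem_of_tendsto (h.tendsto_code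
    (fun s n => (restrict_le s x n).trans (hx n)) hx (tendsto_restrict x)) (.of_forall fun s => ?_)
  obtain ⟨z, hz, hv⟩ := h.exists_finite_normalization (restrict s x)
  exact ⟨z, hz, h.code_eq_of_value_eq hv⟩

lemma sum_Ioc_blocks {A : Type*} [AddCommMonoid A] {c : ℤ → ℤ} (hc : Monotone c) {f g : ℤ → A}
    (hfg : ∀ j, ∑ n ∈ Finset.Ioc (c j) (c (j + 1)), f n = ∑ n ∈ Finset.Ioc (c j) (c (j + 1)), g n)
    (i : ℤ) (j : ℕ) : ∑ n ∈ Finset.Ioc (c i) (c (i + j)), f n =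
      ∑ n ∈ Finset.Ioc (c i) (c (i + j)), g n := by
  induction j with
  | zero => simp
  | succ j ih =>
    have hunion := Finset.Ioc_union_Ioc_eq_Ioc (hc (show i ≤ i + j by lia))
      (hc (show i + j ≤ i + j + 1 by lia))
    have hdisj := Finset.Ioc_disjoint_Ioc_of_le (a := c i) (d := c (i + j + 1))
      (le_refl (c (i + j)))
    push_cast
    rw [← add_assoc, ← hunion, Finset.sum_union hdisj, Finset.sum_union hdisj, ih, hfg]

lemma tendsto_Ioc_blocks {c : ℤ → ℤ} (hc : StrictMono c) :
    Tendsto (fun j : ℕ => Finset.Ioc (c (-j)) (c j)) atTop atTop := by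
  refine tendsto_atTop_finset_of_monotone (fun i j hij => ?_) fun n => ?_
  · exact Finset.Ioc_subset_Ioc (hc.monotone (by lia)) (hc.monotone (by lia))
  · have hgrowth (j : ℕ) : c 0 + j ≤ c j ∧ c (-j) ≤ c 0 - j := by
      induction j with
      | zero => simp
      | succ j ih =>
        have hright : c j < c (j + 1 : ℕ) := hc (by lia)
        have hleft : c (-(j + 1 : ℕ) : ℤ) < c (-j) := hc (by lia)
        lia
    refine ⟨(n - c 0).natAbs + 1, Finset.mem_Ioc.2 ?_⟩
    have := hgrowth ((n - c 0).natAbs + 1)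
    lia

lemma Admissible.code_eq_of_isNormalization (h : Admissible r σ) {B : ℕ} {x z : ℤ → ℕ}
    (hx : ∀ n, x n ≤ B) (hz : IsNormalization r σ x z) : code r σ x = code r σ z := by
  obtain ⟨hzC, c, hc, hblock⟩ := hz
  have htendsto {C : ℕ} {y : ℤ → ℕ} (hy : ∀ n, y n ≤ C) :
      Tendsto (fun j : ℕ => code r σ (restrict (Finset.Ioc (c (-j)) (c j)) y)) atTop
        (𝓝 (code r σ y)) :=
    h.tendsto_code (fun j n => (restrict_le _ y n).trans (hy n)) hy
      ((tendsto_restrict y).comp (tendsto_Ioc_blocks hc))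
  refine tendsto_nhds_unique (htendsto hx)
    ((htendsto (h.le_of_mem hzC)).congr fun j => (h.code_eq_of_value_eq ?_).symm)
  have hsum := sum_Ioc_blocks hc.monotone hblock (-j) (2 * j)
  rw [show (-j + (2 * j : ℕ) : ℤ) = j by push_cast; ring] at hsum
  rw [value_restrict, value_restrict, hsum]

lemma Admissible.code_const (h : Admissible r σ) {c : ℕ} {k : ℤ} (hc : (c : ℤ) = (r - 1 - σ) * k) :
    code r σ (fun _ => c) = 0 := by
  rw [← h.torusCode_charOp (q := fun _ => k) (B := k.natAbs) fun _ => by simp]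
  unfold code
  congr 1
  ext n
  simp only [charOp, hc, Int.cast_id]
  ring

lemma reflect_le (a : ℤ → ℕ) (n : ℤ) : reflect r σ a n ≤ 2 * r := by
  unfold reflect
  split_ifs <;> lia

lemma Admissible.code_reflect (h : Admissible r σ) {a : ℤ → ℕ} (ha : a ∈ compactum r σ) :
    code r σ (reflect r σ a) = -code r σ a := by
  rw [eq_neg_iff_add_eq_zero, ← h.code_add (reflect_le a) (h.le_of_mem ha)]
  obtain rfl | rfl := h.eq_neg_one_or_one
  · rw [show reflect r (-1) a + a = fun _ => r by
      ext n
      have := h.le_of_mem ha n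
      simp only [reflect, if_true, Pi.add_apply]
      lia]
    exact h.code_const (k := 1) (by ring)
  · have hr := h.three_le
    rw [compactum_one] at ha
    rw [show reflect r 1 a + a = fun _ => 2 * (r - 2) by
      ext n
      have := ha.1 n
      simp only [reflect, Pi.add_apply]
      lia]
    exact h.code_const (k := 2) (by lia)

/-- The subgroup of all codes. -/
def codeSubgroup (h : Admissible r σ) : AddSubgroup Torus where
  carrier := code r σ '' compactum r σ
  zero_mem' := by
    rw [← h.code_const (c := 0) (k := 0) (by simp)]
    exact h.code_mem_image fun _ => le_rfl
  add_mem' := by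
    rintro _ _ ⟨a, ha, rfl⟩ ⟨b, hb, rfl⟩
    rw [← h.code_add (h.le_of_mem ha) (h.le_of_mem hb)]
    exact h.code_mem_image (B := r + r) fun n =>
      add_le_add (h.le_of_mem ha n) (h.le_of_mem hb n)
  neg_mem' := by
    rintro _ ⟨a, ha, rfl⟩
    rw [← h.code_reflect ha]
    exact h.code_mem_image (reflect_le a)

/-- The unit digit at place `n`. -/
def unitDigit (n : ℤ) : ℤ → ℕ := Pi.single n 1

lemma unitDigit_le (n m : ℤ) : unitDigit n m ≤ 1 := by
  unfold unitDigit
  rw [Pi.single_apply]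
  split_ifs <;> lia

lemma code_unitDigit (n : ℤ) : code r σ (unitDigit n) =
    ![((green r σ n : ℝ) : UnitAddCircle), ((green r σ (n - 1) : ℝ) : UnitAddCircle)] := by
  have hgreen (N : ℤ) :
      potential r σ (fun m => (((unitDigit n m : ℕ) : ℤ) : ℝ)) N = green r σ (n - N) := by
    unfold potential
    rw [tsum_eq_single n fun m hm => by simp [unitDigit, hm]]
    simp [unitDigit]
  simp only [code, torusCode, hgreen, sub_zero]

/-- The line of slope `u` in the torus: for the two roots `u` of the characteristic polynomial, the
expanding and the contracting line through `0`. -/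
def torusLine (u : ℝ) : ℝ →+ Torus :=
  AddMonoidHom.mk' (fun x => ![((x : ℝ) : UnitAddCircle), ((u * x : ℝ) : UnitAddCircle)])
    fun x y => by simp [mul_add]

lemma torusLine_apply (u x : ℝ) :
    torusLine u x = ![((x : ℝ) : UnitAddCircle), ((u * x : ℝ) : UnitAddCircle)] := rfl

lemma continuous_torusLine (u : ℝ) : Continuous (torusLine u) := by
  have hcoe : Continuous (fun x : ℝ => (x : UnitAddCircle)) := AddCircle.continuous_mk' 1
  refine continuous_pi fun i => ?_
  fin_cases i
  · exact hcoe
  · exact hcoe.comp (continuous_const_mul u)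

lemma Admissible.code_unitDigit_add_one (h : Admissible r σ) (n : ℕ) :
    code r σ (unitDigit (n + 1)) = torusLine (dominantRoot r σ)
      ((dominantRoot r σ)⁻¹ ^ (n + 1) / (dominantRoot r σ - conjRoot r σ)) := by
  have hl := h.dominantRoot_pos.ne'
  have hzpow : dominantRoot r σ ^ (-((n : ℤ) + 1)) = (dominantRoot r σ)⁻¹ ^ (n + 1) := by
    rw [zpow_neg, inv_pow]
    norm_cast
  have hzpow' : dominantRoot r σ ^ (-(n : ℤ)) =
      dominantRoot r σ * (dominantRoot r σ)⁻¹ ^ (n + 1) := by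
    rw [zpow_neg, zpow_natCast, pow_succ, inv_pow, mul_left_comm, mul_inv_cancel₀ hl, mul_one]
  rw [code_unitDigit, green_of_nonneg (by lia), green_of_nonneg (by lia), add_sub_cancel_right,
    hzpow, hzpow', mul_div_assoc, torusLine_apply]

lemma Admissible.code_unitDigit_neg (h : Admissible r σ) (n : ℕ) :
    code r σ (unitDigit (-n)) = torusLine (conjRoot r σ)
      (conjRoot r σ ^ n / (dominantRoot r σ - conjRoot r σ)) := by
  have hzpow : conjRoot r σ ^ (-(-(n : ℤ) - 1)) = conjRoot r σ * conjRoot r σ ^ n := by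
    rw [neg_sub, sub_neg_eq_add, zpow_add₀ h.conjRoot_ne_zero, zpow_one, zpow_natCast]
  rw [code_unitDigit, green_of_nonpos (by lia), green_of_nonpos (by lia), hzpow, neg_neg,
    zpow_natCast, mul_div_assoc, torusLine_apply]

/-- A closed subgroup of `ℝ` with arbitrarily small nonzero elements is everything. -/
lemma apply_mem_of_tendsto_zero {G : Type*} [AddGroup G] [TopologicalSpace G] {H : AddSubgroup G}
    (hH : IsClosed (H : Set G)) {f : ℝ →+ G} (hf : Continuous f) {y : ℕ → ℝ} (hy : ∀ n, y n ≠ 0)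
    (hlim : Tendsto y atTop (𝓝 0)) (hmem : ∀ n, f (y n) ∈ H) (s : ℝ) : f s ∈ H := by
  suffices hdense : Dense ((H.comap f : AddSubgroup ℝ) : Set ℝ) by
    have hclosed : IsClosed ((H.comap f : AddSubgroup ℝ) : Set ℝ) := hH.preimage hf
    exact hclosed.closure_subset (hdense s)
  refine AddSubgroup.dense_of_not_isolated_zero _ fun ε hε => ?_
  obtain ⟨n, hn⟩ := (hlim.abs.eventually_lt_const (by simpa using hε)).exists
  exact ⟨|y n|, abs_mem_iff.2 (hmem n), abs_pos.2 (hy n), hn⟩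

theorem Admissible.code_surjOn (h : Admissible r σ) :
    Set.SurjOn (code r σ) (compactum r σ) Set.univ := by
  intro x _
  change x ∈ codeSubgroup h
  have hs := h.sub_conjRoot_pos.ne'
  have hinv := inv_lt_one_of_one_lt₀ h.one_lt_dominantRoot
  have hunit (n : ℤ) : code r σ (unitDigit n) ∈ codeSubgroup h := h.code_mem_image (unitDigit_le n)
  have hexpanding : ∀ s, torusLine (dominantRoot r σ) s ∈ codeSubgroup h := by
    refine apply_mem_of_tendsto_zero h.isClosed_image_code (continuous_torusLine _)
      (fun n => div_ne_zero (pow_ne_zero (n + 1) (inv_ne_zero h.dominantRoot_pos.ne')) hs) ?_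
      fun n => h.code_unitDigit_add_one n ▸ hunit _
    simpa using ((tendsto_pow_atTop_nhds_zero_of_lt_one (inv_nonneg.2 h.dominantRoot_pos.le)
      hinv).comp (tendsto_add_atTop_nat 1)).div_const (dominantRoot r σ - conjRoot r σ)
  have hcontracting : ∀ t, torusLine (conjRoot r σ) t ∈ codeSubgroup h := by
    refine apply_mem_of_tendsto_zero h.isClosed_image_code (continuous_torusLine _)
      (fun n => div_ne_zero (pow_ne_zero n h.conjRoot_ne_zero) hs) ?_
      fun n => h.code_unitDigit_neg n ▸ hunit _
    simpa using (tendsto_pow_atTop_nhds_zero_of_abs_lt_one (h.abs_conjRoot ▸ hinv)).div_const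
      (dominantRoot r σ - conjRoot r σ)
  obtain ⟨X, hX⟩ := QuotientAddGroup.mk_surjective (x 0)
  obtain ⟨Y, hY⟩ := QuotientAddGroup.mk_surjective (x 1)
  have hx : x = torusLine (dominantRoot r σ)
        ((Y - conjRoot r σ * X) / (dominantRoot r σ - conjRoot r σ)) +
      torusLine (conjRoot r σ)
        ((dominantRoot r σ * X - Y) / (dominantRoot r σ - conjRoot r σ)) := by
    simp only [torusLine_apply]
    ext i
    fin_cases i
    · refine hX.symm.trans (congrArg (fun z : ℝ => (z : UnitAddCircle)) ?_)
      field_simp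
      ring
    · refine hY.symm.trans (congrArg (fun z : ℝ => (z : UnitAddCircle)) ?_)
      field_simp
      ring
  rw [hx]
  exact add_mem (hexpanding _) (hcontracting _)

end CompactumCode

/-! ### Glued sequences and carries -/

section Glued

lemma closedEquivalence_of_rel {X : Type*} [TopologicalSpace X] {R : X → X → Prop} {x y : X}
    (hxy : R x y) : closedEquivalence R x y := fun _ hs => hs.1 x y hxy

lemma closedEquivalence_le {X : Type*} [TopologicalSpace X] {R : X → X → Prop} {s : Setoid X}
    (hR : ∀ x y, R x y → s x y) (hs : IsClosed {p : X × X | s p.1 p.2}) :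
    closedEquivalence R ≤ s :=
  sInf_le ⟨hR, hs⟩

lemma isClosed_closedEquivalence {X : Type*} [TopologicalSpace X] (R : X → X → Prop) :
    IsClosed {p : X × X | closedEquivalence R p.1 p.2} := by
  have : {p : X × X | closedEquivalence R p.1 p.2} = ⋂ s ∈ {s : Setoid X |
      (∀ a b, R a b → s a b) ∧ IsClosed {p : X × X | s p.1 p.2}}, {p : X × X | s p.1 p.2} := by
    ext p
    simp only [Set.mem_iInter]
    rfl
  rw [this]
  exact isClosed_biInter fun s hs => hs.2

variable {r : ℕ} {σ : ℤ} {a b c : ℤ → ℕ}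

/-- Two sequences of digits lie in the compactum and are identified in the factor space. -/
def Glued (r : ℕ) (σ : ℤ) (a b : ℤ → ℕ) : Prop :=
  ∃ (ha : a ∈ compactum r σ) (hb : b ∈ compactum r σ), gluing r σ ⟨a, ha⟩ ⟨b, hb⟩

lemma Glued.refl (ha : a ∈ compactum r σ) : Glued r σ a a := ⟨ha, ha, (gluing r σ).refl _⟩

lemma Glued.symm : Glued r σ a b → Glued r σ b a
  | ⟨ha, hb, hab⟩ => ⟨hb, ha, (gluing r σ).symm hab⟩

lemma Glued.trans : Glued r σ a b → Glued r σ b c → Glued r σ a c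
  | ⟨ha, _, hab⟩, ⟨_, hc, hbc⟩ => ⟨ha, hc, (gluing r σ).trans hab hbc⟩

lemma Glued.of_glue (ha : a ∈ compactum r σ) (hb : b ∈ compactum r σ) (hab : Glue r σ a b) :
    Glued r σ a b :=
  ⟨ha, hb, closedEquivalence_of_rel hab⟩

lemma Glued.of_tendsto {u v : ℕ → ℤ → ℕ} (huv : ∀ j, Glued r σ (u j) (v j))
    (hu : Tendsto u atTop (𝓝 a)) (hv : Tendsto v atTop (𝓝 b)) : Glued r σ a b := by
  choose hu_mem hv_mem huv using huv
  have ha := isClosed_compactum.mem_of_tendsto hu (.of_forall hu_mem)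
  have hb := isClosed_compactum.mem_of_tendsto hv (.of_forall hv_mem)
  have hlim : Tendsto (fun j => ((⟨u j, hu_mem j⟩, ⟨v j, hv_mem j⟩) :
      compactum r σ × compactum r σ)) atTop (𝓝 (⟨a, ha⟩, ⟨b, hb⟩)) :=
    (tendsto_subtype_rng.2 hu).prodMk_nhds (tendsto_subtype_rng.2 hv)
  exact ⟨ha, hb, (isClosed_closedEquivalence _).mem_of_tendsto hlim (.of_forall huv)⟩

/-- The sequence `q` consists of the carries, all in `{-1, 0, 1}`, which turn the element `b` of
the compactum into the element `a`. -/
structure IsCarry (r : ℕ) (σ : ℤ) (a b : ℤ → ℕ) (q : ℤ → ℤ) : Prop where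
  admissible : Admissible r σ
  left_mem : a ∈ compactum r σ
  right_mem : b ∈ compactum r σ
  bounds : ∀ n, -1 ≤ q n ∧ q n ≤ 1
  sub_eq : ∀ n, (a n : ℤ) - b n = r * q n - q (n + 1) - σ * q (n - 1)

namespace IsCarry

variable {q : ℤ → ℤ}

lemma symm (h : IsCarry r σ a b q) : IsCarry r σ b a (-q) where
  admissible := h.admissible
  left_mem := h.right_mem
  right_mem := h.left_mem
  bounds n := by
    have := h.bounds n
    simp only [Pi.neg_apply]
    lia
  sub_eq n := by
    simp only [Pi.neg_apply]
    linear_combination -h.sub_eq n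

lemma digit_eq (h : IsCarry r σ a b q) {n : ℤ} (hprev : q (n - 1) = 0) (hn : q n = 0)
    (hnext : q (n + 1) = 0) : a n = b n := by
  have := h.sub_eq n
  rw [hprev, hn, hnext] at this
  lia

lemma eq_of_zero (h : IsCarry r σ a b q) (h0 : ∀ n, q n = 0) : a = b :=
  funext fun _ => h.digit_eq (h0 _) (h0 _) (h0 _)

lemma truncate (h : IsCarry r σ a b q) {c d : ℤ → ℕ} {N : ℤ} (hc : c ∈ compactum r σ)
    (hd : d ∈ compactum r σ) (hq : q N = 0) (hleft : ∀ n < N, c n = d n)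
    (hN : (c N : ℤ) - d N = -q (N + 1)) (hright : ∀ n > N, c n = a n ∧ d n = b n) :
    IsCarry r σ c d (fun n => if n < N then 0 else q n) := by
  refine ⟨h.admissible, hc, hd, fun n => ?_, fun n => ?_⟩
  · have := h.bounds n
    split_ifs <;> lia
  obtain hn | rfl | hn := lt_trichotomy n N
  · rw [if_pos hn, if_pos (show n - 1 < N by lia), hleft n hn]
    obtain hn' | hn' : n + 1 < N ∨ n + 1 = N := by lia
    · simp only [if_pos hn']
      ring
    · simp only [hn', hq, ite_self]
      ring
  · simp [hN, hq]
  · rw [(hright n hn).1, (hright n hn).2, if_neg hn.not_gt, if_neg (by lia), if_neg (by lia),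
      h.sub_eq n]

end IsCarry

lemma exists_last_before_not {p : ℤ → Prop} {n m : ℤ} (hnm : n ≤ m) (hn : p n) (hm : ¬ p m) :
    ∃ k, n ≤ k ∧ k < m ∧ (∀ i, n ≤ i → i ≤ k → p i) ∧ ¬ p (k + 1) := by
  obtain ⟨k, ⟨hnk, hk⟩, hleast⟩ := Int.exists_least_of_bdd (P := fun k => n ≤ k ∧ ¬ p k)
    ⟨n, fun k hk => hk.1⟩ ⟨m, hnm, hm⟩
  have hne : k ≠ n := by
    rintro rfl
    exact hk hn
  refine ⟨k - 1, by lia, by linarith [hleast m ⟨hnm, hm⟩], fun i hni hik => ?_, by simpa using hk⟩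
  by_contra hi
  have := hleast i ⟨hni, hi⟩
  lia

lemma exists_first_after_not {p : ℤ → Prop} {n m : ℤ} (hmn : m ≤ n) (hn : p n) (hm : ¬ p m) :
    ∃ k, m < k ∧ k ≤ n ∧ (∀ i, k ≤ i → i ≤ n → p i) ∧ ¬ p (k - 1) := by
  obtain ⟨k, hnk, hkm, hrun, hk⟩ := exists_last_before_not (p := fun i => p (-i))
    (neg_le_neg hmn) (by simpa using hn) (by simpa using hm)
  exact ⟨-k, by lia, by lia, fun i hki hin => by simpa using hrun (-i) (by lia) (by lia),
    by rwa [← neg_add']⟩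

lemma IsCarry.glued_of_left_zero_of_first_one {q : ℤ → ℤ} (h : IsCarry r σ a b q) {M : ℤ}
    (h0 : ∀ n ≤ M, q n = 0)
    (hone : ∀ {a b : ℤ → ℕ} {q : ℤ → ℤ} {N : ℤ}, IsCarry r σ a b q → (∀ n ≤ N, q n = 0) →
      q (N + 1) = 1 → Glued r σ a b) : Glued r σ a b := by
  by_cases hz : ∀ n, q n = 0
  · exact h.eq_of_zero hz ▸ Glued.refl h.left_mem
  push Not at hz
  obtain ⟨m, hm⟩ := hz
  obtain ⟨k, -, -, hrun, hk⟩ := exists_last_before_not (p := fun i => q i = 0)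
    (not_lt.1 fun hmM => hm (h0 m hmM.le)) (h0 M le_rfl) hm
  have hbelow (n : ℤ) (hn : n ≤ k) : q n = 0 := (le_total n M).elim (h0 n) (hrun n · hn)
  obtain hq | hq : q (k + 1) = 1 ∨ q (k + 1) = -1 := by
    have := h.bounds (k + 1)
    lia
  · exact hone h hbelow hq
  · exact (hone h.symm (N := k) (fun n hn => by simp [hbelow n hn]) (by simp [hq])).symm

/-- Time reversal of a two-sided sequence. -/
def reverse {α : Type*} (a : ℤ → α) : ℤ → α := fun n => a (-n)

/-- The two-sided sequence which equals `a` to the left of `N`, `b` to the right of `N`, and `k` at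
`N`. -/
def join (a b : ℤ → ℕ) (N : ℤ) (k : ℕ) : ℤ → ℕ :=
  fun n => if n < N then a n else if n = N then k else b n

section Join

variable {N n : ℤ} {k : ℕ}

lemma join_of_lt (hn : n < N) : join a b N k n = a n := if_pos hn

lemma join_apply_self : join a b N k N = k := by simp [join]

lemma join_of_gt (hn : n > N) : join a b N k n = b n := by simp [join, hn.not_gt, hn.ne']

lemma join_self : join a a N (a N) = a := by
  ext n
  unfold join
  split_ifs with hlt heq
  · rfl
  · rw [heq]
  · rfl

end Join

end Glued

/-! ### Carries in the sofic compactum -/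

section Sofic

variable {r : ℕ}

lemma glued_of_soficGlueRight {a b : ℤ → ℕ} (ha : a ∈ soficCompactum r) (hb : b ∈ soficCompactum r)
    (hab : SoficGlueRight r a b) : Glued r 1 a b :=
  .of_glue (compactum_one ▸ ha) (compactum_one ▸ hb) (by simp [Glue, hab])

lemma glued_of_soficGlueLeft {a b : ℤ → ℕ} (ha : a ∈ soficCompactum r) (hb : b ∈ soficCompactum r)
    (hab : SoficGlueLeft r a b) : Glued r 1 a b :=
  .of_glue (compactum_one ▸ ha) (compactum_one ▸ hb) (by simp [Glue, hab])

lemma exists_lt_of_mem_soficCompactum {a : ℤ → ℕ} (ha : a ∈ soficCompactum r) {n m : ℤ}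
    (hnm : n < m) (hn : a n = r - 1) (hm : a m = r - 1) : ∃ k, n < k ∧ k < m ∧ a k < r - 2 := by
  by_contra! hcon
  obtain ⟨k, hnk, hkm, hrun, hk⟩ := exists_last_before_not (p := fun k => n < k → a k ≠ r - 1)
    hnm.le (by simp) (by simp [hnm, hm])
  push Not at hk
  refine ha.2 n (k - n).toNat ⟨hn, fun i hi => ?_, ?_⟩
  · have hdigit := ha.1 (n + 1 + i)
    have := hcon (n + 1 + i) (by lia) (by lia)
    have := hrun (n + 1 + i) (by lia) (by lia) (by lia)
    lia
  · rw [show n + 1 + ((k - n).toNat : ℤ) = k + 1 by lia, hk.2]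

lemma reverse_mem_soficCompactum {a : ℤ → ℕ} (ha : a ∈ soficCompactum r) :
    reverse a ∈ soficCompactum r := by
  refine ⟨fun n => ha.1 (-n), fun n j hj => ha.2 (-(n + 1 + j)) j ⟨hj.2.2, fun i hi => ?_, ?_⟩⟩
  · have := hj.2.1 (j - 1 - i) (by lia)
    rw [← this, reverse]
    congr 1
    lia
  · rw [← hj.1, reverse]
    congr 1
    lia

namespace IsCarry

variable {a b : ℤ → ℕ} {q : ℤ → ℤ}

lemma left_mem_sofic (h : IsCarry r 1 a b q) : a ∈ soficCompactum r := compactum_one ▸ h.left_mem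

lemma right_mem_sofic (h : IsCarry r 1 a b q) : b ∈ soficCompactum r := h.symm.left_mem_sofic

lemma reverse (h : IsCarry r 1 a b q) : IsCarry r 1 (reverse a) (reverse b) (reverse q) where
  admissible := h.admissible
  left_mem := compactum_one ▸ reverse_mem_soficCompactum h.left_mem_sofic
  right_mem := compactum_one ▸ reverse_mem_soficCompactum h.right_mem_sofic
  bounds n := h.bounds (-n)
  sub_eq n := by
    have := h.sub_eq (-n)
    simp only [ArithCoding.reverse]
    rw [this, show -(n + 1) = -n - 1 by ring, show -(n - 1) = -n + 1 by ring]
    ring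

lemma sofic_neighbors (h : IsCarry r 1 a b q) {n : ℤ} (hn : q n = 1) :
    (q (n - 1) = 1 ∧ q (n + 1) = 1 ∧ (a n : ℤ) = b n + r - 2) ∨
    (q (n - 1) = 1 ∧ q (n + 1) = 0 ∧ a n = r - 1 ∧ b n = 0) ∨
    (q (n - 1) = 0 ∧ q (n + 1) = 1 ∧ a n = r - 1 ∧ b n = 0) := by
  have hsub := h.sub_eq n
  have hprev := h.bounds (n - 1)
  have hnext := h.bounds (n + 1)
  have ha := h.left_mem_sofic.1 n
  have hr := h.admissible.three_le
  rw [hn] at hsub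
  lia

lemma ne_of_run (h : IsCarry r 1 a b q) {n m : ℤ} (hnm : n < m)
    (hrun : ∀ k, n < k → k < m → q k = 1) (hn : a n = r - 1) : a m ≠ r - 1 := by
  intro hm
  obtain ⟨k, hnk, hkm, hk⟩ := exists_lt_of_mem_soficCompactum h.left_mem_sofic hnm hn hm
  have hr := h.admissible.three_le
  have := h.sofic_neighbors (hrun k hnk hkm)
  lia

lemma right_run (h : IsCarry r 1 a b q) {n : ℤ} (hn : q n = 1) (hprev : q (n - 1) = 0) {m : ℤ}
    (hm : n ≤ m) : q m = 1 := by
  by_contra hne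
  obtain ⟨k, hnk, -, hrun, hk⟩ := exists_last_before_not (p := fun i => q i = 1) hm hn hne
  have hstart := h.sofic_neighbors hn
  have hend := h.sofic_neighbors (hrun k hnk le_rfl)
  have hlt : n < k := hnk.lt_of_ne (by rintro rfl; lia)
  exact h.ne_of_run hlt (fun i hi hik => hrun i hi.le hik.le) (by lia) (by lia)

lemma left_run (h : IsCarry r 1 a b q) {n : ℤ} (hn : q n = 1) (hnext : q (n + 1) = 0) {m : ℤ}
    (hm : m ≤ n) : q m = 1 := by
  have := h.reverse.right_run (n := -n) (by simpa [ArithCoding.reverse] using hn)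
    (by rwa [ArithCoding.reverse, neg_sub, sub_neg_eq_add, add_comm]) (neg_le_neg hm)
  simpa [ArithCoding.reverse] using this

lemma digits_of_right_run (h : IsCarry r 1 a b q) {N : ℤ} (h0 : q N = 0) (h1 : ∀ n > N, q n = 1) :
    a (N + 1) = r - 1 ∧ (∀ n > N + 1, a n = r - 2) ∧ ∀ n > N, b n = 0 := by
  have hfirst := h.sofic_neighbors (h1 (N + 1) (by lia))
  rw [add_sub_cancel_right, h0] at hfirst
  have hrest (n : ℤ) (hn : n > N + 1) : a n = r - 2 ∧ b n = 0 := by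
    have hprev := h1 (n - 1) (by lia)
    have hnext := h1 (n + 1) (by lia)
    have := h.sofic_neighbors (h1 n (by lia))
    have := h.left_mem_sofic.1 n
    have := h.ne_of_run hn (fun k hk _ => h1 k (by lia)) (by lia)
    have hr := h.admissible.three_le
    lia
  refine ⟨by lia, fun n hn => (hrest n hn).1, fun n hn => ?_⟩
  obtain rfl | hn : n = N + 1 ∨ n > N + 1 := by lia
  · lia
  · exact (hrest n hn).2

lemma soficGlueRight (h : IsCarry r 1 a b q) {N : ℤ} (h0 : ∀ n ≤ N, q n = 0)
    (h1 : ∀ n > N, q n = 1) : SoficGlueRight r a b := by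
  obtain ⟨hfirst, hrest, hb⟩ := h.digits_of_right_run (h0 N le_rfl) h1
  have hN := h.sub_eq N
  rw [h0 N le_rfl, h0 (N - 1) (by lia), h1 (N + 1) (by lia)] at hN
  have := h.right_mem_sofic.1 N
  have hr := h.admissible.three_le
  exact ⟨N, a N, by lia, fun n hn => h.digit_eq (h0 _ (by lia)) (h0 _ hn.le) (h0 _ (by lia)), rfl,
    by lia, hfirst, fun i => hrest _ (by lia), hb⟩

lemma digits_of_left_run (h : IsCarry r 1 a b q) {N : ℤ} (h0 : q N = 0) (h1 : ∀ n < N, q n = 1) :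
    a (N - 1) = r - 1 ∧ (∀ n < N - 1, a n = r - 2) ∧ ∀ n < N, b n = 0 := by
  obtain ⟨hfirst, hrest, hb⟩ := h.reverse.digits_of_right_run (N := -N)
    (by simpa [ArithCoding.reverse] using h0) fun n hn => h1 _ (by lia)
  refine ⟨?_, fun n hn => ?_, fun n hn => ?_⟩
  · rwa [ArithCoding.reverse, neg_add, neg_neg, ← sub_eq_add_neg] at hfirst
  · simpa [ArithCoding.reverse] using hrest (-n) (by lia)
  · simpa [ArithCoding.reverse] using hb (-n) (by lia)

lemma glued_of_left_zero_sofic (h : IsCarry r 1 a b q) {M : ℤ} (h0 : ∀ n ≤ M, q n = 0) :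
    Glued r 1 a b :=
  h.glued_of_left_zero_of_first_one h0 fun h h0 hone =>
    glued_of_soficGlueRight h.left_mem_sofic h.right_mem_sofic
      (h.soficGlueRight h0 fun _ hn => h.right_run hone (by simp [h0]) hn)

end IsCarry

lemma add_two_le_of_prev_eq {a : ℤ → ℕ} (ha : a ∈ soficCompactum r) (hr : 2 ≤ r) {M : ℤ}
    (hM : a (M - 1) = r - 1) : a M + 2 ≤ r := by
  have := ha.1 M
  have hblock := ha.2 (M - 1) 0
  simp only [sub_add_cancel, Nat.cast_zero, add_zero] at hblock
  by_contra hlt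
  exact hblock ⟨hM, by simp, by lia⟩

lemma join_zero_mem_soficCompactum {a : ℤ → ℕ} (ha : a ∈ soficCompactum r) (hr : 2 ≤ r) {M : ℤ}
    (hM : a (M - 1) = r - 1) : join 0 a M (a M + 1) ∈ soficCompactum r := by
  have haM := add_two_le_of_prev_eq ha hr hM
  refine ⟨fun n => ?_, fun n j ⟨hfirst, hmid, hlast⟩ => ?_⟩
  · have := ha.1 n
    unfold join
    split_ifs
    · simp
    · lia
    · lia
  obtain hn | rfl | hn := lt_trichotomy n M
  · rw [join_of_lt hn, Pi.zero_apply] at hfirst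
    lia
  · rw [join_apply_self] at hfirst
    rw [join_of_gt (by lia)] at hlast
    refine ha.2 (n - 1) (j + 1) ⟨hM, fun i hi => ?_, ?_⟩
    · obtain rfl | hi' := Nat.eq_zero_or_pos i
      · rw [sub_add_cancel, Nat.cast_zero, add_zero]
        lia
      · rw [← hmid (i - 1) (by lia), join_of_gt (by lia)]
        congr 1
        lia
    · rw [← hlast]
      congr 1
      lia
  · rw [join_of_gt hn] at hfirst
    rw [join_of_gt (by lia)] at hlast
    exact ha.2 n j ⟨hfirst, fun i hi => by rw [← hmid i hi, join_of_gt (by lia)], hlast⟩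

lemma IsCarry.glued_of_left_run_sofic {a b : ℤ → ℕ} {q : ℤ → ℤ} (h : IsCarry r 1 a b q) {M : ℤ}
    (h1 : ∀ n < M, q n = 1) (h0 : q M = 0) : Glued r 1 a b := by
  obtain ⟨hfirst, hrest, hb⟩ := h.digits_of_left_run h0 h1
  have hr := h.admissible.three_le
  have haM := add_two_le_of_prev_eq h.left_mem_sofic (by lia) hfirst
  have hz := join_zero_mem_soficCompactum h.left_mem_sofic (by lia) hfirst
  have hM := h.sub_eq M
  rw [h0, h1 (M - 1) (by lia)] at hM
  have hcarry := h.truncate (compactum_one ▸ hz) h.right_mem h0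
    (fun n hn => by rw [join_of_lt hn, hb n hn, Pi.zero_apply])
    (by rw [join_apply_self]; lia) fun n hn => ⟨join_of_gt hn, rfl⟩
  exact (glued_of_soficGlueLeft h.left_mem_sofic hz ⟨M, a M, haM,
    fun n hn => (join_of_gt hn).symm, rfl, join_apply_self, hfirst,
    fun i => hrest _ (by lia), fun n hn => join_of_lt hn⟩).trans
      (hcarry.glued_of_left_zero_sofic (M := M - 1) fun n hn => if_pos (by lia))

/-- The sequence `(… r-2, r-2, r-1, 0, 0, …)` with last nonzero digit at place `N`. -/
def soficLeftTail (r : ℕ) (N : ℤ) : ℤ → ℕ := join (fun _ => r - 2) 0 N (r - 1)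

lemma soficLeftTail_mem (hr : 3 ≤ r) (N : ℤ) : soficLeftTail r N ∈ soficCompactum r := by
  refine ⟨fun n => ?_, fun n j ⟨hfirst, _, hlast⟩ => ?_⟩
  · unfold soficLeftTail join
    split_ifs
    · lia
    · lia
    · simp
  · unfold soficLeftTail join at hfirst hlast
    simp only [Pi.zero_apply] at hfirst hlast
    split_ifs at hfirst hlast <;> lia

lemma unitDigit_mem_soficCompactum (hr : 3 ≤ r) (N : ℤ) : unitDigit N ∈ soficCompactum r := by
  refine ⟨fun n => (unitDigit_le N n).trans (by lia), fun n j hj => ?_⟩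
  have := hj.1
  have := unitDigit_le N n
  lia

lemma glued_soficLeftTail_unitDigit (hr : 3 ≤ r) (N : ℤ) :
    Glued r 1 (soficLeftTail r N) (unitDigit (N + 1)) := by
  refine glued_of_soficGlueLeft (soficLeftTail_mem hr N) (unitDigit_mem_soficCompactum hr _)
    ⟨N + 1, 0, by lia, fun n hn => ?_, join_of_gt (lt_add_one N), by simp [unitDigit],
      by rw [add_sub_cancel_right, soficLeftTail, join_apply_self],
      fun i => join_of_lt (by lia), fun n hn => ?_⟩
  · simp [soficLeftTail, join_of_gt (show n > N by lia), unitDigit, hn.ne']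
  · simp [unitDigit, hn.ne]

lemma glued_const_zero (hr : 3 ≤ r) : Glued r 1 (fun _ => r - 2) 0 := by
  refine Glued.of_tendsto (fun j : ℕ => glued_soficLeftTail_unitDigit hr j)
    (tendsto_pi_nhds.2 fun n => tendsto_const_nhds.congr' ?_)
    (tendsto_pi_nhds.2 fun n => tendsto_const_nhds.congr' ?_)
  · filter_upwards [eventually_gt_atTop n.natAbs] with j hj
    rw [soficLeftTail, join_of_lt (by lia)]
  · filter_upwards [eventually_gt_atTop n.natAbs] with j hj
    simp [unitDigit, show n ≠ j + 1 by lia]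

namespace IsCarry

variable {a b : ℤ → ℕ} {q : ℤ → ℤ}

lemma digit_eq_of_one (h : IsCarry r 1 a b q) {n : ℤ} (hprev : q (n - 1) = 1) (hn : q n = 1)
    (hnext : q (n + 1) = 1) : (a n : ℤ) = b n + r - 2 := by
  have := h.sofic_neighbors hn
  lia

lemma glued_of_one (h : IsCarry r 1 a b q) (h1 : ∀ n, q n = 1) : Glued r 1 a b := by
  have hr := h.admissible.three_le
  have hab (n : ℤ) := h.digit_eq_of_one (h1 (n - 1)) (h1 n) (h1 (n + 1))
  have hle := h.left_mem_sofic.1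
  by_cases hmax : ∃ N, a N = r - 1
  · obtain ⟨N, hN⟩ := hmax
    have ha (m : ℤ) (hm : m ≠ N) : a m = r - 2 := by
      have hne : a m ≠ r - 1 := hm.lt_or_gt.elim
        (fun hlt e => h.ne_of_run hlt (fun k _ _ => h1 k) e hN)
        (fun hlt => h.ne_of_run hlt (fun k _ _ => h1 k) hN)
      have := hab m
      have := hle m
      lia
    have hb : b = unitDigit N := by
      ext m
      have := hab m
      obtain rfl | hm := eq_or_ne m N
      · simp only [unitDigit, Pi.single_eq_same]
        lia
      · have := ha m hm
        simp only [unitDigit, Pi.single_eq_of_ne hm]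
        lia
    have hglue : SoficGlueRight r a (soficLeftTail r (N - 1)) := ⟨N - 1, r - 2, by lia,
      fun m hm => by rw [soficLeftTail, join_of_lt hm, ha m (by lia)], ha _ (by lia),
      by rw [soficLeftTail, join_apply_self]; lia, by rwa [sub_add_cancel], fun i => ha _ (by lia),
      fun m hm => join_of_gt hm⟩
    rw [hb]
    simpa using (glued_of_soficGlueRight h.left_mem_sofic (soficLeftTail_mem hr _) hglue).trans
      (glued_soficLeftTail_unitDigit hr (N - 1))
  · push Not at hmax
    have hdigits (n : ℤ) : a n = r - 2 ∧ b n = 0 := by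
      have := hab n
      have := hle n
      have := hmax n
      lia
    rw [show a = fun _ => r - 2 from funext fun n => (hdigits n).1,
      show b = 0 from funext fun n => (hdigits n).2]
    exact glued_const_zero hr

lemma eq_one_of_ne_zero (h : IsCarry r 1 a b q) (hq : ∀ n, q n ≠ 0) (h0 : q 0 = 1) (n : ℤ) :
    q n = 1 := by
  induction n using Int.induction_on with
  | zero => exact h0
  | succ n ih =>
    have := h.sofic_neighbors ih
    have := hq (n + 1)
    lia
  | pred n ih =>
    have := h.sofic_neighbors ih
    have := hq (-n - 1)
    lia

lemma glued_of_sofic (h : IsCarry r 1 a b q) : Glued r 1 a b := by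
  by_cases hz : ∃ m, q m = 0
  · obtain ⟨m, hm⟩ := hz
    by_cases hleft : ∀ n ≤ m, q n = 0
    · exact h.glued_of_left_zero_sofic hleft
    push Not at hleft
    obtain ⟨n, hnm, hn⟩ := hleft
    obtain ⟨k, -, hkm, hrun, hk⟩ := exists_first_after_not (p := fun i => q i = 0) hnm hm hn
    have hk0 : q k = 0 := hrun k le_rfl hkm
    obtain hq | hq : q (k - 1) = 1 ∨ q (k - 1) = -1 := by
      have := h.bounds (k - 1)
      lia
    · exact h.glued_of_left_run_sofic (M := k)
        (fun i hi => h.left_run hq (by simpa using hk0) (Int.le_sub_one_of_lt hi)) hk0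
    · exact (h.symm.glued_of_left_run_sofic (M := k) (fun i hi => h.symm.left_run (by simp [hq])
        (by simpa using hk0) (Int.le_sub_one_of_lt hi)) (by simpa using hk0)).symm
  · push Not at hz
    obtain hq | hq : q 0 = 1 ∨ q 0 = -1 := by
      have := h.bounds 0
      have := hz 0
      lia
    · exact h.glued_of_one (h.eq_one_of_ne_zero hz hq)
    · exact (h.symm.glued_of_one (h.symm.eq_one_of_ne_zero (by simpa using hz) (by simp [hq]))).symm

lemma zero_of_right_run (h : IsCarry r 1 a b q) {N : ℤ} (h1 : ∀ n > N, q n = 1) :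
    ∃ N, ∀ n > N, b n = 0 := by
  have hr := h.admissible.three_le
  have hab (n : ℤ) (hn : n > N + 1) :=
    h.digit_eq_of_one (h1 (n - 1) (by lia)) (h1 n (by lia)) (h1 (n + 1) (by lia))
  have hle := h.left_mem_sofic.1
  by_cases hmax : ∃ m > N + 1, a m = r - 1
  · obtain ⟨m, hm, ham⟩ := hmax
    refine ⟨m, fun n hn => ?_⟩
    have := hab n (by lia)
    have := hle n
    have := h.ne_of_run hn (fun k hk _ => h1 k (by lia)) ham
    lia
  · push Not at hmax
    refine ⟨N + 1, fun n hn => ?_⟩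
    have := hab n hn
    have := hle n
    have := hmax n hn
    lia

lemma zero_tail_of_one (h : IsCarry r 1 a b q) {n : ℤ} (hn : q n = 1) :
    (∃ N, ∀ n > N, b n = 0) ∨ ∃ N, ∀ n < N, b n = 0 := by
  by_cases hall : ∀ m, n ≤ m → q m = 1
  · exact .inl (h.zero_of_right_run (N := n - 1) fun m hm => hall m (by lia))
  push Not at hall
  obtain ⟨m, hnm, hm⟩ := hall
  obtain ⟨k, hnk, -, hrun, hk⟩ := exists_last_before_not (p := fun i => q i = 1) hnm hn hm
  have hk1 := hrun k hnk le_rfl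
  have hnext : q (k + 1) = 0 := by
    have := h.sofic_neighbors hk1
    lia
  obtain ⟨N, hN⟩ := h.reverse.zero_of_right_run (N := -k - 1)
    fun i hi => h.left_run hk1 hnext (show -i ≤ k by lia)
  exact .inr ⟨-N, fun i hi => by simpa [ArithCoding.reverse] using hN (-i) (by lia)⟩

end IsCarry

end Sofic

/-! ### Carries in the Markov compactum -/

section Markov

variable {r : ℕ}

lemma glued_of_markovGlueRight {a b : ℤ → ℕ} (ha : a ∈ markovCompactum r)
    (hb : b ∈ markovCompactum r) (hab : MarkovGlueRight r a b) : Glued r (-1) a b :=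
  .of_glue (compactum_neg_one ▸ ha) (compactum_neg_one ▸ hb) (by simp [Glue, hab])

lemma glued_of_markovGlueLeft {a b : ℤ → ℕ} (ha : a ∈ markovCompactum r)
    (hb : b ∈ markovCompactum r) (hab : MarkovGlueLeft r a b) : Glued r (-1) a b :=
  .of_glue (compactum_neg_one ▸ ha) (compactum_neg_one ▸ hb) (by simp [Glue, hab])

/-- The sequence with `r` at the places congruent to `p` modulo `2` and `0` elsewhere. -/
def alternating (r : ℕ) (p : ℤ) : ℤ → ℕ := fun n => if (n - p) % 2 = 0 then r else 0

lemma alternating_mem (r : ℕ) (p : ℤ) : alternating r p ∈ markovCompactum r := by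
  intro n
  unfold alternating
  split_ifs <;> lia

lemma alternating_of_even {p n : ℤ} (hn : (n - p) % 2 = 0) : alternating r p n = r := if_pos hn

lemma alternating_of_odd {p n : ℤ} (hn : (n - p) % 2 = 1) : alternating r p n = 0 :=
  if_neg (by lia)

lemma alternating_congr {p p' : ℤ} (hp : (p - p') % 2 = 0) :
    alternating r p = alternating r p' := by
  ext n
  simp only [alternating]
  congr 1
  exact propext (by lia)

lemma join_mem_markovCompactum {a b : ℤ → ℕ} {N : ℤ} {k : ℕ} (ha : a ∈ markovCompactum r)
    (hb : b ∈ markovCompactum r) (hprev : a (N - 1) ≠ r) (hk : k < r ∨ k = r ∧ b (N + 1) = 0) :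
    join a b N k ∈ markovCompactum r := by
  intro n
  obtain hn | rfl | rfl | hn : n < N - 1 ∨ n = N - 1 ∨ n = N ∨ n > N := by lia
  · rw [join_of_lt (by lia), join_of_lt (by lia)]
    exact ha n
  · rw [join_of_lt (by lia)]
    exact ⟨(ha _).1, fun h => absurd h hprev⟩
  · rw [join_apply_self, join_of_gt (by lia)]
    lia
  · rw [join_of_gt hn, join_of_gt (by lia)]
    exact hb n

lemma unitDigit_mem_markovCompactum (hr : 1 ≤ r) (N : ℤ) : unitDigit N ∈ markovCompactum r := by
  intro n
  have := unitDigit_le N n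
  refine ⟨by lia, fun h => ?_⟩
  obtain rfl | hn := eq_or_ne n N
  · simp [unitDigit]
  · simp only [unitDigit, Pi.single_eq_of_ne hn] at h
    lia

lemma glued_join_alternating_unitDigit (hr : 1 ≤ r) (N : ℤ) :
    Glued r (-1) (join 0 (alternating r (N + 1)) N 0) (unitDigit N) := by
  refine glued_of_markovGlueRight (join_mem_markovCompactum (fun n => by simp) (alternating_mem r _)
    (by simp; lia) (.inl hr)) (unitDigit_mem_markovCompactum hr N)
    ⟨N, 0, hr, fun n hn => ?_, join_apply_self, by simp [unitDigit], fun i => ⟨?_, ?_⟩,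
      fun n hn => by simp [unitDigit, hn.ne']⟩
  · rw [join_of_lt hn, unitDigit, Pi.single_eq_of_ne hn.ne, Pi.zero_apply]
  · rw [join_of_gt (by lia), alternating_of_even (by lia)]
  · rw [join_of_gt (by lia), alternating_of_odd (by lia)]

lemma glued_alternating_zero (hr : 1 ≤ r) (p : ℤ) : Glued r (-1) (alternating r p) 0 := by
  refine Glued.of_tendsto (fun j : ℕ => glued_join_alternating_unitDigit hr (p - 2 * j - 1))
    (tendsto_pi_nhds.2 fun n => tendsto_const_nhds.congr' ?_)
    (tendsto_pi_nhds.2 fun n => tendsto_const_nhds.congr' ?_)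
  · filter_upwards [eventually_gt_atTop (n.natAbs + p.natAbs)] with j hj
    rw [join_of_gt (by lia), alternating_congr (show (p - (p - 2 * j - 1 + 1)) % 2 = 0 by lia)]
  · filter_upwards [eventually_gt_atTop (n.natAbs + p.natAbs)] with j hj
    simp [unitDigit, show n ≠ p - 2 * j - 1 by lia]

lemma markovGlueLeft_join {a b c : ℤ → ℕ} {N : ℤ} {k : ℕ} (hk : k < r)
    (ha : ∀ n < N - 1, a n = alternating r (N - 1) n) (haN : a (N - 1) = r - 1)
    (hb : ∀ n < N, b n = alternating r N n) :
    MarkovGlueLeft r (join b c N k) (join a c N (k + 1)) := by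
  refine ⟨N, k, hk, fun n hn => by rw [join_of_gt hn, join_of_gt hn], join_apply_self,
    join_apply_self, fun i => ⟨?_, ?_⟩, by rw [join_of_lt (by lia), haN], fun i => ⟨?_, ?_⟩⟩
  · rw [join_of_lt (by lia), hb _ (by lia), alternating_of_odd (by lia)]
  · rw [join_of_lt (by lia), hb _ (by lia), alternating_of_even (by lia)]
  · rw [join_of_lt (by lia), ha _ (by lia), alternating_of_odd (by lia)]
  · rw [join_of_lt (by lia), ha _ (by lia), alternating_of_even (by lia)]

namespace IsCarry

variable {a b : ℤ → ℕ} {q : ℤ → ℤ} {n m : ℤ}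

lemma left_mem_markov (h : IsCarry r (-1) a b q) : a ∈ markovCompactum r :=
  compactum_neg_one ▸ h.left_mem

lemma right_mem_markov (h : IsCarry r (-1) a b q) : b ∈ markovCompactum r := h.symm.left_mem_markov

lemma next_ne_one (h : IsCarry r (-1) a b q) (hn : q n = 1) : q (n + 1) ≠ 1 := by
  intro hnext
  have hr := h.admissible.one_le
  have hsub1 := h.sub_eq (n + 1)
  have hsub2 := h.sub_eq (n + 1 + 1)
  have := h.left_mem_markov (n + 1)
  have := h.left_mem_markov (n + 1 + 1)
  have := h.bounds (n + 1 + 1)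
  have := h.bounds (n + 1 + 1 + 1)
  rw [add_sub_cancel_right] at hsub1 hsub2
  rw [hnext, hn] at hsub1
  have hnext2 : q (n + 1 + 1) = 1 := by lia
  rw [hnext2, hnext] at hsub2
  lia

lemma prev_ne_one (h : IsCarry r (-1) a b q) (hn : q n = 1) : q (n - 1) ≠ 1 := fun hprev =>
  h.next_ne_one hprev (by rwa [sub_add_cancel])

lemma prev_of_next (h : IsCarry r (-1) a b q) (hn : q n = 1) (hnext : q (n + 1) = -1) :
    q (n - 1) = -1 := by
  have hsub := h.sub_eq n
  have := h.left_mem_markov n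
  have := h.bounds (n - 1)
  rw [hn, hnext] at hsub
  lia

lemma isolated_step (h : IsCarry r (-1) a b q) (hn : q n = 1) (hprev : q (n - 1) = 0) :
    q (n + 1) = 0 ∧ q (n + 2) = 1 ∧ a n = r ∧ b n = 0 ∧ a (n + 1) = 0 ∧ b (n + 1) = 0 := by
  have hnext : q (n + 1) = 0 := by
    have := h.next_ne_one hn
    have := h.prev_of_next hn
    have := h.bounds (n + 1)
    lia
  have hsub1 := h.sub_eq n
  have hsub2 := h.sub_eq (n + 1)
  have := h.left_mem_markov n
  have := h.bounds (n + 2)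
  rw [hn, hprev, hnext] at hsub1
  rw [add_sub_cancel_right, hnext, hn, add_assoc, one_add_one_eq_two] at hsub2
  lia

lemma isolated_iterate (h : IsCarry r (-1) a b q) (hn : q n = 1) (hprev : q (n - 1) = 0) (i : ℕ) :
    q (n + 2 * i) = 1 ∧ q (n + 2 * i - 1) = 0 := by
  induction i with
  | zero => simpa using ⟨hn, hprev⟩
  | succ i ih =>
    have := h.isolated_step ih.1 ih.2
    push_cast
    rw [show n + 2 * ((i : ℤ) + 1) = n + 2 * i + 2 by ring,
      show n + 2 * (i : ℤ) + 2 - 1 = n + 2 * i + 1 by ring]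
    exact ⟨this.2.1, this.1⟩

lemma isolated_run (h : IsCarry r (-1) a b q) (hn : q n = 1) (hprev : q (n - 1) = 0) (hm : n ≤ m) :
    q m = 1 - (m - n) % 2 ∧ a m = alternating r n m ∧ b m = 0 := by
  obtain ⟨hq, hq'⟩ := h.isolated_iterate hn hprev ((m - n) / 2).toNat
  have hstep := h.isolated_step hq hq'
  obtain hpar | hpar := Int.emod_two_eq (m - n)
  · rw [show n + 2 * (((m - n) / 2).toNat : ℤ) = m by lia] at hq hstep
    rw [alternating_of_even hpar]
    lia
  · rw [show n + 2 * (((m - n) / 2).toNat : ℤ) = m - 1 by lia, sub_add_cancel] at hstep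
    rw [alternating_of_odd hpar]
    lia

lemma opposite_iterate (h : IsCarry r (-1) a b q) (hn : q n = 1) (hnext : q (n + 1) = -1) (i : ℕ) :
    q (n - 2 * i) = 1 ∧ q (n - 2 * i + 1) = -1 := by
  induction i with
  | zero => simpa using ⟨hn, hnext⟩
  | succ i ih =>
    have hprev := h.prev_of_next ih.1 ih.2
    have hprev2 := h.symm.prev_of_next (n := n - 2 * i - 1) (by simp [hprev])
      (by simp only [Pi.neg_apply, sub_add_cancel, ih.1])
    simp only [Pi.neg_apply, neg_inj] at hprev2
    push_cast
    rw [show n - 2 * ((i : ℤ) + 1) = n - 2 * i - 1 - 1 by ring,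
      show n - 2 * (i : ℤ) - 1 - 1 + 1 = n - 2 * i - 1 by ring]
    exact ⟨hprev2, hprev⟩

lemma opposite_run (h : IsCarry r (-1) a b q) (hn : q n = 1) (hnext : q (n + 1) = -1)
    (hm : m ≤ n + 1) : q m = 1 - 2 * ((m - n) % 2) := by
  have := h.opposite_iterate hn hnext ((n + 1 - m) / 2).toNat
  obtain hpar | hpar := Int.emod_two_eq (m - n)
  · rw [show n - 2 * (((n + 1 - m) / 2).toNat : ℤ) = m by lia] at this
    lia
  · rw [show n - 2 * (((n + 1 - m) / 2).toNat : ℤ) + 1 = m by lia] at this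
    lia

lemma digits_of_opposite (h : IsCarry r (-1) a b q) (hn : q n = 1) (hnext : q (n + 1) = -1)
    (hm : m ≤ n) : a m = alternating r n m ∧ b m = alternating r (n + 1) m := by
  have hsub := h.sub_eq m
  rw [h.opposite_run hn hnext (by lia), h.opposite_run hn hnext (by lia),
    h.opposite_run hn hnext (by lia)] at hsub
  have := h.left_mem_markov m
  have := h.right_mem_markov m
  obtain hpar | hpar := Int.emod_two_eq (m - n)
  · rw [alternating_of_even hpar, alternating_of_odd (by lia)]
    rw [hpar, show (m + 1 - n) % 2 = 1 by lia, show (m - 1 - n) % 2 = 1 by lia] at hsub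
    lia
  · rw [alternating_of_odd hpar, alternating_of_even (by lia)]
    rw [hpar, show (m + 1 - n) % 2 = 0 by lia, show (m - 1 - n) % 2 = 0 by lia] at hsub
    lia

lemma markovGlueRight (h : IsCarry r (-1) a b q) {N : ℤ} (h0 : ∀ n ≤ N, q n = 0)
    (h1 : q (N + 1) = 1) : MarkovGlueRight r a b := by
  have hrun (m : ℤ) (hm : N + 1 ≤ m) := (h.isolated_run h1 (by simp [h0]) hm).2
  have hN := h.sub_eq N
  rw [h1, h0 N le_rfl, h0 (N - 1) (by lia)] at hN
  have := (h.right_mem_markov N).1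
  refine ⟨N, a N, by lia, fun n hn => h.digit_eq (h0 _ (by lia)) (h0 _ hn.le) (h0 _ (by lia)), rfl,
    by lia, fun i => ⟨?_, ?_⟩, fun m hm => (hrun m hm).2⟩
  · rw [(hrun _ (by lia)).1, alternating_of_even (by lia)]
  · rw [(hrun _ (by lia)).1, alternating_of_odd (by lia)]

lemma glued_of_left_zero_markov (h : IsCarry r (-1) a b q) {M : ℤ} (h0 : ∀ n ≤ M, q n = 0) :
    Glued r (-1) a b :=
  h.glued_of_left_zero_of_first_one h0 fun h h0 hone =>
    glued_of_markovGlueRight h.left_mem_markov h.right_mem_markov (h.markovGlueRight h0 hone)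

lemma ne_one_of_two_zeros (h : IsCarry r (-1) a b q) {M : ℤ} (hM : q M = 0) (hM1 : q (M - 1) = 0)
    (hprev : q (n - 1) = 0) (hn : n ≤ M) : q n ≠ 1 := by
  intro hq
  obtain hlt | rfl := hn.lt_or_eq
  · have := h.isolated_run hq hprev hn
    have := h.isolated_run hq hprev (Int.le_sub_one_of_lt hlt)
    lia
  · lia

lemma eq_alternating_of_isolated (h : IsCarry r (-1) a b q) (hiso : ∀ n, q n ≠ 0 → q (n - 1) = 0)
    (hn : q n = 1) (hzeros : ∀ m, q m = 0 → q (m - 1) ≠ 0) : a = alternating r n ∧ b = 0 := by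
  have hone (i : ℕ) : q (n - 2 * i) = 1 := by
    induction i with
    | zero => simpa using hn
    | succ i ih =>
      have hprev := hiso _ (by lia : q (n - 2 * i) ≠ 0)
      have hprev2 := hzeros _ hprev
      have hprev3 := hiso _ hprev2
      have := h.bounds (n - 2 * i - 1 - 1)
      push_cast
      rw [show n - 2 * ((i : ℤ) + 1) = n - 2 * i - 1 - 1 by ring]
      by_contra hne
      have := (h.symm.isolated_step (n := n - 2 * i - 1 - 1) (by simp only [Pi.neg_apply]; lia)
        (by simp [hprev3])).2.1
      rw [show n - 2 * (i : ℤ) - 1 - 1 + 2 = n - 2 * i by ring, Pi.neg_apply] at this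
      lia
  have hdigits (m : ℤ) : a m = alternating r n m ∧ b m = 0 := by
    have hq := hone (m - n).natAbs
    have := (h.isolated_run hq (hiso _ (by lia)) (m := m) (by lia)).2
    rwa [alternating_congr (show (n - 2 * ((m - n).natAbs : ℤ) - n) % 2 = 0 by lia)] at this
  exact ⟨funext fun m => (hdigits m).1, funext fun m => (hdigits m).2⟩

lemma glued_of_isolated (h : IsCarry r (-1) a b q) (hiso : ∀ n, q n ≠ 0 → q (n - 1) = 0) :
    Glued r (-1) a b := by
  by_cases hzeros : ∃ m, q m = 0 ∧ q (m - 1) = 0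
  · obtain ⟨M, hM, hM1⟩ := hzeros
    refine h.glued_of_left_zero_markov (M := M) fun n hn => ?_
    by_contra hne
    have := h.bounds n
    have := h.ne_one_of_two_zeros hM hM1 (hiso n hne) hn
    have := h.symm.ne_one_of_two_zeros (by simp [hM]) (by simp [hM1]) (by simp [hiso n hne]) hn
    simp only [Pi.neg_apply] at this
    lia
  push Not at hzeros
  obtain ⟨n, hn⟩ : ∃ n, q n ≠ 0 := by
    by_contra! hall
    exact hzeros 0 (hall 0) (hall _)
  have hr := h.admissible.one_le
  obtain hq | hq : q n = 1 ∨ q n = -1 := by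
    have := h.bounds n
    lia
  · obtain ⟨rfl, rfl⟩ := h.eq_alternating_of_isolated hiso hq hzeros
    exact glued_alternating_zero hr n
  · obtain ⟨rfl, rfl⟩ := h.symm.eq_alternating_of_isolated (n := n) (by simpa using hiso)
      (by simp [hq]) (by simpa using hzeros)
    exact (glued_alternating_zero hr n).symm

lemma digits_of_opposite_left_run (h : IsCarry r (-1) a b q) {N : ℤ} (h1 : q (N - 1) = 1)
    (h2 : q (N - 2) = -1) (h0 : q N = 0) :
    (∀ n < N - 1, a n = alternating r (N - 1) n) ∧ a (N - 1) = r - 1 ∧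
      ∀ n < N, b n = alternating r N n := by
  have hr := h.admissible.one_le
  have hdigits (n : ℤ) (hn : n < N - 1) :
      a n = alternating r (N - 1) n ∧ b n = alternating r N n := by
    have := h.symm.digits_of_opposite (n := N - 2) (m := n) (by simp [h2])
      (by rw [show N - 2 + 1 = N - 1 by ring]; simp [h1]) (by lia)
    rw [show N - 2 + 1 = N - 1 by ring, alternating_congr (show (N - 2 - N) % 2 = 0 by lia)] at this
    exact this.symm
  have hlast : a (N - 1) = r - 1 ∧ b (N - 1) = 0 := by
    have hsub := h.sub_eq (N - 1)
    have hb := (h.right_mem_markov (N - 1 - 1)).2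
    rw [sub_add_cancel, (hdigits _ (by lia)).2, alternating_of_even (by lia)] at hb
    rw [h1, sub_add_cancel, h0, show N - 1 - 1 = N - 2 by ring, h2] at hsub
    lia
  refine ⟨fun n hn => (hdigits n hn).1, hlast.1, fun n hn => ?_⟩
  obtain hn' | rfl : n < N - 1 ∨ n = N - 1 := by lia
  · exact (hdigits n hn').2
  · rw [hlast.2, alternating_of_odd (by lia)]

lemma glued_of_left_run_markov (h : IsCarry r (-1) a b q) {N : ℤ} (h1 : q (N - 1) = 1)
    (h2 : q (N - 2) = -1) (h0 : q N = 0) : Glued r (-1) a b := by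
  have hr := h.admissible.one_le
  obtain ⟨ha, hlast, hb⟩ := h.digits_of_opposite_left_run h1 h2 h0
  have hblast : b (N - 1) = 0 := by rw [hb _ (by lia), alternating_of_odd (by lia)]
  have hN := h.sub_eq N
  rw [h0, h1] at hN
  have hnext := h.bounds (N + 1)
  obtain haN | haN := Nat.eq_zero_or_pos (a N)
  · have hbN := h.isolated_step (n := N + 1) (by lia) (by simpa using h0)
    have hz : join a b N 1 ∈ markovCompactum r :=
      join_mem_markovCompactum h.left_mem_markov h.right_mem_markov (by lia) (by lia)
    have hglue : MarkovGlueLeft r b (join a b N 1) := by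
      have := markovGlueLeft_join (c := b) hr ha hlast hb
      rwa [show 0 = b N by lia, join_self, show b N + 1 = 1 by lia] at this
    have hcarry := h.truncate h.left_mem (compactum_neg_one ▸ hz) h0
      (fun n hn => (join_of_lt hn).symm) (by rw [join_apply_self]; lia)
      fun n hn => ⟨rfl, join_of_gt hn⟩
    exact (hcarry.glued_of_left_zero_markov (M := N - 1) fun n hn => if_pos (by lia)).trans
      (glued_of_markovGlueLeft h.right_mem_markov hz hglue).symm
  · have hz : join b a N (a N - 1) ∈ markovCompactum r :=
      join_mem_markovCompactum h.right_mem_markov h.left_mem_markov (by lia)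
        (by have := h.left_mem_markov N; lia)
    have hglue : MarkovGlueLeft r (join b a N (a N - 1)) a := by
      have := markovGlueLeft_join (c := a) (k := a N - 1) (by have := h.left_mem_markov N; lia)
        ha hlast hb
      rwa [show a N - 1 + 1 = a N by lia, join_self] at this
    have hcarry := h.truncate (compactum_neg_one ▸ hz) h.right_mem h0
      (fun n hn => join_of_lt hn) (by rw [join_apply_self]; lia)
      fun n hn => ⟨join_of_gt hn, rfl⟩
    exact (glued_of_markovGlueLeft hz h.left_mem_markov hglue).symm.trans
      (hcarry.glued_of_left_zero_markov (M := N - 1) fun n hn => if_pos (by lia))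

lemma eq_neg_next (h : IsCarry r (-1) a b q) (hn : q n ≠ 0) (hnext : q (n + 1) ≠ 0) :
    q (n + 1) = -q n := by
  have hpos := h.next_ne_one (n := n)
  have hneg := h.symm.next_ne_one (n := n)
  have := h.bounds n
  have := h.bounds (n + 1)
  simp only [Pi.neg_apply] at hneg
  lia

lemma eq_alternating_of_opposite (h : IsCarry r (-1) a b q) (hn : q n = 1) (hnext : q (n + 1) = -1)
    (hne : ∀ m ≥ n, q m ≠ 0) : a = alternating r n ∧ b = alternating r (n + 1) := by
  have hone (i : ℕ) : q (n + 2 * i) = 1 ∧ q (n + 2 * i + 1) = -1 := by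
    induction i with
    | zero => simpa using ⟨hn, hnext⟩
    | succ i ih =>
      have hnext1 := h.eq_neg_next (hne (n + 2 * i + 1) (by lia)) (hne _ (by lia))
      have hnext2 := h.eq_neg_next (hne (n + 2 * i + 1 + 1) (by lia)) (hne _ (by lia))
      push_cast
      rw [show n + 2 * ((i : ℤ) + 1) = n + 2 * i + 1 + 1 by ring]
      lia
  have hdigits (m : ℤ) : a m = alternating r n m ∧ b m = alternating r (n + 1) m := by
    obtain ⟨hq, hq'⟩ := hone (m - n).natAbs
    have := h.digits_of_opposite hq hq' (m := m) (by lia)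
    rwa [alternating_congr (show (n + 2 * ((m - n).natAbs : ℤ) - n) % 2 = 0 by lia),
      alternating_congr (show (n + 2 * ((m - n).natAbs : ℤ) + 1 - (n + 1)) % 2 = 0 by lia)] at this
  exact ⟨funext fun m => (hdigits m).1, funext fun m => (hdigits m).2⟩

lemma glued_of_opposite (h : IsCarry r (-1) a b q) (hn : q n = 1) (hnext : q (n + 1) = -1) :
    Glued r (-1) a b := by
  have hr := h.admissible.one_le
  by_cases hne : ∀ m ≥ n, q m ≠ 0
  · obtain ⟨rfl, rfl⟩ := h.eq_alternating_of_opposite hn hnext hne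
    exact (glued_alternating_zero hr _).trans (glued_alternating_zero hr _).symm
  push Not at hne
  obtain ⟨m, hnm, hm⟩ := hne
  obtain ⟨k, hnk, -, hrun, hk⟩ := exists_last_before_not (p := fun i => q i ≠ 0) hnm
    (by simp [hn]) (by simpa using hm)
  rw [not_not] at hk
  have hlt : n < k := hnk.lt_of_ne (by rintro rfl; lia)
  have hprev := h.eq_neg_next (hrun (k - 1) (by lia) (by lia))
    (by simpa using hrun k hnk le_rfl)
  rw [sub_add_cancel] at hprev
  obtain hq | hq : q k = 1 ∨ q k = -1 := by
    have := h.bounds k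
    have := hrun k hnk le_rfl
    lia
  · refine h.glued_of_left_run_markov (N := k + 1) (by simpa using hq) ?_ hk
    rw [show k + 1 - 2 = k - 1 by ring]
    lia
  · refine (h.symm.glued_of_left_run_markov (N := k + 1) (by simp [hq]) ?_ (by simp [hk])).symm
    rw [show k + 1 - 2 = k - 1 by ring, Pi.neg_apply]
    lia

lemma glued_of_markov (h : IsCarry r (-1) a b q) : Glued r (-1) a b := by
  by_cases hiso : ∀ n, q n ≠ 0 → q (n - 1) = 0
  · exact h.glued_of_isolated hiso
  push Not at hiso
  obtain ⟨n, hn, hprev⟩ := hiso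
  have hneg := h.eq_neg_next hprev (by rwa [sub_add_cancel])
  rw [sub_add_cancel] at hneg
  obtain hq | hq : q (n - 1) = 1 ∨ q (n - 1) = -1 := by
    have := h.bounds (n - 1)
    lia
  · exact h.glued_of_opposite hq (by rw [sub_add_cancel, hneg, hq])
  · exact (h.symm.glued_of_opposite (n := n - 1) (by simp [hq]) (by simp [hneg, hq])).symm

lemma tail_of_one (h : IsCarry r (-1) a b q) (hn : q n = 1) :
    (∃ N, ∀ n > N, b n = 0) ∨ ∃ N p, ∀ n < N, b n = alternating r p n := by
  by_cases hprev : q (n - 1) = 0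
  · exact .inl ⟨n - 1, fun m hm => (h.isolated_run hn hprev (by lia)).2.2⟩
  · have := h.bounds (n - 1)
    have := h.prev_ne_one hn
    exact .inr ⟨n, n - 1, fun m hm => (h.symm.digits_of_opposite (n := n - 1)
      (by simp only [Pi.neg_apply]; lia) (by simp [hn]) (by lia)).1⟩

end IsCarry

end Markov

/-! ### Equal codes mean glued sequences -/

section Carry

variable {r : ℕ} {σ : ℤ} {a b : ℤ → ℕ}

lemma Admissible.exists_charOp_eq_sub (h : Admissible r σ) {B : ℕ} (ha : ∀ n, a n ≤ B)
    (hb : ∀ n, b n ≤ B) (hab : code r σ a = code r σ b) :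
    ∃ q : ℤ → ℤ, (∀ n, |(q n : ℝ)| ≤ (dominantRoot r σ + 1) / (dominantRoot r σ - 1) /
      (dominantRoot r σ - conjRoot r σ) * B) ∧ ∀ n, (a n : ℤ) - b n = charOp r σ q n := by
  set d : ℤ → ℤ := (fun n => (a n : ℤ)) - fun n => (b n : ℤ)
  have hd : d ∈ boundedSeq B := fun n => by
    have := ha n
    have := hb n
    simp only [d, Pi.sub_apply]
    rw [abs_le]
    lia
  have h0 : torusCode r σ d = 0 :=
    (h.torusCode_sub (cast_mem_boundedSeq ha) (cast_mem_boundedSeq hb)).trans (sub_eq_zero.2 hab)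
  obtain ⟨q, hq, hqd⟩ := h.exists_potential_eq hd h0
  exact ⟨q, fun n => hq n ▸ h.abs_potential_le (abs_intCast_le hd) n,
    fun n => (congrFun hqd n).symm⟩

lemma Admissible.carry_bound_lt_two (h : Admissible r (-1)) :
    (dominantRoot r (-1) + 1) / (dominantRoot r (-1) - 1) /
      (dominantRoot r (-1) - conjRoot r (-1)) * r < 2 := by
  have hl := h.one_lt_dominantRoot
  have hlm := h.sub_conjRoot_pos
  have hmul := h.dominantRoot_mul_conjRoot
  push_cast at hmul
  rw [div_div, div_mul_eq_mul_div, div_lt_iff₀ (mul_pos (sub_pos.2 hl) hlm),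
    ← dominantRoot_add_conjRoot (σ := -1)]
  refine lt_of_mul_lt_mul_left ?_ h.dominantRoot_pos.le
  set l := dominantRoot r (-1)
  set m := conjRoot r (-1)
  calc l * ((l + 1) * (l + m)) = (l + 1) * (l ^ 2 - 1) := by linear_combination (l + 1) * hmul
    _ < 2 * (l - 1) * (l ^ 2 + 1) := by nlinarith [pow_pos (sub_pos.2 hl) 3]
    _ = l * (2 * ((l - 1) * (l - m))) := by linear_combination (2 * (l - 1)) * hmul

lemma Admissible.carry_bound_eq (h : Admissible r 1) :
    (dominantRoot r 1 + 1) / (dominantRoot r 1 - 1) / (dominantRoot r 1 - conjRoot r 1) =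
      1 / ((r : ℝ) - 2) := by
  have hl := h.one_lt_dominantRoot
  have hmul := h.dominantRoot_mul_conjRoot
  have hr : (3 : ℝ) ≤ r := by exact_mod_cast h.three_le
  push_cast at hmul
  rw [div_div, div_eq_div_iff (mul_pos (sub_pos.2 hl) h.sub_conjRoot_pos).ne' (by linarith),
    ← dominantRoot_add_conjRoot (σ := 1)]
  refine mul_left_cancel₀ h.dominantRoot_pos.ne' ?_
  linear_combination (2 * dominantRoot r 1) * hmul

/-- A carry `2` forces the next carry to be `2` and the digit to be `r - 1`, hence the forbidden
block `(r-1)(r-1)`. -/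
lemma Admissible.ne_two_of_charOp_eq_sub (h : Admissible r 1) {q : ℤ → ℤ}
    (ha : a ∈ soficCompactum r) (hq : ∀ n, q n ≤ 2)
    (hab : ∀ n, (a n : ℤ) - b n = charOp r 1 q n) (n : ℤ) : q n ≠ 2 := by
  have hr := h.three_le
  have hstep (n : ℤ) (hn : q n = 2) : q (n + 1) = 2 ∧ a n = r - 1 := by
    have hab := hab n
    have hnext := hq (n + 1)
    have hprev := hq (n - 1)
    have := ha.1 n
    rw [charOp, hn] at hab
    lia
  intro hn
  obtain ⟨hnext, han⟩ := hstep n hn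
  exact ha.2 n 0 ⟨han, by simp, by simpa using (hstep (n + 1) hnext).2⟩

lemma Admissible.exists_isCarry (h : Admissible r σ) (ha : a ∈ compactum r σ)
    (hb : b ∈ compactum r σ) (hab : code r σ a = code r σ b) : ∃ q, IsCarry r σ a b q := by
  obtain rfl | rfl := h.eq_neg_one_or_one
  · obtain ⟨q, hq, hsub⟩ := h.exists_charOp_eq_sub (h.le_of_mem ha) (h.le_of_mem hb) hab
    refine ⟨q, h, ha, hb, fun n => ?_, hsub⟩
    have hlt : |q n| < 2 := by exact_mod_cast (hq n).trans_lt h.carry_bound_lt_two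
    rw [abs_lt] at hlt
    lia
  · have ha' : a ∈ soficCompactum r := compactum_one ▸ ha
    have hb' : b ∈ soficCompactum r := compactum_one ▸ hb
    have hr := h.three_le
    obtain ⟨q, hq, hsub⟩ := h.exists_charOp_eq_sub ha'.1 hb'.1 hab
    have hq_le (n : ℤ) : ((r : ℤ) - 2) * |q n| ≤ r - 1 := by
      have hqn := hq n
      have hr' : (3 : ℝ) ≤ r := by exact_mod_cast hr
      rw [h.carry_bound_eq, one_div_mul_eq_div, le_div_iff₀ (by linarith), mul_comm,
        Nat.cast_sub (by lia), Nat.cast_one] at hqn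
      exact_mod_cast hqn
    have hq_le_two (n : ℤ) : |q n| ≤ 2 := by
      by_contra! hlt
      nlinarith [hq_le n]
    have hne := h.ne_two_of_charOp_eq_sub ha' (fun n => (le_abs_self _).trans (hq_le_two n)) hsub
    have hne_neg := h.ne_two_of_charOp_eq_sub (a := b) (b := a) (q := -q) hb'
      (fun n => (neg_le_abs _).trans (hq_le_two n)) fun n => by
        have := hsub n
        simp only [charOp, Pi.neg_apply] at this ⊢
        linear_combination -this
    refine ⟨q, h, ha, hb, fun n => ?_, hsub⟩
    have hle := abs_le.1 (hq_le_two n)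
    have hne := hne n
    have hne_neg : -q n ≠ 2 := hne_neg n
    lia

lemma MarkovGlueRight.exists_charOp_eq_sub (hab : MarkovGlueRight r a b) :
    ∃ q ∈ boundedSeq 1, ∀ n, (a n : ℤ) - b n = charOp r (-1) q n := by
  obtain ⟨N, k, -, heq, haN, hbN, ha, hb⟩ := hab
  refine ⟨fun n => if N < n ∧ (n - N) % 2 = 1 then 1 else 0,
    fun n => by beta_reduce; split_ifs <;> simp, fun n => ?_⟩
  simp only [charOp]
  obtain hn | rfl | hn := lt_trichotomy n N
  · rw [if_neg (by lia), if_neg (by lia), if_neg (by lia), heq n hn]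
    simp
  · rw [if_neg (by lia), if_pos (by lia), if_neg (by lia), haN, hbN]
    simp
  · have han := ha ((n - N - 1) / 2).toNat
    by_cases hp : (n - N) % 2 = 1
    · rw [show N + 1 + 2 * (((n - N - 1) / 2).toNat : ℤ) = n by lia] at han
      rw [if_pos ⟨hn, hp⟩, if_neg (by lia), if_neg (by lia), han.1, hb n hn]
      simp
    · rw [show N + 2 + 2 * (((n - N - 1) / 2).toNat : ℤ) = n by lia] at han
      rw [if_neg (by lia), if_pos (by lia), if_pos (by lia), han.2, hb n hn]
      simp

lemma MarkovGlueLeft.exists_charOp_eq_sub (hab : MarkovGlueLeft r a b) :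
    ∃ q ∈ boundedSeq 1, ∀ n, (a n : ℤ) - b n = charOp r (-1) q n := by
  obtain ⟨N, k, hk, heq, haN, hbN, ha, hb_prev, hb⟩ := hab
  refine ⟨fun n => if N ≤ n then 0 else if (N - n) % 2 = 1 then -1 else 1,
    fun n => by beta_reduce; split_ifs <;> simp, fun n => ?_⟩
  simp only [charOp]
  obtain hn | rfl | rfl | hn : n > N ∨ n = N ∨ n = N - 1 ∨ n < N - 1 := by lia
  · rw [if_pos (by lia), if_pos (by lia), if_pos (by lia), heq n hn]
    simp
  · rw [if_pos (by lia), if_pos (by lia), if_neg (by lia), if_pos (by lia), haN, hbN]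
    simp
  · have ha_prev : a (N - 1) = 0 := by simpa using (ha 0).1
    rw [if_neg (by lia), if_pos (by lia), if_pos (by lia), if_neg (by lia), if_neg (by lia),
      ha_prev, hb_prev]
    push_cast [Nat.cast_sub (show 1 ≤ r by lia)]
    ring
  · have ha_odd := (ha ((N - 1 - n) / 2).toNat).1
    have ha_even := (ha ((N - 2 - n) / 2).toNat).2
    have hb := hb ((N - 2 - n) / 2).toNat
    rw [if_neg (show ¬N ≤ n by lia), if_neg (show ¬N ≤ n + 1 by lia),
      if_neg (show ¬N ≤ n - 1 by lia)]
    by_cases hp : (N - n) % 2 = 1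
    · rw [show N - 1 - 2 * (((N - 1 - n) / 2).toNat : ℤ) = n by lia] at ha_odd
      rw [show N - 3 - 2 * (((N - 2 - n) / 2).toNat : ℤ) = n by lia] at hb
      rw [if_pos hp, if_neg (by lia), if_neg (by lia), ha_odd, hb.2]
      push_cast; ring
    · rw [show N - 2 - 2 * (((N - 2 - n) / 2).toNat : ℤ) = n by lia] at ha_even hb
      rw [if_neg hp, if_pos (by lia), if_pos (by lia), ha_even, hb.1]
      push_cast; ring

lemma SoficGlueRight.exists_charOp_eq_sub (hab : SoficGlueRight r a b) :
    ∃ q ∈ boundedSeq 1, ∀ n, (a n : ℤ) - b n = charOp r 1 q n := by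
  obtain ⟨N, k, hk, heq, haN, hbN, ha_next, ha, hb⟩ := hab
  refine ⟨fun n => if N < n then 1 else 0, fun n => by beta_reduce; split_ifs <;> simp,
    fun n => ?_⟩
  simp only [charOp]
  obtain hn | rfl | rfl | hn : n < N ∨ n = N ∨ n = N + 1 ∨ n > N + 1 := by lia
  · rw [if_neg (by lia), if_neg (by lia), if_neg (by lia), heq n hn]
    simp
  · rw [if_neg (by lia), if_pos (by lia), if_neg (by lia), haN, hbN]
    simp
  · rw [if_pos (by lia), if_pos (by lia), if_neg (by lia), ha_next, hb _ (by lia)]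
    push_cast [Nat.cast_sub (show 1 ≤ r by lia)]
    ring
  · have han := ha (n - N - 2).toNat
    rw [show N + 2 + ((n - N - 2).toNat : ℤ) = n by lia] at han
    rw [if_pos (by lia), if_pos (by lia), if_pos (by lia), han, hb _ (by lia)]
    push_cast [Nat.cast_sub (show 2 ≤ r by lia)]
    ring

lemma SoficGlueLeft.exists_charOp_eq_sub (hab : SoficGlueLeft r a b) :
    ∃ q ∈ boundedSeq 1, ∀ n, (a n : ℤ) - b n = charOp r 1 q n := by
  obtain ⟨N, k, hk, heq, haN, hbN, ha_prev, ha, hb⟩ := hab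
  refine ⟨fun n => if n < N then 1 else 0, fun n => by beta_reduce; split_ifs <;> simp,
    fun n => ?_⟩
  simp only [charOp]
  obtain hn | rfl | rfl | hn : n > N ∨ n = N ∨ n = N - 1 ∨ n < N - 1 := by lia
  · rw [if_neg (by lia), if_neg (by lia), if_neg (by lia), heq n hn]
    simp
  · rw [if_neg (by lia), if_neg (by lia), if_pos (by lia), haN, hbN]
    simp
  · rw [if_pos (by lia), if_neg (by lia), if_pos (by lia), ha_prev, hb _ (by lia)]
    push_cast [Nat.cast_sub (show 1 ≤ r by lia)]
    ring
  · have han := ha (N - 2 - n).toNat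
    rw [show N - 2 - ((N - 2 - n).toNat : ℤ) = n by lia] at han
    rw [if_pos (by lia), if_pos (by lia), if_pos (by lia), han, hb _ (by lia)]
    push_cast [Nat.cast_sub (show 2 ≤ r by lia)]
    ring

lemma Admissible.code_eq_of_glue (h : Admissible r σ) (ha : a ∈ compactum r σ)
    (hb : b ∈ compactum r σ) (hab : Glue r σ a b) : code r σ a = code r σ b := by
  obtain ⟨q, hq, hsub⟩ : ∃ q ∈ boundedSeq 1, ∀ n, (a n : ℤ) - b n = charOp r σ q n := by
    obtain rfl | rfl := h.eq_neg_one_or_one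
    · rw [Glue, if_pos rfl] at hab
      exact hab.elim MarkovGlueRight.exists_charOp_eq_sub MarkovGlueLeft.exists_charOp_eq_sub
    · rw [Glue, if_neg (by norm_num)] at hab
      exact hab.elim SoficGlueRight.exists_charOp_eq_sub SoficGlueLeft.exists_charOp_eq_sub
  refine sub_eq_zero.1 <| (h.torusCode_sub (cast_mem_boundedSeq (h.le_of_mem ha))
    (cast_mem_boundedSeq (h.le_of_mem hb))).symm.trans ?_
  rw [← h.torusCode_charOp hq]
  congr 1
  exact funext hsub

theorem Admissible.glued_of_code_eq (h : Admissible r σ) (ha : a ∈ compactum r σ)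
    (hb : b ∈ compactum r σ) (hab : code r σ a = code r σ b) : Glued r σ a b := by
  obtain ⟨q, hq⟩ := h.exists_isCarry ha hb hab
  obtain rfl | rfl := h.eq_neg_one_or_one
  exacts [hq.glued_of_markov, hq.glued_of_sofic]

/-- A sequence of digits that vanishes to the right, vanishes to the left, or alternates between
`r` and `0` to the left. Of two elements of the compactum with the same code, one is of this
kind. -/
def HasExceptionalTail (r : ℕ) (x : ℤ → ℕ) : Prop :=
  ∃ N : ℤ, (∀ n > N, x n = 0) ∨ (∀ n < N, x n = 0) ∨ ∃ p, ∀ n < N, x n = alternating r p n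

lemma IsCarry.hasExceptionalTail_of_one {q : ℤ → ℤ} (hq : IsCarry r σ a b q) {n : ℤ}
    (hn : q n = 1) : HasExceptionalTail r b := by
  obtain rfl | rfl := hq.admissible.eq_neg_one_or_one
  · obtain ⟨N, hN⟩ | ⟨N, p, hN⟩ := hq.tail_of_one hn
    exacts [⟨N, .inl hN⟩, ⟨N, .inr (.inr ⟨p, hN⟩)⟩]
  · obtain ⟨N, hN⟩ | ⟨N, hN⟩ := hq.zero_tail_of_one hn
    exacts [⟨N, .inl hN⟩, ⟨N, .inr (.inl hN)⟩]

lemma Admissible.hasExceptionalTail_of_code_eq (h : Admissible r σ) (ha : a ∈ compactum r σ)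
    (hb : b ∈ compactum r σ) (hab : code r σ a = code r σ b) (hne : a ≠ b) :
    HasExceptionalTail r a ∨ HasExceptionalTail r b := by
  obtain ⟨q, hq⟩ := h.exists_isCarry ha hb hab
  obtain ⟨n, hn⟩ : ∃ n, q n ≠ 0 := by
    by_contra! hzero
    exact hne (hq.eq_of_zero hzero)
  obtain hone | hneg : q n = 1 ∨ q n = -1 := by
    have := hq.bounds n
    lia
  · exact .inr (hq.hasExceptionalTail_of_one hone)
  · exact .inl (hq.symm.hasExceptionalTail_of_one (n := n) (by simp [hneg]))

end Carry

/-! ### The factor space is the torus -/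

section GluedSpace

variable {r : ℕ} {σ : ℤ}

lemma Admissible.continuous_code_compactum (h : Admissible r σ) :
    Continuous fun a : compactum r σ => code r σ a :=
  ((h.continuousOn_code r).mono fun _ ha => h.le_of_mem ha).domRestrict

theorem Admissible.gluing_iff (h : Admissible r σ) (a b : compactum r σ) :
    gluing r σ a b ↔ code r σ a = code r σ b := by
  refine ⟨fun hab => ?_, fun hab => (h.glued_of_code_eq a.2 b.2 hab).2.2⟩
  have hle : gluing r σ ≤ Setoid.ker fun a : compactum r σ => code r σ a :=
    closedEquivalence_le (fun a b hab => h.code_eq_of_glue a.2 b.2 hab)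
      (isClosed_eq (h.continuous_code_compactum.comp continuous_fst)
        (h.continuous_code_compactum.comp continuous_snd))
  exact hle hab

lemma Admissible.compactSpace (h : Admissible r σ) : CompactSpace (GluedSpace r σ) :=
  have := isCompact_iff_compactSpace.1 h.isCompact_compactum
  inferInstanceAs (CompactSpace (Quotient (gluing r σ)))

lemma continuous_proj : Continuous (proj r σ) := continuous_quotient_mk'

lemma proj_surjective : Function.Surjective (proj r σ) := Quotient.mk_surjective

/-- The bijection of the factor space with the torus induced by the universal coding. -/
noncomputable def gluedEquiv (h : Admissible r σ) : GluedSpace r σ ≃ Torus :=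
  Equiv.ofBijective
    (Quotient.lift (fun a : compactum r σ => code r σ a) fun a b => (h.gluing_iff a b).1)
    ⟨fun p q => Quotient.inductionOn₂ p q fun a b hab => Quotient.sound ((h.gluing_iff a b).2 hab),
      fun x => by
        obtain ⟨a, ha, rfl⟩ := h.code_surjOn (Set.mem_univ x)
        exact ⟨proj r σ ⟨a, ha⟩, rfl⟩⟩

lemma continuous_gluedEquiv (h : Admissible r σ) : Continuous (gluedEquiv h) :=
  Continuous.quotient_lift h.continuous_code_compactum _

lemma Admissible.t2Space (h : Admissible r σ) : T2Space (GluedSpace r σ) :=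
  .of_injective_continuous (gluedEquiv h).injective (continuous_gluedEquiv h)

/-- The homeomorphism of the factor space with the torus induced by the universal coding. -/
noncomputable def gluedHomeo (h : Admissible r σ) : GluedSpace r σ ≃ₜ Torus :=
  haveI := h.compactSpace
  Continuous.homeoOfEquivCompactToT2 (f := gluedEquiv h) (continuous_gluedEquiv h)

lemma gluedHomeo_proj (h : Admissible r σ) (a : compactum r σ) :
    gluedHomeo h (proj r σ a) = code r σ a := rfl

lemma Admissible.isNormalizationGroup (h : Admissible r σ) :
    IsNormalizationGroup r σ (gluedHomeo h).toEquiv.addCommGroup := by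
  let := (gluedHomeo h).toEquiv.addCommGroup
  have hadd (p q : GluedSpace r σ) :
      p + q = (gluedHomeo h).symm (gluedHomeo h p + gluedHomeo h q) := rfl
  have hneg (p : GluedSpace r σ) : -p = (gluedHomeo h).symm (-gluedHomeo h p) := rfl
  refine ⟨{ continuous_add := ?_, continuous_neg := ?_ }, fun a b z hz => ?_, fun a z hz => ?_⟩
  · simp only [hadd]
    fun_prop
  · simp only [hneg]
    fun_prop
  · rw [hadd, Homeomorph.symm_apply_eq, gluedHomeo_proj, gluedHomeo_proj, gluedHomeo_proj,
      ← h.code_add (h.le_of_mem a.2) (h.le_of_mem b.2)]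
    exact h.code_eq_of_isNormalization
      (fun n => add_le_add (h.le_of_mem a.2 n) (h.le_of_mem b.2 n)) hz
  · rw [hneg, Homeomorph.symm_apply_eq, gluedHomeo_proj, gluedHomeo_proj, ← h.code_reflect a.2]
    exact h.code_eq_of_isNormalization (reflect_le _) hz

lemma isNormalization_of_value_eq {x z : ℤ →₀ ℕ} (hz : ⇑z ∈ compactum r σ)
    (hzx : value r σ z = value r σ x) : IsNormalization r σ x z := by
  obtain ⟨B, hB⟩ : ∃ B : ℕ, ∀ n ∈ x.support ∪ z.support, n.natAbs < B :=
    ⟨(x.support ∪ z.support).sup Int.natAbs + 1, fun n hn =>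
      Nat.lt_succ_of_le (Finset.le_sup (f := Int.natAbs) hn)⟩
  have hzero (n : ℤ) (hn : B ≤ n.natAbs) : x n = 0 ∧ z n = 0 := by
    by_contra hne
    refine hn.not_gt (hB n ?_)
    rw [Finset.mem_union, Finsupp.mem_support_iff, Finsupp.mem_support_iff]
    lia
  refine ⟨hz, fun j => if j ≤ 0 then j - B else j + B, fun i j hij => ?_, fun j => ?_⟩
  · beta_reduce
    split_ifs <;> lia
  · obtain rfl | hj := eq_or_ne j 0
    · have hsub : x.support ∪ z.support ⊆ Finset.Ioc (-(B : ℤ)) (1 + B) := fun n hn => by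
        have := hB n hn
        rw [Finset.mem_Ioc]
        lia
      simp only [le_refl, if_true, zero_add, zero_sub, one_pos.not_ge, if_false]
      rw [← value_eq_sum x (Finset.subset_union_left.trans hsub),
        ← value_eq_sum z (Finset.subset_union_right.trans hsub), hzx]
    · refine Finset.sum_congr rfl fun n hn => ?_
      have hn : B ≤ n.natAbs := by
        simp only [Finset.mem_Ioc] at hn
        split_ifs at hn <;> lia
      rw [(hzero n hn).1, (hzero n hn).2]

/-- Finitely supported digit sequences have a normalization of their sum, and they are dense. -/
lemma IsNormalizationGroup.gluedHomeo_add (h : Admissible r σ) {G : AddCommGroup (GluedSpace r σ)}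
    (hG : IsNormalizationGroup r σ G) (p q : GluedSpace r σ) :
    gluedHomeo h (p + q) = gluedHomeo h p + gluedHomeo h q := by
  have := hG.isTopologicalAddGroup
  obtain ⟨a, rfl⟩ := proj_surjective p
  obtain ⟨b, rfl⟩ := proj_surjective q
  let trunc (a : compactum r σ) (s : Finset ℤ) : compactum r σ :=
    ⟨restrict s a, h.restrict_mem a.2 s⟩
  have hproj (a : compactum r σ) :
      Tendsto (fun s => proj r σ (trunc a s)) atTop (𝓝 (proj r σ a)) :=
    (continuous_proj.tendsto a).comp (tendsto_subtype_rng.2 (tendsto_restrict a))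
  have hhomeo (p : GluedSpace r σ) := (gluedHomeo h).continuous.tendsto p
  refine tendsto_nhds_unique ((hhomeo _).comp ((hproj a).add (hproj b)))
    ((((hhomeo _).comp (hproj a)).add ((hhomeo _).comp (hproj b))).congr fun s => ?_)
  obtain ⟨z, hz, hv⟩ := h.exists_finite_normalization (restrict s a + restrict s b)
  have hnorm := isNormalization_of_value_eq hz hv
  have hadd : proj r σ (trunc a s) + proj r σ (trunc b s) = proj r σ ⟨z, hz⟩ :=
    hG.proj_add _ _ ⟨z, hz⟩ hnorm
  have ha := h.le_of_mem (trunc a s).2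
  have hb := h.le_of_mem (trunc b s).2
  simp only [Function.comp_apply]
  rw [hadd, gluedHomeo_proj, gluedHomeo_proj, gluedHomeo_proj, ← h.code_add ha hb]
  exact h.code_eq_of_isNormalization (fun n => add_le_add (ha n) (hb n)) hnorm

theorem Admissible.existsUnique_isNormalizationGroup (h : Admissible r σ) :
    ∃! G : AddCommGroup (GluedSpace r σ), IsNormalizationGroup r σ G := by
  refine ⟨_, h.isNormalizationGroup, fun G hG => AddCommGroup.ext ?_⟩
  funext p q
  apply (gluedHomeo h).injective
  rw [hG.gluedHomeo_add h]
  exact ((gluedHomeo h).apply_symm_apply _).symm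

end GluedSpace

/-! ### Coding maps factor through the universal code -/

section Homoclinic

variable {r : ℕ} {σ : ℤ}

/-- The real sequences which modulo `1` are integer combinations of `green r σ` and its translate
by one place. -/
def greenLattice (r : ℕ) (σ : ℤ) : AddSubgroup (ℤ → ℝ) :=
  (AddSubgroup.closure {fun n => (green r σ n : UnitAddCircle),
    fun n => (green r σ (n - 1) : UnitAddCircle)}).comap
      ((QuotientAddGroup.mk' (AddSubgroup.zmultiples (1 : ℝ))).compLeft ℤ)

lemma mem_greenLattice {g : ℤ → ℝ} : g ∈ greenLattice r σ ↔ ∃ α β : ℤ, ∀ n, (g n : UnitAddCircle) =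
    α • (green r σ n : UnitAddCircle) + β • (green r σ (n - 1) : UnitAddCircle) := by
  rw [greenLattice, AddSubgroup.mem_comap, AddSubgroup.mem_closure_pair]
  exact exists₂_congr fun α β => funext_iff.trans (forall_congr' fun n => eq_comm)

lemma Admissible.green_translate_mem (h : Admissible r σ) (N : ℤ) :
    (fun n => green r σ (n - N)) ∈ greenLattice r σ := by
  refine h.mem_of_charOp_mem (p := fun N n => green r σ (n - N)) (fun N => ?_) ?_ ?_ N
  · refine mem_greenLattice.2 ⟨0, 0, fun n => ?_⟩
    rw [zero_smul, zero_smul, add_zero, coe_eq_zero_iff_exists_intCast]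
    refine ⟨if n - N = 0 then 1 else 0, ?_⟩
    have hrec := h.green_recursion (n - N)
    rw [show n - N - 1 = n - (N + 1) by ring, show n - N + 1 = n - (N - 1) by ring] at hrec
    simpa [charOp] using hrec.symm
  · exact mem_greenLattice.2 ⟨1, 0, fun n => by simp⟩
  · exact mem_greenLattice.2 ⟨0, 1, fun n => by simp⟩

lemma exists_small_lift (x : UnitAddCircle) :
    ∃ g : ℝ, (g : UnitAddCircle) = x ∧ |g| = ‖x‖ ∧ |g| ≤ 1 / 2 := by
  obtain ⟨y, rfl⟩ := QuotientAddGroup.mk_surjective x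
  refine ⟨y - round y, ?_, UnitAddCircle.norm_eq.symm, abs_sub_round y⟩
  rw [AddCircle.coe_sub, coe_intCast_eq_zero, sub_zero]

lemma tendsto_charOp_zero {q : ℤ → ℝ} (hq : Tendsto q cofinite (𝓝 0)) :
    Tendsto (charOp r σ q) cofinite (𝓝 0) := by
  have hnext : Tendsto (fun n => q (n + 1)) cofinite (𝓝 0) :=
    hq.comp (add_left_injective (1 : ℤ)).tendsto_cofinite
  have hprev : Tendsto (fun n => q (n - 1)) cofinite (𝓝 0) :=
    hq.comp (sub_left_injective (b := (1 : ℤ))).tendsto_cofinite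
  have hlim := ((hq.const_mul (r : ℝ)).sub hnext).sub (hprev.const_mul (σ : ℝ))
  rwa [mul_zero, mul_zero, sub_zero, sub_zero] at hlim

lemma finite_ne_zero_of_tendsto {d : ℤ → ℤ}
    (hd : Tendsto (fun n => (d n : ℝ)) cofinite (𝓝 0)) : {n | d n ≠ 0}.Finite := by
  refine (hd.eventually (eventually_abs_sub_lt 0 one_pos)).mono fun n hn => ?_
  rw [sub_zero] at hn
  exact Int.abs_lt_one_iff.1 (by exact_mod_cast hn)

lemma Admissible.reflection_mem_greenLattice (h : Admissible r σ) {q : ℤ → ℝ} {B : ℝ} {d : ℤ → ℤ}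
    (hq : ∀ n, |q n| ≤ B) (hd : ∀ n, charOp r σ q n = d n) (hfin : {n | d n ≠ 0}.Finite) :
    (fun n => q (-n)) ∈ greenLattice r σ := by
  have hsum : (fun n => q (-n)) = ∑ m ∈ hfin.toFinset, d m • fun n => green r σ (n - -m) := by
    ext n
    rw [← h.potential_charOp hq, potential, tsum_eq_sum (s := hfin.toFinset), Finset.sum_apply]
    · refine Finset.sum_congr rfl fun m _ => ?_
      simp only [hd, Pi.smul_apply, zsmul_eq_mul, sub_neg_eq_add, add_comm, mul_comm]
    · intro m hm
      rw [hd, show d m = 0 by simpa using hm, Int.cast_zero, mul_zero]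
  rw [hsum]
  exact sum_mem fun m _ => zsmul_mem (h.green_translate_mem (-m)) _

-- The lift of `τ` to `[-1/2, 1/2]` solves the recursion up to an integer defect, which tends to `0`
-- and is thus finitely supported.
lemma Admissible.eq_green_combination_of_recursion (h : Admissible r σ) {τ : ℤ → UnitAddCircle}
    (hrec : ∀ n, τ (n - 1) = (r : ℤ) • τ n - σ • τ (n + 1)) (hlim : Tendsto τ cofinite (𝓝 0)) :
    ∃ α β : ℤ, ∀ n, τ n =
      α • (green r σ n : UnitAddCircle) + β • (green r σ (n - 1) : UnitAddCircle) := by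
  choose g hcoe hnorm hbound using fun n => exists_small_lift (τ n)
  set q : ℤ → ℝ := fun n => g (-n)
  have hq0 : Tendsto q cofinite (𝓝 0) := by
    rw [tendsto_zero_iff_norm_tendsto_zero] at hlim ⊢
    exact (hlim.comp neg_injective.tendsto_cofinite).congr fun n => (hnorm (-n)).symm
  have hdefect n : ∃ d : ℤ, (d : ℝ) = charOp r σ q n := by
    rw [← coe_eq_zero_iff_exists_intCast, charOp, AddCircle.coe_sub, AddCircle.coe_sub,
      ← Int.cast_natCast, coe_intCast_mul, coe_intCast_mul, hcoe, hcoe, hcoe,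
      show -(n + 1) = -n - 1 by ring, hrec, show -(n - 1) = -n + 1 by ring]
    abel
  choose d hd using hdefect
  have hfin : {n | d n ≠ 0}.Finite :=
    finite_ne_zero_of_tendsto ((tendsto_charOp_zero hq0).congr fun n => (hd n).symm)
  have hmem := h.reflection_mem_greenLattice (fun n => hbound (-n)) (fun n => (hd n).symm) hfin
  simpa only [q, neg_neg, hcoe] using mem_greenLattice.1 hmem

end Homoclinic

section CodingMaps

variable {r : ℕ} {σ : ℤ}

lemma Admissible.mem_primarySpace (h : Admissible r σ) {B : ℕ} {a : ℤ → ℕ}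
    (ha : ∀ n, a n ≤ B) : a ∈ primarySpace (dominantRoot r σ) := by
  have hpos := h.dominantRoot_pos
  have hgeom : Summable fun n : ℕ => (B : ℝ) * (dominantRoot r σ)⁻¹ ^ (n + 1) :=
    ((summable_nat_add_iff 1).2 (summable_geometric_of_lt_one (inv_nonneg.2 hpos.le)
      (inv_lt_one_of_one_lt₀ h.one_lt_dominantRoot))).mul_left _
  have hsummable (f : ℕ → ℤ) : Summable fun n => (a (f n) : ℝ) / dominantRoot r σ ^ (n + 1) := by
    refine hgeom.of_nonneg_of_le (fun n => by positivity) fun n => ?_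
    rw [inv_pow, ← div_eq_mul_inv]
    have := ha (f n)
    gcongr
  exact ⟨hsummable fun n => n + 1, hsummable fun n => -(n + 1)⟩

lemma toralMap_toralMap {M : Matrix (Fin 2) (Fin 2) ℤ} (ht : M.trace = r) (hd : M.det = σ)
    (x : Torus) : toralMap M (toralMap M x) = (r : ℤ) • toralMap M x - σ • x := by
  have hsq : M * M = (r : ℤ) • M - σ • 1 := by
    have hCH := M.aeval_self_charpoly
    rw [Matrix.charpoly_fin_two, ht, hd, map_add, map_sub, map_mul, map_pow, Polynomial.aeval_X,
      Polynomial.aeval_C, Polynomial.aeval_C, Algebra.algebraMap_eq_smul_one,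
      Algebra.algebraMap_eq_smul_one, smul_one_mul, pow_two] at hCH
    rw [← sub_eq_zero, ← hCH]
    abel
  rw [← toralMap_mul, hsq]
  ext i
  fin_cases i <;> simp [toralMap_apply, -zsmul_eq_mul, -natCast_zsmul, -zsmul_one,
    sub_smul, mul_smul] <;> abel

lemma shift_unitDigit (n : ℤ) : shift (unitDigit n) = unitDigit (n - 1) := by
  ext m
  simp only [shift, unitDigit, Pi.single_apply, eq_sub_iff_add_eq]

lemma tendsto_unitDigit : Tendsto unitDigit cofinite (𝓝 0) := by
  refine tendsto_pi_nhds.2 fun m => tendsto_const_nhds.congr' ?_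
  filter_upwards [eventually_cofinite_ne m] with n hn
  simp [unitDigit, hn.symm]

lemma IsCodingMap.map_zero {M : Matrix (Fin 2) (Fin 2) ℤ} {lam : ℝ} {φ : (ℤ → ℕ) → Torus}
    (hφ : IsCodingMap M lam φ) : φ 0 = 0 := by
  have hmem : (0 : ℤ → ℕ) ∈ primarySpace lam := by simp [primarySpace, summable_zero]
  simpa using hφ.map_add 0 hmem 0 hmem

lemma IsCodingMap.unitDigit_recursion (h : Admissible r σ) {M : Matrix (Fin 2) (Fin 2) ℤ}
    (ht : M.trace = r) (hd : M.det = σ) {φ : (ℤ → ℕ) → Torus}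
    (hφ : IsCodingMap M (dominantRoot r σ) φ) (n : ℤ) :
    φ (unitDigit (n - 1)) = (r : ℤ) • φ (unitDigit n) - σ • φ (unitDigit (n + 1)) := by
  have hshift n : φ (unitDigit (n - 1)) = toralMap M (φ (unitDigit n)) := by
    rw [← shift_unitDigit, hφ.map_shift _ (h.mem_primarySpace (unitDigit_le n))]
  have hnext := hshift (n + 1)
  rw [add_sub_cancel_right] at hnext
  rw [hshift, hnext, toralMap_toralMap ht hd]

lemma IsCodingMap.tendsto_unitDigit {M : Matrix (Fin 2) (Fin 2) ℤ} {lam : ℝ}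
    {φ : (ℤ → ℕ) → Torus} (hφ : IsCodingMap M lam φ) :
    Tendsto (fun n => φ (unitDigit n)) cofinite (𝓝 0) := by
  have hcont : ContinuousWithinAt φ {ε | ∀ n, ε n ≤ 1} 0 := hφ.continuousOn 1 0 fun _ => zero_le_one
  rw [ContinuousWithinAt, hφ.map_zero] at hcont
  exact hcont.comp
    (tendsto_nhdsWithin_iff.2 ⟨ArithCoding.tendsto_unitDigit, .of_forall unitDigit_le⟩)

/-- `A` intertwines `code r σ` with `φ` on the sequences with bounded digits. -/
def FactorsThrough (r : ℕ) (σ : ℤ) (A : Matrix (Fin 2) (Fin 2) ℤ) (φ : (ℤ → ℕ) → Torus) : Prop :=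
  ∀ (B : ℕ) (a : ℤ → ℕ), (∀ n, a n ≤ B) → φ a = toralMap A (code r σ a)

lemma IsCodingMap.eq_toralMap_of_finsupp (h : Admissible r σ) {A M : Matrix (Fin 2) (Fin 2) ℤ}
    {φ : (ℤ → ℕ) → Torus} (hφ : IsCodingMap M (dominantRoot r σ) φ)
    (hunit : ∀ n, φ (unitDigit n) = toralMap A (code r σ (unitDigit n))) (a : ℤ →₀ ℕ) :
    φ a = toralMap A (code r σ a) := by
  have hle (a : ℤ →₀ ℕ) n : a n ≤ a.degree := Finsupp.le_degree n a
  have hadd (a b : ℤ →₀ ℕ) (ha : φ a = toralMap A (code r σ a))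
      (hb : φ b = toralMap A (code r σ b)) : φ ⇑(a + b) = toralMap A (code r σ ⇑(a + b)) := by
    rw [Finsupp.coe_add, hφ.map_add _ (h.mem_primarySpace (hle a)) _ (h.mem_primarySpace (hle b)),
      h.code_add (hle a) (hle b), toralMap_add, ha, hb]
  have hzero : φ ⇑(0 : ℤ →₀ ℕ) = toralMap A (code r σ ⇑(0 : ℤ →₀ ℕ)) := by
    have hcode : code r σ 0 = 0 := by
      simpa using h.code_add (a := 0) (b := 0) (fun _ => Nat.zero_le 0) fun _ => Nat.zero_le 0
    rw [Finsupp.coe_zero, hφ.map_zero, hcode]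
    exact ((toralHom A).map_zero).symm
  induction a using Finsupp.induction_linear with
  | zero => exact hzero
  | add a b ha hb => exact hadd a b ha hb
  | single n k =>
    induction k with
    | zero => rwa [Finsupp.single_zero]
    | succ k ih =>
      rw [Finsupp.single_add]
      refine hadd _ _ ih ?_
      rw [Finsupp.single_eq_pi_single]
      exact hunit n

theorem IsCodingMap.exists_factorsThrough (h : Admissible r σ) {M : Matrix (Fin 2) (Fin 2) ℤ}
    (ht : M.trace = r) (hd : M.det = σ) {φ : (ℤ → ℕ) → Torus}
    (hφ : IsCodingMap M (dominantRoot r σ) φ) :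
    ∃ A : Matrix (Fin 2) (Fin 2) ℤ, FactorsThrough r σ A φ := by
  choose α β hαβ using fun i => h.eq_green_combination_of_recursion
    (τ := fun n => φ (unitDigit n) i) (fun n => congrFun (hφ.unitDigit_recursion h ht hd n) i)
    (hφ.tendsto_unitDigit.apply_nhds i)
  set A : Matrix (Fin 2) (Fin 2) ℤ := Matrix.of fun i => ![α i, β i]
  have hunit n : φ (unitDigit n) = toralMap A (code r σ (unitDigit n)) := by
    ext i
    rw [hαβ i n, toralMap_apply, code_unitDigit]
    rfl
  refine ⟨A, fun B a ha => ?_⟩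
  have hle (s : Finset ℤ) n : restrict s a n ≤ B := (restrict_le s a n).trans (ha n)
  have hφlim := (hφ.continuousOn B a ha).tendsto.comp
    (tendsto_nhdsWithin_iff.2 ⟨tendsto_restrict a, .of_forall hle⟩)
  have hAlim := ((continuous_toralMap A).tendsto _).comp
    (h.tendsto_code hle ha (tendsto_restrict a))
  exact tendsto_nhds_unique hφlim
    (hAlim.congr fun s => (hφ.eq_toralMap_of_finsupp h hunit _).symm)

lemma eq_zero_of_toralMap_eq_zero {D : Matrix (Fin 2) (Fin 2) ℤ} (hD : ∀ x, toralMap D x = 0) :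
    D = 0 := by
  ext i j
  by_contra hne
  rw [Matrix.zero_apply] at hne
  have hne' : (D i j : ℝ) ≠ 0 := by exact_mod_cast hne
  have hzero : D i j • ((1 / (2 * (D i j : ℝ)) : ℝ) : UnitAddCircle) = 0 := by
    have := congrFun (hD (Pi.single j ((1 / (2 * (D i j : ℝ)) : ℝ) : UnitAddCircle))) i
    rw [toralMap_apply] at this
    fin_cases j <;> simpa [-zsmul_eq_mul] using this
  rw [← coe_intCast_mul, coe_eq_zero_iff_exists_intCast] at hzero
  obtain ⟨k, hk⟩ := hzero
  field_simp at hk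
  have : k * 2 = 1 := by exact_mod_cast hk
  lia

lemma Admissible.sq_ne_discr (h : Admissible r σ) (s : ℤ) : s ^ 2 ≠ (r : ℤ) ^ 2 - 4 * σ := by
  intro hs
  rw [← sq_abs] at hs
  have hnonneg := abs_nonneg s
  generalize |s| = s at hs hnonneg
  rcases h with ⟨rfl, hr⟩ | ⟨rfl, hr⟩
  · have hlower : (r : ℤ) < s := by nlinarith
    have hupper : s < r + 2 := by nlinarith
    obtain rfl : s = r + 1 := by lia
    ring_nf at hs
    lia
  · have hupper : s < (r : ℤ) := by nlinarith
    nlinarith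

lemma Admissible.form_ne_zero (h : Admissible r σ) {x y : ℤ} (hxy : x ≠ 0 ∨ y ≠ 0) :
    y ^ 2 - r * x * y + σ * x ^ 2 ≠ 0 := by
  intro hform
  have hx : x ≠ 0 := by
    rintro rfl
    exact hxy.elim (fun h => h rfl) fun h => h (by simpa using hform)
  have hsq : (2 * y - r * x) ^ 2 = ((r : ℤ) ^ 2 - 4 * σ) * x ^ 2 := by
    linear_combination 4 * hform
  obtain ⟨s, hs⟩ : x ∣ 2 * y - r * x := by
    rw [← Int.pow_dvd_pow_iff two_ne_zero, hsq]
    exact dvd_mul_left _ _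
  rw [hs, mul_pow, mul_comm] at hsq
  exact h.sq_ne_discr s (mul_right_cancel₀ (pow_ne_zero 2 hx) hsq)

-- The kernel of `A` is invariant under the companion matrix `S`, so a vector `v ≠ 0` in it yields a
-- matrix with columns `v`, `S v` that is annihilated by `A` although its determinant is not `0`.
lemma Admissible.det_ne_zero_of_intertwine (h : Admissible r σ) {A M : Matrix (Fin 2) (Fin 2) ℤ}
    (hA : A ≠ 0) (hAM : A * !![0, 1; -σ, (r : ℤ)] = M * A) : A.det ≠ 0 := by
  intro hdet
  obtain ⟨v, hv, hAv⟩ := Matrix.exists_mulVec_eq_zero_iff.2 hdet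
  have hv' : v 0 ≠ 0 ∨ v 1 ≠ 0 := by
    by_contra! hzero
    exact hv (by ext i; fin_cases i <;> simp [hzero])
  have hASv : A.mulVec (Matrix.mulVec !![0, 1; -σ, (r : ℤ)] v) = 0 := by
    rw [Matrix.mulVec_mulVec, hAM, ← Matrix.mulVec_mulVec, hAv, Matrix.mulVec_zero]
  set V : Matrix (Fin 2) (Fin 2) ℤ := !![v 0, v 1; v 1, -σ * v 0 + r * v 1] with hV
  have hAV : A * V = 0 := by
    ext i j
    have hi := congrFun hAv i
    have hSi := congrFun hASv i
    simp only [Matrix.mulVec, dotProduct, Fin.sum_univ_two, Pi.zero_apply, Matrix.of_apply,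
      Matrix.cons_val', Matrix.cons_val_zero, Matrix.cons_val_one, Matrix.cons_val_fin_one,
      zero_mul, one_mul, zero_add] at hi hSi
    fin_cases j
    · simpa [Matrix.mul_apply, Fin.sum_univ_two, hV] using hi
    · simpa [Matrix.mul_apply, Fin.sum_univ_two, hV] using hSi
  have hVdet : V.det ≠ 0 := by
    rw [hV, Matrix.det_fin_two_of]
    exact fun hzero => h.form_ne_zero hv' (by linear_combination -hzero)
  have hsmul : V.det • A = 0 := by
    rw [← Matrix.mul_one A, ← Matrix.mul_smul, ← Matrix.mul_adjugate, ← Matrix.mul_assoc, hAV,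
      Matrix.zero_mul]
  exact hA ((smul_eq_zero.1 hsmul).resolve_left hVdet)

lemma FactorsThrough.mul_companion (h : Admissible r σ) {M A : Matrix (Fin 2) (Fin 2) ℤ}
    {φ : (ℤ → ℕ) → Torus} (hA : FactorsThrough r σ A φ)
    (hφ : IsCodingMap M (dominantRoot r σ) φ) : A * !![0, 1; -σ, (r : ℤ)] = M * A := by
  rw [← sub_eq_zero]
  refine eq_zero_of_toralMap_eq_zero fun x => ?_
  obtain ⟨a, ha, rfl⟩ := h.code_surjOn (Set.mem_univ x)
  have hle := h.le_of_mem ha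
  have hshift : code r σ (shift a) = toralMap !![0, 1; -σ, (r : ℤ)] (code r σ a) :=
    h.torusCode_shift (cast_mem_boundedSeq hle)
  have hφshift := hφ.map_shift a (h.mem_primarySpace hle)
  rw [hA r a hle, hA r (shift a) fun n => hle _, hshift, ← toralMap_mul, ← toralMap_mul,
    ← sub_eq_zero] at hφshift
  rw [← hφshift]
  ext i
  simp only [toralMap_apply, Matrix.sub_apply, sub_smul, Pi.sub_apply]
  abel

theorem FactorsThrough.det_ne_zero (h : Admissible r σ) {M A : Matrix (Fin 2) (Fin 2) ℤ}
    {φ : (ℤ → ℕ) → Torus} (hA : FactorsThrough r σ A φ)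
    (hφ : IsCodingMap M (dominantRoot r σ) φ) (hne : ∃ a ∈ compactum r σ, φ a ≠ 0) :
    A.det ≠ 0 := by
  refine h.det_ne_zero_of_intertwine ?_ (hA.mul_companion h hφ)
  rintro rfl
  obtain ⟨a, ha, hφa⟩ := hne
  refine hφa ?_
  rw [hA r a (h.le_of_mem ha)]
  ext i
  simp [toralMap_apply]

end CodingMaps

/-! ### Nonsingular toral endomorphisms -/

section NonsingularMaps

variable {A : Matrix (Fin 2) (Fin 2) ℤ}

lemma toralMap_det_smul (x : Torus) : toralMap (A.det • 1) x = A.det • x := by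
  ext i
  rw [toralMap_apply]
  fin_cases i <;> simp [-zsmul_eq_mul, -zsmul_one]

lemma toralMap_surjective (hA : A.det ≠ 0) : Function.Surjective (toralMap A) := by
  have hdiv (u : UnitAddCircle) : ∃ v : UnitAddCircle, A.det • v = u := by
    obtain ⟨y, rfl⟩ := QuotientAddGroup.mk_surjective u
    refine ⟨((y / A.det : ℝ) : UnitAddCircle), ?_⟩
    rw [← coe_intCast_mul, mul_div_cancel₀ _ (Int.cast_ne_zero.2 hA)]
  intro x
  choose v hv using fun i => hdiv (x i)
  refine ⟨toralMap A.adjugate v, ?_⟩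
  rw [← toralMap_mul, Matrix.mul_adjugate, toralMap_det_smul]
  exact funext hv

lemma finite_ker_toralHom (hA : A.det ≠ 0) : ((toralHom A).ker : Set Torus).Finite := by
  have htorsion : {u : UnitAddCircle | A.det • u = 0}.Finite :=
    AddCircle.finite_torsion_of_isSMulRegular_int _ _ <|
      .of_right_eq_zero_of_smul fun _ h0 => (smul_eq_zero.1 h0).resolve_left hA
  refine (Set.Finite.pi' fun _ : Fin 2 => htorsion).subset fun x hx i => ?_
  have hx' : toralMap A x = 0 := hx
  have hdet : A.det • x = 0 := by
    rw [← toralMap_det_smul, ← Matrix.adjugate_mul, toralMap_mul, hx']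
    exact (toralHom A.adjugate).map_zero
  exact congrFun hdet i

/-- The degree of a toral endomorphism, as the number of elements of its kernel; it is `0` if the
kernel is infinite. -/
noncomputable def toralDegree (A : Matrix (Fin 2) (Fin 2) ℤ) : ℕ := Nat.card (toralHom A).ker

lemma toralDegree_pos (hA : A.det ≠ 0) : 0 < toralDegree A :=
  have : Finite (toralHom A).ker := finite_ker_toralHom hA
  Nat.card_pos

lemma ncard_fibre_toralMap (hA : A.det ≠ 0) (x : Torus) :
    {y | toralMap A y = x}.ncard = toralDegree A :=
  Nat.card_congr ((toralHom A).fiberEquivKerOfSurjective (toralMap_surjective hA) x)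

lemma measurePreserving_toralMap (hA : A.det ≠ 0) :
    MeasurePreserving (toralMap A) volume volume :=
  (toralHom A).measurePreserving (continuous_toralMap A) (toralMap_surjective hA) rfl

lemma volume_singleton_torus (x : Torus) : volume ({x} : Set Torus) = 0 := by
  have hcircle (u : UnitAddCircle) : volume ({u} : Set UnitAddCircle) = 0 := by
    simpa using AddCircle.volume_closedBall (T := 1) (x := u) 0
  rw [← Set.univ_pi_singleton, volume_pi, Measure.pi_pi]
  simp [hcircle]

lemma volume_image_toralMap (hA : A.det ≠ 0) {s : Set Torus} (hs : IsCompact s)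
    (hnull : volume s = 0) : volume (toralMap A '' s) = 0 := by
  rw [← (measurePreserving_toralMap hA).measure_preimage
    (hs.image (continuous_toralMap A)).isClosed.measurableSet.nullMeasurableSet]
  have hcover : toralMap A ⁻¹' (toralMap A '' s) ⊆
      ⋃ k ∈ ((toralHom A).ker : Set Torus), (fun x => x - k) ⁻¹' s := by
    rintro x ⟨y, hy, hyx⟩
    refine Set.mem_biUnion (x := x - y) ?_ (by simpa using hy)
    exact (toralHom A).sub_mem_ker_iff.2 hyx.symm
  refine measure_mono_null hcover
    ((measure_biUnion_null_iff (finite_ker_toralHom hA).countable).2 fun k _ => ?_)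
  simp only [sub_eq_add_neg, measure_preimage_add_right, hnull]

end NonsingularMaps

/-! ### Exceptional tails are negligible -/

lemma measure_eq_zero_of_contracting {X : Type*} [TopologicalSpace X] [MeasurableSpace X]
    [OpensMeasurableSpace X] {μ : Measure X} [μ.OuterRegular] {f : X → X}
    (hf : MeasurePreserving f μ μ) {x₀ : X} (hx₀ : μ {x₀} = 0) (F : ℕ → Set X)
    (hF : ∀ k, Set.MapsTo f (F k) (F (k + 1))) (hsmall : ∀ U ∈ 𝓝 x₀, ∃ k, F k ⊆ U) :
    μ (F 0) = 0 := by
  have hiter (k : ℕ) : F 0 ⊆ f^[k] ⁻¹' F k := by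
    induction k with
    | zero => exact subset_rfl
    | succ k ih =>
      rw [Function.iterate_succ']
      exact fun x hx => hF k (ih hx)
  refine le_antisymm (le_of_forall_gt fun ε hε => ?_) zero_le
  obtain ⟨U, hxU, hUo, hUε⟩ := Set.exists_isOpen_lt_of_lt {x₀} ε (by rwa [hx₀])
  obtain ⟨k, hk⟩ := hsmall U (hUo.mem_nhds (hxU rfl))
  calc μ (F 0) ≤ μ (f^[k] ⁻¹' U) := measure_mono fun x hx => hk (hiter k hx)
    _ = μ U := (hf.iterate k).measure_preimage hUo.measurableSet.nullMeasurableSet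
    _ < ε := hUε

section Tails

variable {r : ℕ} {σ : ℤ}

variable (r σ) in
/-- The codes of the integer sequences bounded by `B` that vanish on `s`. -/
def vanishingCodes (B : ℕ) (s : Set ℤ) : Set Torus :=
  torusCode r σ '' {d | d ∈ boundedSeq B ∧ ∀ n ∈ s, d n = 0}

lemma Admissible.exists_vanishingCodes_subset (h : Admissible r σ) (B : ℕ) {s : ℕ → Set ℤ}
    (hs : ∀ n, ∀ᶠ k in atTop, n ∈ s k) {U : Set Torus} (hU : U ∈ 𝓝 0) :
    ∃ k, vanishingCodes r σ B (s k) ⊆ U := by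
  by_contra! hnot
  have houtside k : ∃ d, (d ∈ boundedSeq B ∧ ∀ n ∈ s k, d n = 0) ∧ torusCode r σ d ∉ U := by
    obtain ⟨_, ⟨d, hd, rfl⟩, hdU⟩ := Set.not_subset.1 (hnot k)
    exact ⟨d, hd, hdU⟩
  choose d hd hdU using houtside
  have hzero : torusCode r σ 0 = 0 := by
    ext i
    fin_cases i <;> simp [torusCode, potential]
  have hlim := h.tendsto_torusCode (d := 0) (fun k => (hd k).1) (fun n => by simp) fun n =>
    (hs n).mono fun k hk => (hd k).2 n hk
  rw [hzero] at hlim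
  obtain ⟨k, hk⟩ := (hlim.eventually hU).exists
  exact hdU k hk

lemma Admissible.volume_vanishingCodes_Ioi (h : Admissible r σ) (B : ℕ) (N : ℤ) :
    volume (vanishingCodes r σ B (Set.Ioi N)) = 0 := by
  have hdet : (!![0, 1; -σ, r] : Matrix (Fin 2) (Fin 2) ℤ).det ≠ 0 := by
    rw [Matrix.det_fin_two_of]
    obtain rfl | rfl := h.eq_neg_one_or_one <;> simp
  have hmaps (k : ℕ) : Set.MapsTo (toralMap !![0, 1; -σ, r])
      (vanishingCodes r σ B (Set.Ioi (N - k)))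
      (vanishingCodes r σ B (Set.Ioi (N - (k + 1 : ℕ)))) := by
    rintro _ ⟨d, ⟨hd, hvanish⟩, rfl⟩
    rw [← h.torusCode_shift hd]
    refine ⟨_, ⟨fun n => hd _, fun n hn => hvanish _ ?_⟩, rfl⟩
    rw [Set.mem_Ioi] at hn ⊢
    lia
  have := measure_eq_zero_of_contracting (measurePreserving_toralMap hdet)
    (volume_singleton_torus 0) _ hmaps fun U hU =>
      h.exists_vanishingCodes_subset B (fun n => ?_) hU
  · simpa using this
  · filter_upwards [eventually_gt_atTop (N - n).toNat] with k hk
    rw [Set.mem_Ioi]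
    lia

lemma Admissible.volume_vanishingCodes_Iio (h : Admissible r σ) (B : ℕ) (N : ℤ) :
    volume (vanishingCodes r σ B (Set.Iio N)) = 0 := by
  have hdet : (!![σ * r, -σ; 1, 0] : Matrix (Fin 2) (Fin 2) ℤ).det ≠ 0 := by
    rw [Matrix.det_fin_two_of]
    obtain rfl | rfl := h.eq_neg_one_or_one <;> simp
  have hmaps (k : ℕ) : Set.MapsTo (toralMap !![σ * r, -σ; 1, 0])
      (vanishingCodes r σ B (Set.Iio (N + k)))
      (vanishingCodes r σ B (Set.Iio (N + (k + 1 : ℕ)))) := by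
    rintro _ ⟨d, ⟨hd, hvanish⟩, rfl⟩
    rw [← h.torusCode_unshift hd]
    refine ⟨_, ⟨fun n => hd _, fun n hn => hvanish _ ?_⟩, rfl⟩
    rw [Set.mem_Iio] at hn ⊢
    lia
  have := measure_eq_zero_of_contracting (measurePreserving_toralMap hdet)
    (volume_singleton_torus 0) _ hmaps fun U hU =>
      h.exists_vanishingCodes_subset B (fun n => ?_) hU
  · simpa using this
  · filter_upwards [eventually_gt_atTop (n - N).toNat] with k hk
    rw [Set.mem_Iio]
    lia

variable (r σ) in
/-- The codes of the sequences of digits `0, …, r` that agree with `c` on `s`. -/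
def tailCodes (s : Set ℤ) (c : ℤ → ℕ) : Set Torus :=
  code r σ '' {a | (∀ n, a n ≤ r) ∧ ∀ n ∈ s, a n = c n}

lemma Admissible.isCompact_tailCodes (h : Admissible r σ) (s : Set ℤ) (c : ℤ → ℕ) :
    IsCompact (tailCodes r σ s c) := by
  refine IsCompact.image_of_continuousOn ?_ ((h.continuousOn_code r).mono fun a ha => ha.1)
  refine (isCompact_boundedDigits r).inter_right (t := {a | ∀ n ∈ s, a n = c n}) ?_
  simp only [Set.ofPred_forall]
  exact isClosed_biInter fun n _ => isClosed_eq (continuous_apply n) continuous_const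

lemma Admissible.volume_tailCodes (h : Admissible r σ) {s : Set ℤ} {c : ℤ → ℕ}
    (hc : ∀ n, c n ≤ r) (hs : volume (vanishingCodes r σ (r + r) s) = 0) :
    volume (tailCodes r σ s c) = 0 := by
  have hsub : tailCodes r σ s c ⊆
      (fun x => x - code r σ c) ⁻¹' vanishingCodes r σ (r + r) s := by
    rintro _ ⟨a, ⟨ha, hac⟩, rfl⟩
    refine ⟨(fun n => (a n : ℤ)) - fun n => (c n : ℤ), ⟨fun n => ?_, fun n hn => ?_⟩, ?_⟩
    · have := ha n
      have := hc n
      rw [Pi.sub_apply, abs_le]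
      lia
    · simp [hac n hn]
    · exact h.torusCode_sub (cast_mem_boundedSeq ha) (cast_mem_boundedSeq hc)
  refine measure_mono_null hsub ?_
  simp only [sub_eq_add_neg, measure_preimage_add_right, hs]

variable (r σ) in
/-- The codes of the sequences of digits `0, …, r` with an exceptional tail. -/
def exceptionalCodes : Set Torus :=
  code r σ '' {a | (∀ n, a n ≤ r) ∧ HasExceptionalTail r a}

lemma Admissible.volume_image_exceptionalCodes (h : Admissible r σ)
    {A : Matrix (Fin 2) (Fin 2) ℤ} (hA : A.det ≠ 0) :
    volume (toralMap A '' exceptionalCodes r σ) = 0 := by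
  have hcover : toralMap A '' exceptionalCodes r σ ⊆ ⋃ N : ℤ,
      toralMap A '' tailCodes r σ (Set.Ioi N) 0 ∪ (toralMap A '' tailCodes r σ (Set.Iio N) 0 ∪
        ⋃ p : ℤ, toralMap A '' tailCodes r σ (Set.Iio N) (alternating r p)) := by
    rintro _ ⟨_, ⟨a, ⟨ha, N, hN⟩, rfl⟩, rfl⟩
    refine Set.mem_iUnion.2 ⟨N, ?_⟩
    obtain hN | hN | ⟨p, hN⟩ := hN
    · exact .inl ⟨_, ⟨a, ⟨ha, hN⟩, rfl⟩, rfl⟩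
    · exact .inr (.inl ⟨_, ⟨a, ⟨ha, hN⟩, rfl⟩, rfl⟩)
    · exact .inr (.inr (Set.mem_iUnion.2 ⟨p, _, ⟨a, ⟨ha, hN⟩, rfl⟩, rfl⟩))
  have hnull {s : Set ℤ} {c : ℤ → ℕ} (hc : ∀ n, c n ≤ r)
      (hs : volume (vanishingCodes r σ (r + r) s) = 0) :
      volume (toralMap A '' tailCodes r σ s c) = 0 :=
    volume_image_toralMap hA (h.isCompact_tailCodes s c) (h.volume_tailCodes hc hs)
  have halternating p n : alternating r p n ≤ r := by
    unfold alternating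
    split_ifs <;> simp
  refine measure_mono_null hcover ?_
  simp only [measure_iUnion_null_iff, measure_union_null_iff]
  exact fun N => ⟨hnull (fun _ => zero_le) (h.volume_vanishingCodes_Ioi _ N),
    hnull (fun _ => zero_le) (h.volume_vanishingCodes_Iio _ N),
    fun p => hnull (halternating p) (h.volume_vanishingCodes_Iio _ N)⟩

lemma Admissible.code_mem_exceptionalCodes (h : Admissible r σ) {a b : ℤ → ℕ}
    (ha : a ∈ compactum r σ) (hb : b ∈ compactum r σ) (hab : code r σ a = code r σ b)
    (hne : a ≠ b) : code r σ a ∈ exceptionalCodes r σ := by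
  obtain hta | htb := h.hasExceptionalTail_of_code_eq ha hb hab hne
  · exact ⟨a, ⟨h.le_of_mem ha, hta⟩, rfl⟩
  · exact ⟨b, ⟨h.le_of_mem hb, htb⟩, hab.symm⟩

theorem FactorsThrough.ae_ncard_fibre (h : Admissible r σ) {A : Matrix (Fin 2) (Fin 2) ℤ}
    {φ : (ℤ → ℕ) → Torus} (hA : FactorsThrough r σ A φ) (hdet : A.det ≠ 0) :
    ∀ᵐ x : Torus, {a ∈ compactum r σ | φ a = x}.ncard = toralDegree A := by
  filter_upwards [measure_eq_zero_iff_ae_notMem.1 (h.volume_image_exceptionalCodes hdet)] with x hx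
  have hφ {a} (ha : a ∈ compactum r σ) : φ a = toralMap A (code r σ a) := hA r a (h.le_of_mem ha)
  have himage : code r σ '' {a ∈ compactum r σ | φ a = x} = {y | toralMap A y = x} := by
    ext y
    constructor
    · rintro ⟨a, ⟨ha, hax⟩, rfl⟩
      exact (hφ ha).symm.trans hax
    · intro hy
      obtain ⟨a, ha, rfl⟩ := h.code_surjOn (Set.mem_univ y)
      exact ⟨a, ⟨ha, (hφ ha).trans hy⟩, rfl⟩
  have hinj : Set.InjOn (code r σ) {a ∈ compactum r σ | φ a = x} := by
    rintro a ⟨ha, hax⟩ b ⟨hb, -⟩ hab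
    by_contra hne
    exact hx ⟨_, h.code_mem_exceptionalCodes ha hb hab hne, (hφ ha).symm.trans hax⟩
  rw [← hinj.ncard_image, himage, ncard_fibre_toralMap hdet]

end Tails

section InducedHom

variable {r : ℕ} {σ : ℤ} {G : AddCommGroup (GluedSpace r σ)} {A : Matrix (Fin 2) (Fin 2) ℤ}

/-- The homomorphism from the factor space to the torus that the integer matrix `A` induces by way
of the homeomorphism `gluedHomeo`. -/
noncomputable def inducedHom (h : Admissible r σ) (hG : IsNormalizationGroup r σ G)
    (A : Matrix (Fin 2) (Fin 2) ℤ) : GluedSpace r σ →+ Torus :=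
  (toralHom A).comp (AddMonoidHom.mk' (gluedHomeo h) (hG.gluedHomeo_add h))

lemma continuous_inducedHom (h : Admissible r σ) (hG : IsNormalizationGroup r σ G) :
    Continuous (inducedHom h hG A) :=
  (continuous_toralMap A).comp (gluedHomeo h).continuous

lemma inducedHom_surjective (h : Admissible r σ) (hG : IsNormalizationGroup r σ G)
    (hA : A.det ≠ 0) : Function.Surjective (inducedHom h hG A) :=
  (toralMap_surjective hA).comp (gluedHomeo h).surjective

lemma ncard_fibre_inducedHom (h : Admissible r σ) (hG : IsNormalizationGroup r σ G)
    (hA : A.det ≠ 0) (x : Torus) : {p | inducedHom h hG A p = x}.ncard = toralDegree A := by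
  rw [← ncard_fibre_toralMap hA x]
  exact Set.ncard_preimage_of_injective_subset_range (s := {y | toralMap A y = x})
    (gluedHomeo h).injective fun y _ => (gluedHomeo h).surjective y

lemma quasiMeasurePreserving_inducedHom (h : Admissible r σ) (hG : IsNormalizationGroup r σ G)
    (hA : A.det ≠ 0) (μ : Measure (GluedSpace r σ)) [μ.IsAddHaarMeasure] :
    Measure.QuasiMeasurePreserving (inducedHom h hG A) μ volume := by
  have := hG.isTopologicalAddGroup
  have hmap : (Measure.map (gluedHomeo h) μ).IsAddHaarMeasure :=
    AddEquiv.isAddHaarMeasure_map μ (AddEquiv.mk' (gluedHomeo h).toEquiv (hG.gluedHomeo_add h))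
      (gluedHomeo h).continuous (gluedHomeo h).symm.continuous
  have hhomeo : Measure.QuasiMeasurePreserving (gluedHomeo h) μ volume :=
    ⟨(gluedHomeo h).continuous.measurable, Measure.absolutelyContinuous_isAddHaarMeasure _ _⟩
  exact (measurePreserving_toralMap hA).quasiMeasurePreserving.comp hhomeo

end InducedHom

end ArithCoding

open ArithCoding MeasureTheory in
theorem proposition1p4 (r : ℕ) (σ : ℤ) (hr : (σ = -1 ∧ 1 ≤ r) ∨ (σ = 1 ∧ 3 ≤ r)) :
    CompactSpace (GluedSpace r σ) ∧ T2Space (GluedSpace r σ) ∧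
    (∃! G : AddCommGroup (GluedSpace r σ), IsNormalizationGroup r σ G) ∧
    ∀ G : AddCommGroup (GluedSpace r σ), IsNormalizationGroup r σ G →
      ∀ M : Matrix (Fin 2) (Fin 2) ℤ, M.trace = (r : ℤ) → M.det = σ →
      ∀ φ : (ℤ → ℕ) → Torus, IsCodingMap M (dominantRoot r σ) φ →
        ∃ φ' : GluedSpace r σ →+ Torus,
          Continuous φ' ∧ (∀ a : compactum r σ, φ' (proj r σ a) = φ a) ∧
          ((∃ a ∈ compactum r σ, φ a ≠ 0) →
            Function.Surjective φ' ∧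
            ∃ K : ℕ, 0 < K ∧
              (∀ x : Torus, {p : GluedSpace r σ | φ' p = x}.ncard = K) ∧
              (∀ μ : Measure (GluedSpace r σ), μ.IsAddHaarMeasure →
                ∀ᵐ p ∂μ, {a ∈ compactum r σ | φ a = φ' p}.ncard = K) ∧
              ∀ᵐ x : Torus, {a ∈ compactum r σ | φ a = x}.ncard = K) := by
  have h : Admissible r σ := hr
  refine ⟨h.compactSpace, h.t2Space, h.existsUnique_isNormalizationGroup,
    fun G hG M ht hd φ hφ => ?_⟩
  obtain ⟨A, hA⟩ := hφ.exists_factorsThrough h ht hd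
  refine ⟨inducedHom h hG A, continuous_inducedHom h hG,
    fun a => (hA r a (h.le_of_mem a.2)).symm, fun hne => ?_⟩
  have hdet := hA.det_ne_zero h hφ hne
  have hae := hA.ae_ncard_fibre h hdet
  exact ⟨inducedHom_surjective h hG hdet, toralDegree A, toralDegree_pos hdet,
    ncard_fibre_inducedHom h hG hdet,
    fun μ _ => (quasiMeasurePreserving_inducedHom h hG hdet μ).ae hae, hae⟩
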